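/- Let $X$ be a normal irreducible projective variety over $\mathbf C$. A ($\mathbf Q$-)divisor on $X$ is a finite formal combination of prime divisors (irreducible closed subvarieties of codimension one) with coefficients in $\mathbf Z$ (resp. $\mathbf Q$). For an integral divisor $E$ let $H^0(X,\mathcal O(E))$ be the space of rational functions $f$ on $X$ with $f=0$ or $\operatorname{div}(f)+E\ge 0$. For a $\mathbf Q$-divisor $D$ let the Iitaka dimension $\kappa(D)$ be the maximum of the dimensions of the closures of the images of the rational maps $X\dashrightarrow \mathbf P(H^0(X,\mathcal O(mD)))$ over all integers $m>0$ such that $mD$ is integral and $H^0(X,\mathcal O(mD))\ne 0$, with $\kappa(D)=-\infty$ if there is no such $m$. An effective $\mathbf Q$-divisor $D$ (all coefficients $\ge 0$) is called rigid if $\kappa(D)=0$. (a) An effective $\mathbf Q$-divisor $D$ on $X$ is rigid if and only if there are finitely many distinct prime divisors $D_1,\dots,D_l$ ($l\ge 0$) and positive rational numbers $r_1,\dots,r_l$ such that $D=r_1D_1+\dots+r_lD_l$ and $$\dim_{\mathbf C} H^0(X,\mathcal O(n_1D_1+\dots+n_lD_l))=1\qquad\text{for all }(n_1,\dots,n_l)\in\mathbf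 Z_{\ge 0}^l .$$ (b) Let $D$ be a rigid $\mathbf Q$-divisor on $X$ and let $D_1,\dots,D_l$ be all the irreducible components of its support. For integers $n_1,\dots,n_l$ the divisor $n_1D_1+\dots+n_lD_l$ is principal if and only if $n_1=\dots=n_l=0$. (c) Suppose moreover that $X$ is smooth, and let $D$ and $D_1,\dots,D_l$ be as in (b). Then the sequence of groups $$0\to \mathbf Z[D_1]\oplus\dots\oplus\mathbf Z[D_l]\to \operatorname{Pic}(X)\to \operatorname{Pic}\Bigl(X\setminus\bigcup_{i=1}^l D_i\Bigr)\to 0$$ is exact, where the first map sends $\sum n_i[D_i]$ to the class of the invertible sheaf $\mathcal O(\sum n_iD_i)$ and the second map is restriction of invertible sheaves. (When $V$ is an $\mathcal L$-primitive variety with $\alpha_{\mathcal L}(V)>0$, $\rho:X\to\overline V^{\mathcal L}$ is a resolution of singularities of its $\mathcal L$-closure and $D$ is the rigid divisor with $\mathcal O(D)=\rho^*(L)^{\otimes\alpha_{\mathcal L}(V)}\otimes K_X$, the group on the right is by definition the $\mathcal L$-Picard group $\operatorname{Pic}(V,\mathcal L)$.) -/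

import Mathlib

open CategoryTheory MonoidalCategory TensorProduct

namespace RigidDivisors

theorem tensor_ker_aux {R M N P : Type*} [CommRing R] [AddCommGroup M] [AddCommGroup N] [AddCommGroup P]
    [Module R M] [Module R N] [Module R P] (f : M →ₗ[R] N) (z : M ⊗[R] P)
    (hz : LinearMap.rTensor P f z = 0) :
    ∃ (s : Finset P) (k : ℕ) (m : P → M) (a : P → Fin k → R) (y : Fin k → N),
      z = ∑ p ∈ s, m p ⊗ₜ p ∧ (∀ p ∈ s, f (m p) = ∑ j, a p j • y j) ∧ ∀ j, ∑ p ∈ s, a p j • p = 0 := by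
  classical
  let π : (P →₀ R) →ₗ[R] P := Finsupp.linearCombination R id
  have hπ : Function.Surjective π := fun p => ⟨Finsupp.single p 1, by simp [π]⟩
  obtain ⟨z', rfl⟩ := LinearMap.lTensor_surjective M hπ z
  have hw : LinearMap.rTensor (P →₀ R) f z' ∈ LinearMap.ker (LinearMap.lTensor N π) := by
    rw [LinearMap.mem_ker, ← hz, ← LinearMap.comp_apply, ← LinearMap.comp_apply,
      LinearMap.lTensor_comp_rTensor, LinearMap.rTensor_comp_lTensor]
  have hex := lTensor_exact (M := LinearMap.ker π) N π.exact_subtype_ker_map hπ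
  rw [hex.linearMap_ker_eq] at hw
  obtain ⟨w, hw⟩ := hw
  obtain ⟨k, y, κ, rfl⟩ := TensorProduct.exists_sum_tmul_eq w
  let c := TensorProduct.finsuppScalarRight R R M P
  have hz' : z' = (c z').sum (fun p m => m ⊗ₜ Finsupp.single p 1) := by
    apply c.injective
    simp only [Finsupp.sum, map_sum]
    conv_lhs => rw [← Finsupp.sum_single (c z')]
    simp only [Finsupp.sum, c]
    refine Finset.sum_congr rfl fun p _ => ?_
    rw [TensorProduct.finsuppScalarRight_apply_tmul]
    simp
  have key : ∀ p, f (c z' p) = ∑ j, (κ j : P →₀ R) p • y j := by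
    intro p
    have h1 : ∀ t : M ⊗[R] (P →₀ R), f (c t p) =
        TensorProduct.finsuppScalarRight R R N P (LinearMap.rTensor _ f t) p := by
      intro t
      induction t with
      | zero => simp
      | tmul m q => simp [c]
      | add a b ha hb => simp only [map_add, Finsupp.add_apply, ha, hb]
    rw [h1, ← hw]
    simp [Finsupp.finsetSum_apply]
  refine ⟨(c z').support ∪ Finset.univ.biUnion fun j => (κ j : P →₀ R).support, k,
    fun p => c z' p, fun p j => (κ j : P →₀ R) p, y, ?_, fun p _ => key p, fun j => ?_⟩
  · conv_lhs => rw [hz']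
    simp only [Finsupp.sum, map_sum]
    rw [Finset.sum_subset (Finset.subset_union_left)
      (f := fun p => LinearMap.lTensor M π (c z' p ⊗ₜ Finsupp.single p 1))]
    · refine Finset.sum_congr rfl fun p _ => by simp [π]
    · intro p _ hp
      simp [Finsupp.notMem_support_iff.mp hp]
  · have := (κ j).2
    rw [LinearMap.mem_ker, Finsupp.linearCombination_apply] at this
    rw [← this, Finsupp.sum]
    symm
    apply Finset.sum_subset
    · intro p hp
      simp only [Finset.mem_union, Finset.mem_biUnion]
      exact Or.inr ⟨j, Finset.mem_univ _, hp⟩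
    · intro p _ hp
      simp [Finsupp.notMem_support_iff.mp hp]

theorem sum_tmul_eq_zero_aux {R M P α : Type*} [CommRing R] [AddCommGroup M] [AddCommGroup P]
    [Module R M] [Module R P] {k : ℕ} (s : Finset α) (m : α → M) (p : α → P) (a : α → Fin k → R)
    (y : Fin k → M) (h : ∀ i ∈ s, m i = ∑ j, a i j • y j) (h' : ∀ j, ∑ i ∈ s, a i j • p i = 0) :
    ∑ i ∈ s, m i ⊗ₜ[R] p i = 0 := by
  rw [Finset.sum_congr rfl fun i hi => by rw [h i hi]]
  simp only [TensorProduct.sum_tmul, TensorProduct.smul_tmul]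
  rw [Finset.sum_comm]
  simp only [← TensorProduct.tmul_sum, h', TensorProduct.tmul_zero, Finset.sum_const_zero]

/-- Changing the base ring of a tensor product along an isomorphism of rings. -/
noncomputable def tensorChangeRing {A B M N : Type*} [CommRing A] [CommRing B] [AddCommGroup M] [AddCommGroup N]
    [Module A M] [Module A N] [Module B M] [Module B N] (e : B ≃+* A)
    (hM : ∀ (b : B) (m : M), b • m = e b • m) (hN : ∀ (b : B) (n : N), b • n = e b • n) :
    M ⊗[B] N ≃+ M ⊗[A] N :=
  AddMonoidHom.toAddEquiv
    (TensorProduct.liftAddHom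
      (AddMonoidHom.mk' (fun m => AddMonoidHom.mk' (fun n => m ⊗ₜ[A] n) (TensorProduct.tmul_add m))
        (fun m m' => AddMonoidHom.ext fun n => TensorProduct.add_tmul m m' n))
      (fun b m n => by
        change (b • m) ⊗ₜ[A] n = m ⊗ₜ[A] (b • n)
        rw [hM, hN, TensorProduct.smul_tmul]))
    (TensorProduct.liftAddHom
      (AddMonoidHom.mk' (fun m => AddMonoidHom.mk' (fun n => m ⊗ₜ[B] n) (TensorProduct.tmul_add m))
        (fun m m' => AddMonoidHom.ext fun n => TensorProduct.add_tmul m m' n))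
      (fun a m n => by
        obtain ⟨b, rfl⟩ := e.surjective a
        change (e b • m) ⊗ₜ[B] n = m ⊗ₜ[B] (e b • n)
        rw [← hM, ← hN, TensorProduct.smul_tmul]))
    (by
      ext x
      induction x with
      | zero => simp
      | tmul m n => rfl
      | add x y hx hy => rw [map_add, hx, hy, map_add])
    (by
      ext x
      induction x with
      | zero => simp
      | tmul m n => rfl
      | add x y hx hy => rw [map_add, hx, hy, map_add])

section
universe u v₁ u₁
variable {C : Type u₁} [Category.{v₁} C] (J : GrothendieckTopology C) {R : Cᵒᵖ ⥤ CommRingCat.{u}}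
  {M N : PresheafOfModules.{u} (R ⋙ forget₂ CommRingCat RingCat)}

theorem map_sum_tmul (P : PresheafOfModules.{u} (R ⋙ forget₂ CommRingCat RingCat)) {ι : Type*} (s : Finset ι)
    {U V : Cᵒᵖ} (i : U ⟶ V) (m : ι → M.obj U) (p : ι → P.obj U) :
    (M ⊗ P).presheaf.map i (∑ j ∈ s, (m j) ⊗ₜ[R.obj U] (p j) : (TensorProduct (R.obj U) (M.obj U) (P.obj U))) =
     (∑ j ∈ s, (M.presheaf.map i (m j)) ⊗ₜ[R.obj V] (P.presheaf.map i (p j)) : (TensorProduct (R.obj V) (M.obj V) (P.obj V))) := by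
  erw [map_sum]
  rfl

theorem locallySurjective_whiskerRight (f : M ⟶ N) (P : PresheafOfModules.{u} (R ⋙ forget₂ CommRingCat RingCat))
    [Presheaf.IsLocallySurjective J ((PresheafOfModules.toPresheaf _).map f)] :
    Presheaf.IsLocallySurjective J ((PresheafOfModules.toPresheaf _).map (f ▷ P)) where
  imageSieve_mem {U} s := by
    change TensorProduct (R.obj (.op U)) (N.obj (.op U)) (P.obj (.op U)) at s
    induction s with
    | zero =>
      convert J.top_mem U
      ext V i
      simp only [Sieve.top_apply, iff_true]
      refine ⟨0, ?_⟩
      exact (map_zero (((PresheafOfModules.toPresheaf _).map (f ▷ P)).app (.op V)).hom).trans (map_zero ((N ⊗ P).presheaf.map i.op).hom).symm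
    | tmul n p =>
      refine J.superset_covering ?_ (Presheaf.imageSieve_mem J ((PresheafOfModules.toPresheaf _).map f) (U := .op U) n)
      rintro V i ⟨t, ht⟩
      refine ⟨(t ⊗ₜ[R.obj (.op V)] (P.presheaf.map i.op p) : TensorProduct _ (M.obj _) (P.obj _)), ?_⟩
      have ht' : f.app (.op V) t = N.map i.op n := ht
      change (show N.obj (.op V) from f.app (.op V) t) ⊗ₜ[R.obj (.op V)] (show P.obj (.op V) from P.map i.op p) = _
      rw [ht']
      rfl
    | add x y hx hy =>
      refine J.superset_covering ?_ (J.intersection_covering hx hy)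
      rintro V i ⟨⟨t, ht⟩, ⟨t', ht'⟩⟩
      refine ⟨t + t', ?_⟩
      erw [map_add, map_add]
      rw [ht, ht']

theorem locallyInjective_whiskerRight (f : M ⟶ N) (P : PresheafOfModules.{u} (R ⋙ forget₂ CommRingCat RingCat))
    [Presheaf.IsLocallySurjective J ((PresheafOfModules.toPresheaf _).map f)]
    [Presheaf.IsLocallyInjective J ((PresheafOfModules.toPresheaf _).map f)] :
    Presheaf.IsLocallyInjective J ((PresheafOfModules.toPresheaf _).map (f ▷ P)) where
  equalizerSieve_mem {U} x y h := by
    change TensorProduct (R.obj U) (M.obj U) (P.obj U) at x y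
    have hz : LinearMap.rTensor (P.obj U) (ModuleCat.Hom.hom (R := R.obj U) (f.app U)) (x - y) = 0 := by
      rw [map_sub]
      exact sub_eq_zero.mpr h
    obtain ⟨s, k, m, a, t, h1, h2, h3⟩ := tensor_ker_aux _ _ hz
    -- simultaneous local preimages
    have hinf : ∀ {α : Type u} {X : C} (A : Finset α) (S : α → Sieve X), (∀ a ∈ A, S a ∈ J X) → A.inf S ∈ J X :=
      fun A S h => Finset.inf_induction (p := fun T => T ∈ J _) (J.top_mem _)
        (fun _ h₁ _ h₂ => J.intersection_covering h₁ h₂) h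
    have hcov : (Finset.univ.inf fun j : ULift.{u} (Fin k) =>
        Presheaf.imageSieve ((PresheafOfModules.toPresheaf _).map f) (t j.down)) ∈ J U.unop :=
      hinf _ _ fun j _ => Presheaf.imageSieve_mem J _ _
    refine J.transitive hcov _ fun V i hi => ?_
    have hi' : ∀ j, ∃ x' : M.obj (.op V), f.app (.op V) x' = N.map i.op (t j) := fun j => by
      have := (Finset.inf_le (f := fun j : ULift.{u} (Fin k) =>
        Presheaf.imageSieve ((PresheafOfModules.toPresheaf _).map f) (t j.down))
        (Finset.mem_univ (ULift.up j))) _ hi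
      exact this
    choose x' hx' using hi'
    have hcov2 : (s.inf fun p => Presheaf.equalizerSieve (F := M.presheaf) (X := .op V) (M.map i.op (m p))
        (∑ j, (R.map i.op (a p j)) • x' j : M.obj (.op V))) ∈ J V := by
      refine hinf _ _ fun p hp => ?_
      refine Presheaf.equalizerSieve_mem J ((PresheafOfModules.toPresheaf _).map f) (X := .op V) _ _ ?_
      change f.app (.op V) (M.map i.op (m p)) = f.app (.op V) (∑ j, (R.map i.op (a p j)) • x' j : M.obj (.op V))
      rw [PresheafOfModules.naturality_apply]
      have h4 : f.app U (m p) = ∑ j, a p j • t j := h2 p hp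
      rw [h4]
      refine (map_sum (N.restrictₛₗ i.op) _ _).trans (Eq.trans ?_ (map_sum (f.app (.op V)).hom _ _).symm)
      refine Finset.sum_congr rfl fun j _ => ?_
      refine ((N.restrictₛₗ i.op).map_smulₛₗ _ _).trans (Eq.trans ?_ ((f.app (.op V)).hom.map_smul _ _).symm)
      exact congrArg _ (hx' j).symm
    refine J.superset_covering ?_ hcov2
    intro W j hj
    have hj' : ∀ p ∈ s, M.map j.op (M.map i.op (m p)) = M.map j.op (∑ j, (R.map i.op (a p j)) • x' j : M.obj (.op V)) :=
      fun p hp => (Finset.inf_le (f := fun p => Presheaf.equalizerSieve (F := M.presheaf) (X := .op V) (M.map i.op (m p))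
        (∑ j, (R.map i.op (a p j)) • x' j : M.obj (.op V))) hp) _ hj
    change (M ⊗ P).presheaf.map (j ≫ i).op x = (M ⊗ P).presheaf.map (j ≫ i).op y
    rw [← sub_eq_zero]
    refine (map_sub ((M ⊗ P).presheaf.map (j ≫ i).op).hom x y).symm.trans ?_
    refine (congrArg ((M ⊗ P).presheaf.map (j ≫ i).op).hom h1).trans ?_
    refine (map_sum_tmul P s (j ≫ i).op m (fun p => p)).trans ?_
    have h5 : ∀ p ∈ s, (show M.obj (.op W) from M.presheaf.map (j ≫ i).op (m p)) =
        ∑ l, R.map (j ≫ i).op (a p l) • (show M.obj (.op W) from M.map j.op (x' l)) := by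
      intro p hp
      refine (M.map_comp_apply i.op j.op (m p)).trans ((hj' p hp).trans ?_)
      refine (map_sum (M.restrictₛₗ j.op) _ _).trans ?_
      refine Finset.sum_congr rfl fun l _ => ?_
      refine ((M.restrictₛₗ j.op).map_smulₛₗ _ _).trans ?_
      exact congrArg (fun r : R.obj (.op W) => r • (show M.obj (.op W) from M.map j.op (x' l)))
        (ConcreteCategory.congr_hom (R.map_comp i.op j.op) (a p l)).symm
    have h6 : ∀ l, ∑ p ∈ s, R.map (j ≫ i).op (a p l) • (show P.obj (.op W) from P.presheaf.map (j ≫ i).op p) = 0 := by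
      intro l
      refine Eq.trans ?_ ((congrArg (P.restrictₛₗ (j ≫ i).op) (h3 l)).trans (map_zero _))
      refine Eq.trans ?_ (map_sum (P.restrictₛₗ (j ≫ i).op) _ _).symm
      refine Finset.sum_congr rfl fun p _ => ?_
      exact ((P.restrictₛₗ (j ≫ i).op).map_smulₛₗ (a p l) p).symm
    exact sum_tmul_eq_zero_aux (R := R.obj (.op W)) s _ _ _ (fun l => M.map j.op (x' l)) h5 h6
end

open AlgebraicGeometry Opposite
universe u
variable {X : Scheme.{u}}

/-- The presheaf of modules over `𝒪_X` underlying a sheaf of modules. -/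
abbrev toPre (M : X.Modules) : PresheafOfModules.{u} (X.presheaf ⋙ forget₂ CommRingCat RingCat) := M.val

/-- Sheafification of presheaves of `𝒪_X`-modules. -/
noncomputable def sheafify : PresheafOfModules.{u} (X.presheaf ⋙ forget₂ CommRingCat RingCat) ⥤ X.Modules :=
  let F : PresheafOfModules.{u} X.ringCatSheaf.obj ⥤ SheafOfModules.{u} X.ringCatSheaf :=
    PresheafOfModules.sheafification (𝟙 X.ringCatSheaf.obj)
  F

/-- The tensor product `M ⊗ N` of sheaves of `𝒪_X`-modules: the sheaf associated with
`U ↦ M(U) ⊗ N(U)`. -/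
noncomputable def tensor (M N : X.Modules) : X.Modules :=
  sheafify.obj (toPre M ⊗ toPre N)

/-- A morphism of presheaves of modules is locally bijective. -/
structure LocBij {P Q : PresheafOfModules.{u} (X.presheaf ⋙ forget₂ CommRingCat RingCat)} (f : P ⟶ Q) : Prop where
  inj : Presheaf.IsLocallyInjective (Opens.grothendieckTopology X) ((PresheafOfModules.toPresheaf _).map f)
  surj : Presheaf.IsLocallySurjective (Opens.grothendieckTopology X) ((PresheafOfModules.toPresheaf _).map f)

theorem LocBij.isIso_sheafify {P Q : PresheafOfModules.{u} (X.presheaf ⋙ forget₂ CommRingCat RingCat)} {f : P ⟶ Q}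
    (hf : LocBij f) : IsIso (sheafify.map f) := by
  have h := PresheafOfModules.inverseImage_W_toPresheaf_eq_inverseImage_isomorphisms.{u} (𝟙 X.ringCatSheaf.obj)
  have : ((Opens.grothendieckTopology X).W.inverseImage (PresheafOfModules.toPresheaf X.ringCatSheaf.obj)) f := by
    exact (GrothendieckTopology.W_iff_isLocallyBijective (Opens.grothendieckTopology X) _).mpr ⟨hf.inj, hf.surj⟩
  rw [h] at this
  exact this

noncomputable def toSh (P : PresheafOfModules.{u} (X.presheaf ⋙ forget₂ CommRingCat RingCat)) :
    P ⟶ toPre (sheafify.obj P) :=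
  (PresheafOfModules.sheafificationAdjunction (𝟙 X.ringCatSheaf.obj)).unit.app P

theorem locBij_toSh (P : PresheafOfModules.{u} (X.presheaf ⋙ forget₂ CommRingCat RingCat)) : LocBij (toSh P) where
  inj := by
    change Presheaf.IsLocallyInjective _ (CategoryTheory.toSheafify (Opens.grothendieckTopology X) P.presheaf)
    infer_instance
  surj := by
    change Presheaf.IsLocallySurjective _ (CategoryTheory.toSheafify (Opens.grothendieckTopology X) P.presheaf)
    infer_instance

noncomputable def sheafifyToPre (M : X.Modules) : sheafify.obj (toPre M) ≅ M :=
  (asIso (PresheafOfModules.sheafificationAdjunction (𝟙 X.ringCatSheaf.obj)).counit).app M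

theorem LocBij.whiskerRight {P Q : PresheafOfModules.{u} (X.presheaf ⋙ forget₂ CommRingCat RingCat)} {f : P ⟶ Q}
    (hf : LocBij f) (S : PresheafOfModules.{u} (X.presheaf ⋙ forget₂ CommRingCat RingCat)) : LocBij (f ▷ S) := by
  have := hf.inj
  have := hf.surj
  exact ⟨locallyInjective_whiskerRight _ f S, locallySurjective_whiskerRight _ f S⟩

theorem tensor_assoc (M N P : X.Modules) : Nonempty (tensor (tensor M N) P ≅ tensor M (tensor N P)) := by
  have h1 := ((locBij_toSh (toPre M ⊗ toPre N)).whiskerRight (toPre P)).isIso_sheafify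
  have h2 := ((locBij_toSh (toPre N ⊗ toPre P)).whiskerRight (toPre M)).isIso_sheafify
  exact ⟨(asIso (sheafify.map (toSh (toPre M ⊗ toPre N) ▷ toPre P))).symm ≪≫ sheafify.mapIso (α_ _ _ _) ≪≫
    sheafify.mapIso (β_ _ _) ≪≫ asIso (sheafify.map (toSh (toPre N ⊗ toPre P) ▷ toPre M)) ≪≫ sheafify.mapIso (β_ _ _)⟩

/-- The structure sheaf as a module over itself. -/
noncomputable abbrev structureModule (X : Scheme.{u}) : X.Modules := SheafOfModules.unit X.ringCatSheaf

theorem tensor_unit (M : X.Modules) : Nonempty (tensor (structureModule X) M ≅ M) :=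
  ⟨sheafify.mapIso (λ_ (toPre M)) ≪≫ sheafifyToPre M⟩

theorem tensor_comm (M N : X.Modules) : Nonempty (tensor M N ≅ tensor N M) :=
  ⟨sheafify.mapIso (β_ (toPre M) (toPre N))⟩

theorem tensor_congr {M M' N N' : X.Modules} (e : M ≅ M') (e' : N ≅ N') : Nonempty (tensor M N ≅ tensor M' N') :=
  ⟨sheafify.mapIso (MonoidalCategory.tensorIso (X := toPre M) (Y := toPre M') (X' := toPre N) (Y' := toPre N') 
    ((SheafOfModules.forget _).mapIso e) ((SheafOfModules.forget _).mapIso e'))⟩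

/-- Isomorphism classes of sheaves of `𝒪_X`-modules. -/
def IsoClass (X : Scheme.{u}) : Type (u + 1) := Quotient (isIsomorphicSetoid X.Modules)

def IsoClass.mk (M : X.Modules) : IsoClass X := Quotient.mk _ M

noncomputable instance : CommMonoid (IsoClass X) where
  mul := Quotient.map₂ tensor fun _ _ ⟨e⟩ _ _ ⟨e'⟩ => tensor_congr e e'
  one := IsoClass.mk (structureModule X)
  mul_assoc := by
    rintro ⟨M⟩ ⟨N⟩ ⟨P⟩
    exact Quotient.sound (tensor_assoc M N P)
  mul_comm := by
    rintro ⟨M⟩ ⟨N⟩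
    exact Quotient.sound (tensor_comm M N)
  one_mul := by
    rintro ⟨M⟩
    exact Quotient.sound (tensor_unit M)
  mul_one := by
    rintro ⟨M⟩
    exact Quotient.sound ⟨(tensor_comm _ _).some ≪≫ (tensor_unit M).some⟩


section restrict
variable {Y : Scheme.{u}} (j : Y ⟶ X) [IsOpenImmersion j]

/-- The image of `m ⊗ n` in `Γ(U, M ⊗ N)`. -/
noncomputable def tmulSection (M N : X.Modules) (U : X.Opens) :
    (toPre M).obj (op U) →ₗ[Γ(X, U)] (toPre N).obj (op U) →ₗ[Γ(X, U)] (toPre (tensor M N)).obj (op U) :=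
  LinearMap.compr₂ (TensorProduct.mk Γ(X, U) ((toPre M).obj (op U)) ((toPre N).obj (op U)))
    (ModuleCat.Hom.hom (R := Γ(X, U)) ((toSh (toPre M ⊗ toPre N)).app (op U)))

theorem tmulSection_map (M N : X.Modules) {U V : X.Opens} (i : op U ⟶ op V) (m : (toPre M).obj (op U))
    (n : (toPre N).obj (op U)) :
    (toPre (tensor M N)).map i (tmulSection M N U m n) =
      tmulSection M N V ((toPre M).map i m) ((toPre N).map i n) :=
  (PresheafOfModules.naturality_apply (toSh (toPre M ⊗ toPre N)) i
    (m ⊗ₜ[Γ(X, U)] n : TensorProduct Γ(X, U) ((toPre M).obj (op U)) ((toPre N).obj (op U)))).symm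

/-- The canonical pairing of the restrictions of `M` and `N` with values in the restriction of `M ⊗ N`. -/
noncomputable def restrictPairing (M N : X.Modules) :
    toPre (M.restrict j) ⊗ toPre (N.restrict j) ⟶ toPre ((tensor M N).restrict j) where
  app V := by
    refine ModuleCat.MonoidalCategory.tensorLift (R := Y.presheaf.obj V)
      (M₁ := (toPre (M.restrict j)).obj V) (M₂ := (toPre (N.restrict j)).obj V)
      (M₃ := (toPre ((tensor M N).restrict j)).obj V)
      (fun m n => tmulSection M N (j ''ᵁ V.unop) m n)
      ?_ ?_ ?_ ?_
    · intro m₁ m₂ n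
      exact LinearMap.map_add₂ (tmulSection M N (j ''ᵁ V.unop)) m₁ m₂ n
    · intro a m n
      exact LinearMap.map_smul₂ (tmulSection M N (j ''ᵁ V.unop)) ((j.appIso V.unop).inv a) m n
    · intro m n₁ n₂
      exact (tmulSection M N (j ''ᵁ V.unop) m).map_add n₁ n₂
    · intro a m n
      exact (tmulSection M N (j ''ᵁ V.unop) m).map_smul ((j.appIso V.unop).inv a) n
  naturality {V W} i := by
    refine ModuleCat.MonoidalCategory.tensor_ext (R := Y.presheaf.obj V)
      (M₁ := (toPre (M.restrict j)).obj V) (M₂ := (toPre (N.restrict j)).obj V) ?_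
    intro m n
    exact (tmulSection_map M N ((j.opensFunctor.map i.unop).op) m n).symm

theorem restrictPairing_tmul (M N : X.Modules) (V : Y.Opens) (m : (toPre (M.restrict j)).obj (op V))
    (n : (toPre (N.restrict j)).obj (op V)) :
    (restrictPairing j M N).app (op V) (m ⊗ₜ[Γ(Y, V)] n :
      TensorProduct Γ(Y, V) ((toPre (M.restrict j)).obj (op V)) ((toPre (N.restrict j)).obj (op V))) =
    tmulSection M N (j ''ᵁ V) m n := rfl


theorem image_sieve_mem {V : Y.Opens} {S : Sieve (j ''ᵁ V)} (hS : S ∈ Opens.grothendieckTopology X (j ''ᵁ V))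
    {T : Sieve V} (hST : ∀ (W : Y.Opens) (i : W ⟶ V), S.arrows (j.opensFunctor.map i) → T.arrows i) :
    T ∈ Opens.grothendieckTopology Y V := by
  intro y hy
  obtain ⟨W, i, hi, hyW⟩ := hS (j y) ⟨y, hy, rfl⟩
  refine ⟨j ⁻¹ᵁ W ⊓ V, homOfLE inf_le_right, hST _ _ ?_, hyW, hy⟩
  have hle : j ''ᵁ (j ⁻¹ᵁ W ⊓ V) ≤ W := by
    rintro _ ⟨z, hz, rfl⟩
    exact hz.1
  exact S.downward_closed hi (homOfLE hle)

/-- Sections over `V` of the two presheaf tensor products agree. -/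
noncomputable def restrictChange (M N : X.Modules) (V : Y.Opens) :
    (toPre (M.restrict j) ⊗ toPre (N.restrict j)).obj (op V) ≃+ (toPre M ⊗ toPre N).obj (op (j ''ᵁ V)) :=
  letI : Module Γ(Y, V) ((toPre M).obj (op (j ''ᵁ V))) := ((toPre (M.restrict j)).obj (op V)).isModule
  letI : Module Γ(Y, V) ((toPre N).obj (op (j ''ᵁ V))) := ((toPre (N.restrict j)).obj (op V)).isModule
  tensorChangeRing (A := Γ(X, j ''ᵁ V)) (B := Γ(Y, V)) (M := (toPre M).obj (op (j ''ᵁ V)))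
    (N := (toPre N).obj (op (j ''ᵁ V)))
    (j.appIso V).symm.commRingCatIsoToRingEquiv (fun _ _ => rfl) (fun _ _ => rfl)

theorem restrictPairing_apply (M N : X.Modules) (V : Y.Opens)
    (x : (toPre (M.restrict j) ⊗ toPre (N.restrict j)).obj (op V)) :
    (restrictPairing j M N).app (op V) x =
      (toSh (toPre M ⊗ toPre N)).app (op (j ''ᵁ V)) (restrictChange j M N V x) := by
  change TensorProduct Γ(Y, V) ((toPre (M.restrict j)).obj (op V)) ((toPre (N.restrict j)).obj (op V)) at x
  induction x with
  | zero =>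
    exact (map_zero ((restrictPairing j M N).app (op V)).hom).trans
      (((congrArg ((toSh (toPre M ⊗ toPre N)).app (op (j ''ᵁ V))).hom (map_zero (restrictChange j M N V))).trans
        (map_zero _)).symm)
  | tmul m n => rfl
  | add x y hx hy =>
    refine (map_add ((restrictPairing j M N).app (op V)).hom x y).trans ?_
    refine (congrArg₂ (· + ·) hx hy).trans ?_
    refine (map_add ((toSh (toPre M ⊗ toPre N)).app (op (j ''ᵁ V))).hom _ _).symm.trans ?_
    exact congrArg ((toSh (toPre M ⊗ toPre N)).app (op (j ''ᵁ V))).hom (map_add (restrictChange j M N V) x y).symm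

theorem restrictChange_map (M N : X.Modules) {V W : Y.Opens} (i : W ⟶ V)
    (x : (toPre (M.restrict j) ⊗ toPre (N.restrict j)).obj (op V)) :
    restrictChange j M N W ((toPre (M.restrict j) ⊗ toPre (N.restrict j)).map i.op x) =
      (toPre M ⊗ toPre N).map (j.opensFunctor.map i).op (restrictChange j M N V x) := by
  change TensorProduct Γ(Y, V) ((toPre (M.restrict j)).obj (op V)) ((toPre (N.restrict j)).obj (op V)) at x
  induction x with
  | zero =>
    refine (congrArg (restrictChange j M N W)
      (map_zero ((toPre (M.restrict j) ⊗ toPre (N.restrict j)).map i.op).hom)).trans ?_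
    refine (map_zero (restrictChange j M N W)).trans ?_
    refine Eq.trans ?_ (congrArg ((toPre M ⊗ toPre N).map (j.opensFunctor.map i).op).hom
      (map_zero (restrictChange j M N V)).symm)
    exact (map_zero ((toPre M ⊗ toPre N).map (j.opensFunctor.map i).op).hom).symm
  | tmul m n => rfl
  | add x y hx hy =>
    refine (congrArg (restrictChange j M N W)
      (map_add ((toPre (M.restrict j) ⊗ toPre (N.restrict j)).map i.op).hom x y)).trans ?_
    refine (map_add (restrictChange j M N W) _ _).trans ?_
    refine (congrArg₂ (· + ·) hx hy).trans ?_
    refine Eq.trans ?_ (congrArg ((toPre M ⊗ toPre N).map (j.opensFunctor.map i).op).hom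
      (map_add (restrictChange j M N V) x y).symm)
    exact (map_add ((toPre M ⊗ toPre N).map (j.opensFunctor.map i).op).hom _ _).symm

theorem locBij_restrictPairing (M N : X.Modules) : LocBij (restrictPairing j M N) where
  inj := ⟨fun {V} x y h => by
    have h' : (toSh (toPre M ⊗ toPre N)).app (op (j ''ᵁ V.unop)) (restrictChange j M N V.unop x) =
        (toSh (toPre M ⊗ toPre N)).app (op (j ''ᵁ V.unop)) (restrictChange j M N V.unop y) :=
      (restrictPairing_apply j M N V.unop x).symm.trans (Eq.trans h (restrictPairing_apply j M N V.unop y))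
    have := (locBij_toSh (toPre M ⊗ toPre N)).inj
    refine image_sieve_mem j (Presheaf.equalizerSieve_mem (Opens.grothendieckTopology X)
      ((PresheafOfModules.toPresheaf _).map (toSh (toPre M ⊗ toPre N))) (X := op (j ''ᵁ V.unop)) _ _ h') ?_
    intro W i hi
    apply (restrictChange j M N W).injective
    exact (restrictChange_map j M N i x).trans (Eq.trans hi (restrictChange_map j M N i y).symm)⟩
  surj := ⟨fun {V} s => by
    have := (locBij_toSh (toPre M ⊗ toPre N)).surj
    refine image_sieve_mem j (Presheaf.imageSieve_mem (Opens.grothendieckTopology X)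
      ((PresheafOfModules.toPresheaf _).map (toSh (toPre M ⊗ toPre N))) (U := op (j ''ᵁ V)) s) ?_
    rintro W i ⟨t, ht⟩
    refine ⟨(restrictChange j M N W).symm t, ?_⟩
    refine (restrictPairing_apply j M N W _).trans (Eq.trans ?_ ht)
    exact congrArg ((toSh (toPre M ⊗ toPre N)).app (op (j ''ᵁ W))).hom ((restrictChange j M N W).apply_symm_apply t)⟩

theorem tensor_restrict (M N : X.Modules) :
    Nonempty ((tensor M N).restrict j ≅ tensor (M.restrict j) (N.restrict j)) := by
  have := (locBij_restrictPairing j M N).isIso_sheafify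
  exact ⟨((asIso (sheafify.map (restrictPairing j M N))) ≪≫ sheafifyToPre _).symm⟩

/-- Restriction of isomorphism classes of modules along an open immersion. -/
noncomputable def IsoClass.restrict : IsoClass X →* IsoClass Y where
  toFun := Quotient.map (fun M => M.restrict j) fun _ _ ⟨e⟩ => ⟨(Scheme.Modules.restrictFunctor j).mapIso e⟩
  map_one' := Quotient.sound ⟨Scheme.Modules.restrictUnitIso j⟩
  map_mul' := by
    rintro ⟨M⟩ ⟨N⟩
    exact Quotient.sound (tensor_restrict j M N)

theorem IsoClass.restrict_mk (M : X.Modules) : IsoClass.restrict j (IsoClass.mk M) = IsoClass.mk (M.restrict j) := rfl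

theorem IsoClass.restrict_comp {Z : Scheme.{u}} (k : Z ⟶ Y) [IsOpenImmersion k] (c : IsoClass X) :
    IsoClass.restrict (k ≫ j) c = IsoClass.restrict k (IsoClass.restrict j c) := by
  obtain ⟨M⟩ := c
  exact Quotient.sound ⟨(Scheme.Modules.restrictFunctorComp k j).app M⟩

theorem IsoClass.restrict_eq_one {Z : Scheme.{u}} (k : Z ⟶ X) [IsOpenImmersion k] (c : IsoClass X)
    (h : IsoClass.restrict j c = 1) (hk : Set.range k ⊆ Set.range j) : IsoClass.restrict k c = 1 := by
  have e := IsOpenImmersion.lift_fac j k hk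
  have : IsOpenImmersion (IsOpenImmersion.lift j k hk) := by
    have : IsOpenImmersion (IsOpenImmersion.lift j k hk ≫ j) := by rw [e]; infer_instance
    exact IsOpenImmersion.of_comp _ j
  have h' := IsoClass.restrict_comp j (IsOpenImmersion.lift j k hk) c
  rw [h, map_one] at h'
  rw [← h']
  congr 1
  simp only [e]

/-- A class of modules is locally trivial if it is the class of a module that is locally isomorphic to `𝒪_X`,
that is, of an invertible sheaf. -/
def IsoClass.LocallyTrivial (c : IsoClass X) : Prop :=
  ∀ x : X, ∃ U : X.Opens, x ∈ U ∧ IsoClass.restrict U.ι c = 1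

/-- The Picard group: isomorphism classes of invertible sheaves (modules that are locally isomorphic to `𝒪_X`)
under the tensor product. It is written as a subgroup of the group of units of the monoid of all
isomorphism classes of modules. -/
noncomputable def Pic (X : Scheme.{u}) : Subgroup (IsoClass X)ˣ where
  carrier := {c | (c : IsoClass X).LocallyTrivial}
  one_mem' x := ⟨⊤, trivial, map_one _⟩
  mul_mem' := by
    intro a b ha hb x
    obtain ⟨U, hxU, hU⟩ := ha x
    obtain ⟨V, hxV, hV⟩ := hb x
    refine ⟨U ⊓ V, ⟨hxU, hxV⟩, ?_⟩
    rw [Units.val_mul, map_mul, IsoClass.restrict_eq_one U.ι (U ⊓ V).ι _ hU (by simp),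
      IsoClass.restrict_eq_one V.ι (U ⊓ V).ι _ hV (by simp), one_mul]
  inv_mem' := by
    intro a ha x
    obtain ⟨U, hxU, hU⟩ := ha x
    refine ⟨U, hxU, ?_⟩
    have h : IsoClass.restrict U.ι ((a⁻¹ : (IsoClass X)ˣ) : IsoClass X) * IsoClass.restrict U.ι (a : IsoClass X) = 1 := by
      rw [← map_mul, ← Units.val_mul, inv_mul_cancel, Units.val_one, map_one]
    rwa [hU, mul_one] at h

/-- Restriction of invertible sheaves `Pic X → Pic Y` along an open immersion `Y ⟶ X`. -/
noncomputable def Pic.restrict : Pic X →* Pic Y :=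
  ((Units.map (IsoClass.restrict j)).comp (Pic X).subtype).codRestrict (Pic Y) (by
    rintro ⟨a, ha⟩ y
    obtain ⟨U, hU, h⟩ := ha (j y)
    refine ⟨j ⁻¹ᵁ U, hU, ?_⟩
    change IsoClass.restrict (j ⁻¹ᵁ U).ι (IsoClass.restrict j (a : IsoClass X)) = 1
    rw [← IsoClass.restrict_comp]
    refine IsoClass.restrict_eq_one U.ι _ _ h ?_
    rintro _ ⟨z, rfl⟩
    exact ⟨⟨_, z.2⟩, rfl⟩)

end restrict


/-- A scheme is normal if all its local rings are integrally closed domains. -/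
class IsNormalScheme (X : Scheme.{u}) [IsIntegral X] : Prop where
  stalk_isIntegrallyClosed (x : X) : IsIntegrallyClosed (X.presheaf.stalk x)

/-- A prime divisor, given by its generic point: a point whose closure has codimension one. -/
@[ext]
structure PrimeDivisor (X : Scheme.{u}) where
  /-- the generic point -/
  point : X
  coheight_point : Order.coheight point = 1

/-- The codimension one irreducible closed subset with generic point `P`. -/
def PrimeDivisor.carrier (P : PrimeDivisor X) : Set X := closure {P.point}

/-- Weil divisors with coefficients in `ℤ`. -/
abbrev WeilDivisor (X : Scheme.{u}) := PrimeDivisor X →₀ ℤ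
abbrev QDivisor (X : Scheme.{u}) := PrimeDivisor X →₀ ℚ

section
variable [IsIntegral X] [IsLocallyNoetherian X]

/-- `D` is the divisor of a nonzero rational function. -/
def IsPrincipal (D : WeilDivisor X) : Prop :=
  ∃ f : X.functionField, f ≠ 0 ∧ ∀ P : PrimeDivisor X, D P = Scheme.ord f P.point

theorem isDVR_stalk [IsNormalScheme X] (P : PrimeDivisor X) : IsDiscreteValuationRing (X.presheaf.stalk P.point) := by
  have h1 : ringKrullDim (X.presheaf.stalk P.point) = 1 := by
    rw [ringKrullDim_stalk_eq_coheight, P.coheight_point]; rfl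
  have hf : ¬ IsField (X.presheaf.stalk P.point) := by
    intro h
    rw [ringKrullDim_eq_zero_of_isField h] at h1
    exact zero_ne_one h1
  have hn := IsNormalScheme.stalk_isIntegrallyClosed P.point
  have : Ring.KrullDimLE 1 (X.presheaf.stalk P.point) := krullDimLE_of_coheight_le P.coheight_point.le
  have : Ring.DimensionLEOne (X.presheaf.stalk P.point) :=
    ⟨fun {p} _ _ => (Ring.krullDimLE_one_iff_of_noZeroDivisors.mp this p ‹_› ‹_›)⟩
  have : IsDedekindRing (X.presheaf.stalk P.point) := { hn, this with }
  have : IsDedekindDomain (X.presheaf.stalk P.point) := { this with }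
  exact ((IsDiscreteValuationRing.TFAE _ hf).out 0 2).mpr this

/-- The condition `f ∈ Γ(U, 𝒪(D))` on a rational function `f`. -/
def IsSectionOn (D : WeilDivisor X) (U : X.Opens) (f : X.functionField) : Prop :=
  f = 0 ∨ ∀ P : PrimeDivisor X, P.point ∈ U → 0 ≤ Scheme.ord f P.point + D P


theorem IsSectionOn.add [IsNormalScheme X] {D : WeilDivisor X} {U : X.Opens} {f g : X.functionField}
    (hf : IsSectionOn D U f) (hg : IsSectionOn D U g) : IsSectionOn D U (f + g) := by
  rcases hf with rfl | hf
  · simpa using hg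
  rcases hg with rfl | hg
  · rw [add_zero]; exact Or.inr hf
  by_cases h : f + g = 0
  · exact Or.inl h
  refine Or.inr fun P hP => ?_
  have := isDVR_stalk P
  have h1 := Scheme.ord_add (x := P.point) h
  have h2 := hf P hP
  have h3 := hg P hP
  rcases min_le_iff.mp h1 with h | h <;> linarith

theorem IsSectionOn.smul {D : WeilDivisor X} {U : X.Opens} [Nonempty U] {f : X.functionField}
    (a : Γ(X, U)) (hf : IsSectionOn D U f) : IsSectionOn D U (X.germToFunctionField U a * f) := by
  rcases hf with rfl | hf
  · exact Or.inl (mul_zero _)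
  by_cases ha : a = 0
  · exact Or.inl (by rw [ha, map_zero, zero_mul])
  refine Or.inr fun P hP => (hf P hP).trans ?_
  have := Scheme.ord_le_smul hP ha f
  rw [Algebra.smul_def] at this
  exact add_le_add_left this _

theorem IsSectionOn.mono {D : WeilDivisor X} {U V : X.Opens} (h : V ≤ U) {f : X.functionField}
    (hf : IsSectionOn D U f) : IsSectionOn D V f :=
  hf.imp_right fun hf P hP => hf P (h hP)

/-- A regular function on `U`, as the function on `U` that is constant with value the
corresponding rational function. -/
noncomputable def toRationalSection (U : X.Opens) : Γ(X, U) →+* (U → X.functionField) :=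
  RingHom.pi fun x => (X.germToFunctionField U (h := ⟨x⟩)).hom

noncomputable instance (U : X.Opens) : Module Γ(X, U) (U → X.functionField) :=
  Module.compHom _ (toRationalSection U)

/-- The sections of `𝒪(D)` over `U`: rational functions `f` with `f = 0` or `div f + D ≥ 0` on `U`.
A rational function is regarded here as a constant function on `U`, so that there is only one section
over the empty set. -/
noncomputable def divisorialSections [IsNormalScheme X] (D : WeilDivisor X) (U : X.Opens) :
    Submodule Γ(X, U) (U → X.functionField) where
  carrier := {s | (∀ x y, s x = s y) ∧ ∀ x, IsSectionOn D U (s x)}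
  add_mem' hs ht := ⟨fun x y => congrArg₂ (· + ·) (hs.1 x y) (ht.1 x y), fun x => (hs.2 x).add (ht.2 x)⟩
  zero_mem' := ⟨fun _ _ => rfl, fun _ => Or.inl rfl⟩
  smul_mem' a _ hs := ⟨fun x y => congrArg (X.germToFunctionField U (h := ⟨x⟩) a * ·) (hs.1 x y), fun x =>
    have : Nonempty U := ⟨x⟩
    (hs.2 x).smul a⟩

set_option linter.unusedSectionVars false in
theorem germToFunctionField_res {U V : X.Opens} (i : V ⟶ U) [Nonempty U] [Nonempty V] (a : Γ(X, U)) :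
    X.germToFunctionField V (X.presheaf.map i.op a) = X.germToFunctionField U a :=
  X.presheaf.germ_res_apply i _ _ a

/-- The module of sections of `𝒪(D)` over `U`. -/
noncomputable def divisorialObj [IsNormalScheme X] (D : WeilDivisor X) (U : X.Opensᵒᵖ) :
    ModuleCat.{u} (X.ringCatSheaf.obj.obj U) :=
  (ModuleCat.of Γ(X, U.unop) (divisorialSections D U.unop) : ModuleCat Γ(X, U.unop))

/-- The presheaf of modules `U ↦ Γ(U, 𝒪(D))`. -/
noncomputable def divisorialPresheaf [IsNormalScheme X] (D : WeilDivisor X) :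
    PresheafOfModules.{u} X.ringCatSheaf.obj where
  obj U := divisorialObj D U
  map {U V} i := ModuleCat.ofHom (R := X.ringCatSheaf.obj.obj U) (X := divisorialObj D U)
      (Y := (ModuleCat.restrictScalars (X.ringCatSheaf.obj.map i).hom).obj (divisorialObj D V))
    { toFun s := (⟨fun x => s.1 ⟨x.1, i.unop.le x.2⟩, fun _ _ => s.2.1 _ _, fun _ => (s.2.2 _).mono i.unop.le⟩ :
        divisorialSections D V.unop)
      map_add' _ _ := rfl
      map_smul' a s := by
        apply Subtype.ext
        funext x
        have : Nonempty V.unop := ⟨x⟩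
        have : Nonempty U.unop := ⟨⟨x.1, i.unop.le x.2⟩⟩
        exact congrArg (· * s.1 ⟨x.1, i.unop.le x.2⟩) (germToFunctionField_res i.unop a).symm }
  map_id _ := rfl
  map_comp _ _ := rfl

theorem isSheaf_divisorialPresheaf [IsNormalScheme X] (D : WeilDivisor X) :
    TopCat.Presheaf.IsSheaf (divisorialPresheaf D).presheaf := by
  rw [TopCat.Presheaf.isSheaf_iff_isSheafUniqueGluing]
  intro ι U sf hsf
  change ∀ i, divisorialSections D (U i) at sf
  have hov : ∀ i j (x : U i) (y : U j), (sf i).1 x = (sf j).1 y := by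
    intro i j x y
    obtain ⟨z, hz⟩ : ((U i : Set X) ∩ U j).Nonempty :=
      nonempty_preirreducible_inter (U i).isOpen (U j).isOpen ⟨x.1, x.2⟩ ⟨y.1, y.2⟩
    have h1 : (sf i).1 ⟨z, hz.1⟩ = (sf j).1 ⟨z, hz.2⟩ := 
      congrFun (congrArg Subtype.val (hsf i j)) (⟨z, hz⟩ : (U i ⊓ U j : X.Opens))
    exact ((sf i).2.1 _ _).trans (h1.trans ((sf j).2.1 _ _))
  choose k hk using fun x : (iSup U : X.Opens) => TopologicalSpace.Opens.mem_iSup.mp x.2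
  refine ⟨(⟨fun x => (sf (k x)).1 ⟨x.1, hk x⟩, fun x y => hov _ _ _ _, fun x => ?_⟩ : divisorialSections D (iSup U)), ?_, ?_⟩
  · by_cases h0 : (sf (k x)).1 ⟨x.1, hk x⟩ = 0
    · exact Or.inl h0
    refine Or.inr fun P hP => ?_
    obtain ⟨i, hi⟩ := TopologicalSpace.Opens.mem_iSup.mp hP
    have h1 := hov (k x) i ⟨x.1, hk x⟩ ⟨P.point, hi⟩
    change 0 ≤ Scheme.ord ((sf (k x)).1 ⟨x.1, hk x⟩) P.point + D P
    rw [h1] at h0 ⊢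
    exact ((sf i).2.2 ⟨P.point, hi⟩).resolve_left h0 P hi
  · intro i
    apply Subtype.ext
    funext x
    exact hov _ _ _ _
  · intro t ht
    apply Subtype.ext
    funext x
    exact congrFun (congrArg Subtype.val (ht (k x))) (⟨x.1, hk x⟩ : U (k x))

/-- The sheaf `𝒪(D)` of a Weil divisor `D` on a normal scheme. -/
noncomputable def divisorialSheaf [IsNormalScheme X] (D : WeilDivisor X) : X.Modules where
  val := divisorialPresheaf D
  isSheaf := isSheaf_divisorialPresheaf D

end

/-- The `ℚ`-divisor underlying an integral Weil divisor. -/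
noncomputable def WeilDivisor.toQ : WeilDivisor X →+ QDivisor X :=
  Finsupp.mapRange.addMonoidHom (Int.castAddHom ℚ)

/-- The integral divisor `∑ nᵢ Dᵢ` for integers `nᵢ` attached to the components `Dᵢ` of the support of `D`. -/
noncomputable def componentDivisor (D : QDivisor X) : (D.support →₀ ℤ) →+ WeilDivisor X :=
  Finsupp.mapDomain.addMonoidHom Subtype.val

/-- The complement of the support of `D`. -/
def supportComplement (D : QDivisor X) : X.Opens :=
  ⟨(⋃ P ∈ D.support, P.carrier)ᶜ,
    (D.support.finite_toSet.isClosed_biUnion fun _ _ => isClosed_closure).isOpen_compl⟩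

section Complex
variable {X : Scheme.{0}} [X.Over (Spec (.of ℂ))]
attribute [local instance] MvPolynomial.gradedAlgebra

/-- `X` is a closed subscheme over `ℂ` of some projective space over `ℂ`. -/
def IsProjective (X : Scheme.{0}) [X.Over (Spec (.of ℂ))] : Prop :=
  ∃ (n : ℕ) (i : X ⟶ Proj (MvPolynomial.homogeneousSubmodule (Fin (n + 1)) ℂ)), IsClosedImmersion i ∧
    i ≫ Proj.toSpecZero (MvPolynomial.homogeneousSubmodule (Fin (n + 1)) ℂ) ≫
      Spec.map (CommRingCat.ofHom (algebraMap ℂ (MvPolynomial.homogeneousSubmodule (Fin (n + 1)) ℂ 0))) =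
    X ↘ Spec (.of ℂ)

variable [AlgebraicGeometry.IsIntegral X]

/-- The constants `ℂ → Γ(X, 𝒪_X)`. -/
noncomputable def constants (X : Scheme.{0}) [X.Over (Spec (.of ℂ))] : ℂ →+* Γ(X, ⊤) :=
  (X ↘ Spec (.of ℂ)).appTop.hom.comp (Scheme.ΓSpecIso (.of ℂ)).inv.hom

instance : Nonempty (⊤ : X.Opens) := ⟨⟨genericPoint X, trivial⟩⟩

noncomputable instance : Algebra ℂ X.functionField :=
  ((X.germToFunctionField ⊤).hom.comp (constants X)).toAlgebra

variable [IsLocallyNoetherian X] [IsNormalScheme X]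

/-- The space `H⁰(X, 𝒪(D))`, as the space of rational functions `f` with `f = 0` or `div f + D ≥ 0`. -/
noncomputable def H0 (D : WeilDivisor X) : Submodule ℂ X.functionField where
  carrier := {f | IsSectionOn D ⊤ f}
  add_mem' hf hg := hf.add hg
  zero_mem' := Or.inl rfl
  smul_mem' c _ hf := hf.smul (constants X c)

/-- `H0 D` is the module of global sections of the sheaf `𝒪(D)`. -/
noncomputable def H0Equiv (D : WeilDivisor X) : H0 D ≃+ (divisorialPresheaf D).obj (op ⊤) where
  toFun f := (⟨fun _ => f.1, fun _ _ => rfl, fun _ => f.2⟩ : divisorialSections D ⊤)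
  invFun s := ⟨(show divisorialSections D ⊤ from s).1 ⟨genericPoint X, trivial⟩, s.2.2 _⟩
  left_inv _ := rfl
  right_inv s := Subtype.ext (funext fun _ => s.2.1 _ _)
  map_add' _ _ := rfl

/-- The closure of the image of the rational map `X ⇢ ℙ(H⁰(X, 𝒪(D)))`. The homogeneous coordinates on
`ℙ(H⁰(X, 𝒪(D)))` are the members of a basis of `H⁰(X, 𝒪(D))`, and the closure of the image is
cut out by the forms `F` in these coordinates that vanish identically on `X`. It is empty if
`H⁰(X, 𝒪(D)) = 0`. -/
def linearSystemImage (D : WeilDivisor X) :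
    Set (ProjectiveSpectrum (MvPolynomial.homogeneousSubmodule (Module.Basis.ofVectorSpaceIndex ℂ (H0 D)) ℂ)) :=
  {q | ∀ (d : ℕ), ∀ F ∈ MvPolynomial.homogeneousSubmodule (Module.Basis.ofVectorSpaceIndex ℂ (H0 D)) ℂ d,
    MvPolynomial.aeval (fun i => (Module.Basis.ofVectorSpace ℂ (H0 D) i : X.functionField)) F = 0 →
      F ∈ q.asHomogeneousIdeal}

/-- The Iitaka dimension `κ(D)` of a `ℚ`-divisor: the maximum of the dimensions of the closures of the
images of `X ⇢ ℙ(H⁰(X, 𝒪(mD)))` over all `m > 0` such that `mD` is integral.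
The value `⊥` stands for `-∞`. -/
noncomputable def iitakaDim (D : QDivisor X) : WithBot ℕ∞ :=
  ⨆ (m : ℕ) (E : WeilDivisor X) (_ : 0 < m ∧ E.toQ = (m : ℚ) • D), topologicalKrullDim (linearSystemImage E)

/-- A rigid `ℚ`-divisor: effective of Iitaka dimension zero. -/
def IsRigid (D : QDivisor X) : Prop := 0 ≤ D ∧ iitakaDim D = 0

end Complex

end RigidDivisors

open AlgebraicGeometry RigidDivisors

/-! Everything rests on one property of a rigid divisor `D`: if an integral divisor `E` has its
support inside that of `D`, every function in `H0 E` is constant. Indeed `E` lies below some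
integral multiple `E' = mD`, whose linear system contains `1` as well as the given `f`. If `f` were
nonconstant, the image of `X` under that linear system would have positive dimension, against `κ(D)
= 0`.

The dimension is bounded below by exhibiting a strict specialization. Functions without poles on a
normal scheme are regular, and regular functions on projective `X` are constant, so a nonconstant
`f` has a pole along some prime divisor `P`. Divide the homogeneous coordinates by the power of a
uniformizer at `P` that makes all of them integral and at least one a unit. The generic point of the
image then specializes to the point given by the residues of the coordinates. The linear form
representing `1` vanishes at the second point and not at the first.

For (a), rigidity thus makes each of the spaces `H0` in question the line of constants. Conversely,
if these spaces are lines, each linear system maps to a zero-dimensional projective space, which is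
one point. For (b), if `E` is the divisor of `f`, then `f` lies in `H0 (-E)`, so it is constant and
`E = 0`.

For (c), smoothness makes the local rings regular, and prime ideals of height one in them are
principal (Auslander–Buchsbaum). So every Weil divisor is locally principal, `𝒪(E)` is invertible,
and `E ↦ 𝒪(E)` is a homomorphism to `Pic X` with kernel the principal divisors. Every invertible
sheaf on an open `U` comes from a Weil divisor on `X`: a local generator turns sections into
rational functions, and the orders of the other local generators give the coefficients. This yields
surjectivity of restriction. In the middle, `𝒪(E)` is trivial on `U` exactly when some `s` has
divisor `-E` there, and then `E + div s` is supported on the removed components. Injectivity on the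
left is (b).

The carrying lemmas are `IsProjective.one_le_topologicalKrullDim`,
`IsProjective.exists_algebraMap_eq_of_isRigid`, `IsRegularRing.isPrincipal_of_height_le_one` and
`exists_iso_divisorialSheaf`. -/

section

open IsLocalRing
universe u

/-! ### Regular local rings -/

namespace IsRegularLocalRing

/-- Exchange: an element of `𝔪 ∖ 𝔪²` can replace one of the members of a minimal set of generators. -/
theorem exists_insert_span_eq_maximalIdeal {R : Type*} [CommRing R] [IsLocalRing R] [IsNoetherianRing R]
    {x : R} (hx : x ∈ maximalIdeal R) (hx2 : x ∉ maximalIdeal R ^ 2) :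
    ∃ t : Finset R, t.card + 1 = (maximalIdeal R).spanFinrank ∧
      Ideal.span (insert x (t : Set R)) = maximalIdeal R := by
  classical
  have fg : (maximalIdeal R).FG := (maximalIdeal R).fg_of_isNoetherianRing
  have hfin := Submodule.FG.finite_generators fg
  let s : Finset R := hfin.toFinset
  have hs : Ideal.span (s : Set R) = maximalIdeal R := by
    simpa [s] using (maximalIdeal R).span_generators
  have hcard : s.card = (maximalIdeal R).spanFinrank := by
    rw [← Submodule.FG.generators_ncard fg, Set.ncard_eq_toFinset_card _ hfin]
  have hsm : ∀ y ∈ s, y ∈ maximalIdeal R := fun y hy => hs ▸ Ideal.subset_span hy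
  obtain ⟨a, -, ha⟩ := Submodule.mem_span_finset.mp (show x ∈ Submodule.span R (s : Set R) from hs.ge hx)
  -- If all coefficients were non-units, `x` would lie in `𝔪²`; the generator with a unit
  -- coefficient is the one that `x` replaces.
  obtain ⟨i, his, hi⟩ : ∃ i ∈ s, IsUnit (a i) := by
    by_contra! h
    refine hx2 (ha ▸ Ideal.sum_mem _ fun i hi => ?_)
    rw [pow_two, smul_eq_mul]
    exact Ideal.mul_mem_mul ((mem_maximalIdeal _).mpr (h i hi)) (hsm i hi)
  refine ⟨s.erase i, by rw [Finset.card_erase_of_mem his, hcard]; have := Finset.card_pos.mpr ⟨i, his⟩; omega, ?_⟩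
  apply le_antisymm
  · rw [Ideal.span_le]
    rintro y (rfl | hy)
    · exact hx
    · exact hsm y (Finset.mem_of_mem_erase hy)
  · rw [← hs, Ideal.span_le]
    intro y hy
    by_cases hyi : y = i
    · subst hyi
      rw [← Finset.add_sum_erase s _ his] at ha
      have h1 : a y * y = x - ∑ j ∈ s.erase y, a j • j := by rw [← ha, smul_eq_mul]; ring
      refine (Ideal.unit_mul_mem_iff_mem _ hi).mp (h1 ▸ Ideal.sub_mem _ (Ideal.subset_span (by simp)) ?_)
      exact Ideal.sum_mem _ fun j hj => Ideal.mul_mem_left _ _ (Ideal.subset_span (Or.inr hj))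
    · exact Ideal.subset_span (Or.inr (Finset.mem_erase.mpr ⟨hyi, hy⟩))

variable {R : Type*} [CommRing R] [IsRegularLocalRing R]

/-- The quotient of a regular local ring by an element of `𝔪 ∖ 𝔪²` is regular, of dimension one less. -/
theorem quotient_span_singleton {x : R} (hx : x ∈ maximalIdeal R) (hx2 : x ∉ maximalIdeal R ^ 2) :
    IsRegularLocalRing (R ⧸ Ideal.span {x}) ∧ ringKrullDim (R ⧸ Ideal.span {x}) + 1 = ringKrullDim R := by
  classical
  have hne : Ideal.span {x} ≠ ⊤ := fun h =>
    (maximalIdeal.isMaximal R).ne_top (top_le_iff.mp (h ▸ (Ideal.span_singleton_le_iff_mem _).mpr hx))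
  have : Nontrivial (R ⧸ Ideal.span {x}) := Ideal.Quotient.nontrivial_iff.mpr hne
  have : IsLocalRing (R ⧸ Ideal.span {x}) := .of_surjective' _ Ideal.Quotient.mk_surjective
  obtain ⟨t, ht, hspan⟩ := exists_insert_span_eq_maximalIdeal hx hx2
  have hreg := (isRegularLocalRing_iff R).mp ‹_›
  have hmap : (maximalIdeal R).map (Ideal.Quotient.mk (Ideal.span {x})) = maximalIdeal (R ⧸ Ideal.span {x}) :=
    map_maximalIdeal_of_surjective _ Ideal.Quotient.mk_surjective
  have hle : (maximalIdeal (R ⧸ Ideal.span {x})).spanFinrank ≤ t.card := by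
    have h : maximalIdeal (R ⧸ Ideal.span {x}) =
        Ideal.span ((t.image (Ideal.Quotient.mk (Ideal.span {x})) : Finset _) : Set (R ⧸ Ideal.span {x})) := by
      rw [← hmap, ← hspan, Ideal.map_span, Set.image_insert_eq, Ideal.Quotient.mk_singleton_self,
        Ideal.span_insert_zero, Finset.coe_image]
    rw [h]
    refine (Submodule.spanFinrank_span_le_ncard_of_finite (Finset.finite_toSet _)).trans ?_
    rw [Set.ncard_coe_finset]
    exact Finset.card_image_le
  -- One element lowers the dimension by at most one, while it has lowered the number of generators
  -- of `𝔪` by at least one; this squeezes both to the same value.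
  have hdim : ringKrullDim R ≤ ringKrullDim (R ⧸ Ideal.span {x}) + 1 := by
    simpa using ringKrullDim_le_ringKrullDim_quotient_add_encard ({x} : Set R)
      (by simpa [IsLocalRing.ringJacobson_eq_maximalIdeal] using hx)
  have hdim' : (t.card : WithBot ℕ∞) ≤ ringKrullDim (R ⧸ Ideal.span {x}) := by
    rw [← hreg, ← ht, Nat.cast_add, Nat.cast_one] at hdim
    exact ENat.WithBot.add_le_add_one_right_iff.mp hdim
  have hR : IsRegularLocalRing (R ⧸ Ideal.span {x}) :=
    .of_spanFinrank_maximalIdeal_le _ (le_trans (by exact_mod_cast hle) hdim')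
  refine ⟨hR, ?_⟩
  have h1 := (isRegularLocalRing_iff _).mp hR
  have h2 : ringKrullDim (R ⧸ Ideal.span {x}) = t.card :=
    le_antisymm (h1 ▸ by exact_mod_cast hle) hdim'
  rw [h2, ← hreg, ← ht]
  simp

/-- A regular local ring of positive dimension has an element `x ∈ 𝔪 ∖ 𝔪²` outside all minimal primes. -/
theorem exists_mem_maximalIdeal_notMem (h : ringKrullDim R ≠ 0) :
    ∃ x ∈ maximalIdeal R, x ∉ maximalIdeal R ^ 2 ∧ ∀ p ∈ minimalPrimes R, x ∉ p := by
  classical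
  by_contra! H
  let s : Finset (Ideal R) := insert (maximalIdeal R ^ 2) (minimalPrimes.finite_of_isNoetherianRing R).toFinset
  have hsub : (maximalIdeal R : Set R) ⊆ ⋃ i ∈ (s : Set (Ideal R)), id i := by
    intro x hx
    by_cases hx2 : x ∈ maximalIdeal R ^ 2
    · exact Set.mem_biUnion (x := maximalIdeal R ^ 2) (by simp [s]) hx2
    · obtain ⟨p, hp, hxp⟩ := H x hx hx2
      exact Set.mem_biUnion (x := p) (by simp [s, hp]) hxp
  -- Prime avoidance tolerates two non-prime ideals, and `𝔪²` fills both slots. So `𝔪` lies in `𝔪²`,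
  -- and `R` is a field by Nakayama, or `𝔪` is a minimal prime; in both cases the dimension is zero.
  obtain ⟨i, hi, hle⟩ := (Ideal.subset_union_prime (maximalIdeal R ^ 2) (maximalIdeal R ^ 2) (by
    intro i hi h1 _
    have : i ∈ minimalPrimes R := by simpa [s, h1] using hi
    exact this.1.1)).mp hsub
  apply h
  rcases Finset.mem_insert.mp hi with rfl | hi
  · have h0 : maximalIdeal R = ⊥ := Submodule.eq_bot_of_le_smul_of_le_jacobson_bot (maximalIdeal R) _
      (maximalIdeal R).fg_of_isNoetherianRing (by simpa [pow_two] using hle)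
      (IsLocalRing.maximalIdeal_le_jacobson _)
    exact ringKrullDim_eq_zero_of_isField (isField_iff_maximalIdeal_eq.mpr h0)
  · have hi' : i ∈ minimalPrimes R := by simpa using hi
    have := hi'.1.1
    have : i = maximalIdeal R := le_antisymm (le_maximalIdeal this.ne_top) hle
    rw [← maximalIdeal_height_eq_ringKrullDim, ← this, Ideal.height_eq_zero_iff.mpr hi']
    rfl

theorem exists_dim_eq : ∃ d : ℕ, ringKrullDim R = d := ⟨_, ((isRegularLocalRing_iff R).mp ‹_›).symm⟩

/-- By induction `R/(x)` is a domain, so `(x)` is prime and contains a minimal prime `p` with `x ∉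
p`. Every element of `p` is a multiple `zx`, and then `z ∈ p`; hence `p = xp`, and Nakayama gives `p
= 0`. -/
theorem isDomain_aux (d : ℕ) : ∀ (R : Type u) [CommRing R] [IsRegularLocalRing R], ringKrullDim R = d → IsDomain R := by
  induction d with
  | zero =>
    intro R _ _ hd
    have h1 := (isRegularLocalRing_iff R).mp ‹_›
    rw [hd] at h1
    have h2 : (maximalIdeal R).spanFinrank = 0 := by exact_mod_cast h1
    rw [Submodule.spanFinrank_eq_zero_iff_eq_bot (maximalIdeal R).fg_of_isNoetherianRing] at h2
    exact (isField_iff_maximalIdeal_eq.mpr h2).isDomain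
  | succ d ih =>
    intro R _ _ hd
    obtain ⟨x, hx, hx2, hmin⟩ := exists_mem_maximalIdeal_notMem (R := R) (by rw [hd]; exact_mod_cast Nat.succ_ne_zero d)
    obtain ⟨h1, h2⟩ := quotient_span_singleton hx hx2
    have hd' : ringKrullDim (R ⧸ Ideal.span {x}) = d := by
      rw [hd, Nat.cast_add, Nat.cast_one] at h2
      exact ENat.WithBot.add_one_cancel.mp h2
    have := ih _ hd'
    have hprime : (Ideal.span {x}).IsPrime := (Ideal.Quotient.isDomain_iff_prime _).mp this
    obtain ⟨p, hp, hpx⟩ := Ideal.exists_minimalPrimes_le (I := ⊥) (J := Ideal.span {x}) bot_le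
    have hpp := hp.1.1
    have hbot : p = ⊥ := by
      refine Submodule.eq_bot_of_le_smul_of_le_jacobson_bot (maximalIdeal R) _ p.fg_of_isNoetherianRing ?_
        (IsLocalRing.maximalIdeal_le_jacobson _)
      intro y hy
      obtain ⟨z, rfl⟩ := Ideal.mem_span_singleton'.mp (hpx hy)
      rw [mul_comm]
      exact Submodule.smul_mem_smul hx ((hpp.mem_or_mem hy).resolve_right (hmin p hp))
    subst hbot
    exact IsDomain.of_bot_isPrime R

/-- A regular local ring is a domain. -/
theorem isDomain (R : Type u) [CommRing R] [IsRegularLocalRing R] : IsDomain R :=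
  isDomain_aux _ R exists_dim_eq.choose_spec

end IsRegularLocalRing

/-! ### Finite free resolutions and stable freeness -/

section FiniteFreeResolution

open Function
open scoped Pointwise

/-- `M` has a free resolution of length at most `n` by modules `Rᵏ`. -/
def HasFreeResolution (R : Type u) [CommRing R] : ℕ → ∀ (M : Type u) [AddCommGroup M] [Module R M], Prop
  | 0, M, _, _ => Module.Free R M
  | n + 1, M, _, _ => ∃ (k : ℕ) (f : (Fin k → R) →ₗ[R] M), Surjective f ∧ HasFreeResolution R n (LinearMap.ker f)

variable {R : Type u} [CommRing R]

theorem HasFreeResolution.of_equiv {n : ℕ} {M N : Type u} [AddCommGroup M] [Module R M] [AddCommGroup N]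
    [Module R N] (e : M ≃ₗ[R] N) (h : HasFreeResolution R n M) : HasFreeResolution R n N := by
  cases n with
  | zero =>
    have : Module.Free R M := h
    exact Module.Free.of_equiv e
  | succ n =>
    obtain ⟨k, f, hf, h⟩ := h
    refine ⟨k, e.toLinearMap ∘ₗ f, e.surjective.comp hf, ?_⟩
    rwa [LinearEquiv.ker_comp]

/-- A resolution of `N/xN` lifts one step at a time. Lifts of the generators generate `N` by
Nakayama, and since `x` is regular on `N`, the new kernel reduces modulo `x` to the old one. At the
end, freeness of `N/xN` over `R/(x)` lifts to freeness of `N`. -/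
theorem HasFreeResolution.of_quotSMulTop [IsLocalRing R] [IsNoetherianRing R] {x : R} (hx : x ∈ maximalIdeal R)
    (hxR : IsSMulRegular R x) (n : ℕ) : ∀ (N : Type u) [AddCommGroup N] [Module R N] [Module.Finite R N],
      IsSMulRegular N x → HasFreeResolution (R ⧸ Ideal.span {x}) n (QuotSMulTop x N) → HasFreeResolution R n N := by
  have hj : x ∈ (⊥ : Ideal R).jacobson := IsLocalRing.maximalIdeal_le_jacobson _ hx
  induction n with
  | zero =>
    intro N _ _ _ hN h
    have := Module.finitePresentation_of_finite R N
    exact (Module.free_quotSMulTop_iff_free R N hj hN).mp h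
  | succ n ih =>
    rintro N _ _ _ hN ⟨k, f, hf, h⟩
    choose b hb using fun i => Submodule.mkQ_surjective (x • (⊤ : Submodule R N)) (f (Pi.single i 1))
    let g : (Fin k → R) →ₗ[R] N := Fintype.linearCombination R b
    let q : (Fin k → R) →ₗ[R] (Fin k → R ⧸ Ideal.span {x}) :=
      LinearMap.pi fun i => (Ideal.Quotient.mkₐ R (Ideal.span {x})).toLinearMap ∘ₗ LinearMap.proj i
    have hq : Surjective q := fun v => by
      choose w hw using fun i => Ideal.Quotient.mk_surjective (v i)
      exact ⟨w, funext hw⟩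
    have hfg : ∀ a, f (q a) = Submodule.mkQ (x • (⊤ : Submodule R N)) (g a) := by
      intro a
      have : (f.restrictScalars R) ∘ₗ q = Submodule.mkQ (x • (⊤ : Submodule R N)) ∘ₗ g := by
        refine LinearMap.pi_ext' fun i => LinearMap.ext_ring ?_
        simp only [LinearMap.comp_apply, LinearMap.single_apply, LinearMap.restrictScalars_apply]
        have h1 : q (Pi.single i 1) = Pi.single i 1 := by
          ext j
          rcases eq_or_ne j i with rfl | hij
          · simp [q]
          · simp [q, hij]
        rw [h1, ← hb]
        simp [g]
      exact LinearMap.congr_fun this a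
    have hqk : ∀ a, q a = 0 → ∃ c, a = x • c := by
      intro a ha
      have : ∀ i, ∃ c, a i = x * c := fun i => by
        have h1 : Ideal.Quotient.mk (Ideal.span {x}) (a i) = 0 := congrFun ha i
        obtain ⟨c, hc⟩ := Ideal.mem_span_singleton'.mp (Ideal.Quotient.eq_zero_iff_mem.mp h1)
        exact ⟨c, by rw [← hc, mul_comm]⟩
      choose c hc using this
      exact ⟨c, funext hc⟩
    have hqx : ∀ a, q (x • a) = 0 := fun a => by
      ext i
      change Ideal.Quotient.mk (Ideal.span {x}) (x * a i) = 0
      rw [map_mul, Ideal.Quotient.mk_singleton_self, zero_mul]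
    have hmem : ∀ y : N, y ∈ x • (⊤ : Submodule R N) ↔ ∃ z, x • z = y := fun y => by
      simp [Submodule.mem_smul_pointwise_iff_exists]
    have hg : Surjective g := by
      rw [← LinearMap.range_eq_top]
      refine top_le_iff.mp (Submodule.le_of_le_smul_of_le_jacobson_bot (I := Ideal.span {x}) (Module.Finite.fg_top)
        ((Ideal.span_singleton_le_iff_mem _).mpr hj) ?_)
      intro y _
      obtain ⟨v, hv⟩ := hf (Submodule.mkQ (x • (⊤ : Submodule R N)) y)
      obtain ⟨a, rfl⟩ := hq v
      rw [hfg] at hv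
      have h1 : y - g a ∈ x • (⊤ : Submodule R N) := by
        rw [← Submodule.Quotient.mk_eq_zero]
        rw [Submodule.mkQ_apply, Submodule.mkQ_apply] at hv
        rw [Submodule.Quotient.mk_sub, hv, sub_self]
      rw [show y = g a + (y - g a) by abel]
      exact Submodule.add_mem_sup ⟨a, rfl⟩ (by rwa [Submodule.ideal_span_singleton_smul])
    refine ⟨k, g, hg, ih _ ?_ ?_⟩
    · exact (IsSMulRegular.pi fun _ => hxR).submodule _ _
    have hL : ∀ l : LinearMap.ker g, q l ∈ LinearMap.ker f := fun l => by
      rw [LinearMap.mem_ker, hfg, l.2, map_zero]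
    -- Reduction modulo `x` maps the kernel upstairs onto the kernel downstairs. A lift `a` of an
    -- element downstairs has `g a = x • z`, and subtracting `x` times a preimage of `z` puts it in
    -- the kernel.
    let φ : LinearMap.ker g →ₗ[R] (LinearMap.ker f) :=
      { toFun := fun l => ⟨q l, hL l⟩
        map_add' := fun _ _ => Subtype.ext (map_add q _ _)
        map_smul' := fun _ _ => Subtype.ext (map_smul q _ _) }
    have hφ : Surjective φ := by
      rintro ⟨v, hv⟩
      obtain ⟨a, rfl⟩ := hq v
      rw [LinearMap.mem_ker, hfg, Submodule.mkQ_apply, Submodule.Quotient.mk_eq_zero, hmem] at hv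
      obtain ⟨z, hz⟩ := hv
      obtain ⟨a', rfl⟩ := hg z
      refine ⟨⟨a - x • a', by rw [LinearMap.mem_ker, map_sub, map_smul, hz, sub_self]⟩, Subtype.ext ?_⟩
      change q (a - x • a') = q a
      rw [map_sub, hqx, sub_zero]
    -- Regularity of `x` on `N` enters here: from `g (x • c) = 0` one gets `g c = 0`.
    have hker : LinearMap.ker φ = x • (⊤ : Submodule R (LinearMap.ker g)) := by
      ext l
      rw [LinearMap.mem_ker]
      simp only [Submodule.mem_smul_pointwise_iff_exists, Submodule.mem_top, true_and]
      constructor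
      · intro hl
        obtain ⟨c, hc⟩ := hqk l (congrArg Subtype.val hl)
        refine ⟨⟨c, hN ?_⟩, Subtype.ext hc.symm⟩
        change x • g c = x • 0
        rw [← map_smul, ← hc, l.2, smul_zero]
      · rintro ⟨c, rfl⟩
        exact Subtype.ext (hqx c)
    let e : QuotSMulTop x (LinearMap.ker g) ≃ₗ[R] LinearMap.ker f :=
      (Submodule.quotEquivOfEq _ _ hker.symm).trans (φ.quotKerEquivOfSurjective hφ)
    exact h.of_equiv (e.symm.extendScalarsOfSurjective Ideal.Quotient.mk_surjective)

/-- The module may have `x`-torsion, but its first syzygy sits in a free module over a domain, where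
`x` is regular; then reduction modulo `x` lowers the dimension. The initial syzygy costs one step,
hence the length `d + 1` and not the optimal `d`. -/
theorem IsRegularLocalRing.hasFreeResolution_aux (d : ℕ) : ∀ (R : Type u) [CommRing R] [IsRegularLocalRing R],
    ringKrullDim R = d → ∀ (M : Type u) [AddCommGroup M] [Module R M] [Module.Finite R M],
      HasFreeResolution R (d + 1) M := by
  induction d with
  | zero =>
    intro R _ _ hd M _ _ _
    have h1 := (isRegularLocalRing_iff R).mp ‹_›
    rw [hd] at h1
    have h2 : (maximalIdeal R).spanFinrank = 0 := by exact_mod_cast h1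
    rw [Submodule.spanFinrank_eq_zero_iff_eq_bot (maximalIdeal R).fg_of_isNoetherianRing] at h2
    let := (isField_iff_maximalIdeal_eq.mpr h2).toField
    obtain ⟨k, f, hf⟩ := Module.Finite.exists_fin' R M
    exact ⟨k, f, hf, Module.Free.of_divisionRing R (LinearMap.ker f)⟩
  | succ d ih =>
    intro R _ _ hd M _ _ _
    have := IsRegularLocalRing.isDomain R
    obtain ⟨x, hx, hx2, -⟩ := exists_mem_maximalIdeal_notMem (R := R) (by rw [hd]; exact_mod_cast Nat.succ_ne_zero d)
    obtain ⟨h1, h2⟩ := quotient_span_singleton hx hx2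
    have hd' : ringKrullDim (R ⧸ Ideal.span {x}) = d := by
      rw [hd, Nat.cast_add, Nat.cast_one] at h2
      exact ENat.WithBot.add_one_cancel.mp h2
    have hx0 : x ≠ 0 := fun h => hx2 (h ▸ zero_mem _)
    have hxR : IsSMulRegular R x := (IsRegular.of_ne_zero hx0).left
    obtain ⟨k, f, hf⟩ := Module.Finite.exists_fin' R M
    refine ⟨k, f, hf, HasFreeResolution.of_quotSMulTop hx hxR _ _ ((IsSMulRegular.pi fun _ => hxR).submodule _ _) ?_⟩
    have : Module.Finite (R ⧸ Ideal.span {x}) (QuotSMulTop x (LinearMap.ker f)) :=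
      Module.Finite.of_restrictScalars_finite R _ _
    exact ih _ hd' _

/-- Finitely generated modules over a regular local ring have finite free resolutions. -/
theorem IsRegularLocalRing.hasFreeResolution (R : Type u) [CommRing R] [IsRegularLocalRing R] :
    ∃ n, ∀ (M : Type u) [AddCommGroup M] [Module R M] [Module.Finite R M], HasFreeResolution R n M :=
  ⟨_, hasFreeResolution_aux _ R exists_dim_eq.choose_spec⟩

/-- The localized sequence splits because its right end is projective, so the localization of `F` is
the direct sum of those of `M` and `K`. This is the inductive step down a resolution. -/
theorem LocalizedModule.isStablyFree_of_exact (S : Submonoid R) {K F M : Type*} [AddCommGroup K] [Module R K]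
    [AddCommGroup F] [Module R F] [AddCommGroup M] [Module R M] [Module.Finite R K] [Module.Finite R F] [Module.Free R F]
    {i : K →ₗ[R] F} {f : F →ₗ[R] M} (hi : Injective i) (hf : Surjective f) (hex : Exact i f)
    (hproj : Module.Projective (Localization S) (LocalizedModule S M)) :
    Module.Projective (Localization S) (LocalizedModule S K) ∧
      (Module.IsStablyFree (Localization S) (LocalizedModule S K) →
        Module.IsStablyFree (Localization S) (LocalizedModule S M)) := by
  let i' := LocalizedModule.map S i
  let f' := LocalizedModule.map S f
  have hi' : Injective i' := LocalizedModule.map_injective S _ hi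
  have hf' : Surjective f' := LocalizedModule.map_surjective S _ hf
  have hex' : Exact i' f' := LocalizedModule.map_exact S _ _ hex
  obtain ⟨s, hs⟩ := Module.projective_lifting_property f' LinearMap.id hf'
  let e := hex'.splitSurjectiveEquiv hi' ⟨s, hs⟩
  have : Module.Free (Localization S) (LocalizedModule S F) :=
    Module.free_of_isLocalizedModule (Rₛ := Localization S) S (LocalizedModule.mkLinearMap S F)
  refine ⟨Module.Projective.of_split (e.1.symm.toLinearMap ∘ₗ LinearMap.inl _ _ _)
    (LinearMap.fst _ _ _ ∘ₗ e.1.toLinearMap) (by ext; simp), fun h => ?_⟩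
  -- With `K ⊕ G` free, `M ⊕ (K ⊕ G)` is isomorphic to `F ⊕ G`, which is free.
  obtain ⟨G, _, _, _, _, hG⟩ := Module.IsStablyFree.exist_free_prod (Localization S) (LocalizedModule S K)
  have e2 : (LocalizedModule S M × (LocalizedModule S K × G)) ≃ₗ[Localization S] LocalizedModule S F × G :=
    (LinearEquiv.prodAssoc _ _ _ _).symm.trans
      (((LinearEquiv.prodComm _ _ _).trans e.1.symm).prodCongr (LinearEquiv.refl _ G))
  have := Module.Free.of_equiv e2.symm
  exact Module.IsStablyFree.of_free_prod _ _ (LocalizedModule S K × G)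

/-- A projective localization of a module with a finite free resolution is stably free. -/
theorem HasFreeResolution.isStablyFree_localizedModule [IsNoetherianRing R] (S : Submonoid R) (n : ℕ) :
    ∀ (M : Type u) [AddCommGroup M] [Module R M], HasFreeResolution R n M →
      Module.Projective (Localization S) (LocalizedModule S M) →
        Module.IsStablyFree (Localization S) (LocalizedModule S M) := by
  induction n with
  | zero =>
    intro M _ _ h _
    have : Module.Free R M := h
    have := Module.free_of_isLocalizedModule (Rₛ := Localization S) S (LocalizedModule.mkLinearMap S M)
    infer_instance
  | succ n ih =>
    rintro M _ _ ⟨k, f, hf, h⟩ hproj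
    obtain ⟨h1, h2⟩ := LocalizedModule.isStablyFree_of_exact S (LinearMap.ker f).injective_subtype hf
      (LinearMap.exact_subtype_ker_map f) hproj
    exact h2 (ih _ h h1)

end FiniteFreeResolution

end

/-! ### Prime ideals of height one in regular local rings -/

section

open IsLocalRing
universe u

theorem IsRegularRing.localizationAtPrime (R : Type*) [CommRing R] [IsRegularRing R] (q : Ideal R) [q.IsPrime] :
    IsRegularRing (Localization.AtPrime q) := by
  have : IsNoetherianRing (Localization.AtPrime q) := IsLocalization.isNoetherianRing q.primeCompl _ inferInstance
  rw [isRegularRing_iff]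
  intro P hP
  have := IsLocalization.isLocalization_isLocalization_atPrime_isLocalization q.primeCompl (Localization.AtPrime P) P
  exact IsRegularLocalRing.of_ringEquiv (IsLocalization.algEquiv (P.under R).primeCompl
    (Localization.AtPrime (P.under R)) (Localization.AtPrime P)).toRingEquiv

/-- An ideal that becomes principal in the local ring at `q` is principal near `q`. -/
theorem Ideal.exists_smul_le_span_singleton_of_isPrincipal_map {R : Type*} [CommRing R] [IsNoetherianRing R]
    (I q : Ideal R) [q.IsPrime] (S : Type*) [CommRing S] [Algebra R S] [IsLocalization.AtPrime S q]
    (h : (I.map (algebraMap R S)).IsPrincipal) :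
    ∃ s ∉ q, ∃ y ∈ I, ∀ z ∈ I, s * z ∈ Ideal.span {y} := by
  classical
  obtain ⟨g, hg⟩ := h
  have hgI : g ∈ I.map (algebraMap R S) := hg ▸ Submodule.mem_span_singleton_self g
  -- The local generator has the form `y/t` with `y ∈ I`, so `y` generates locally too.
  obtain ⟨⟨⟨y, hy⟩, t⟩, hgt⟩ := (IsLocalization.mem_map_algebraMap_iff q.primeCompl S).mp hgI
  have hz : ∀ z ∈ I, ∃ s ∉ q, s * z ∈ Ideal.span {y} := by
    intro z hz
    have : algebraMap R S z ∈ Ideal.span {g} := by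
      rw [Ideal.span, ← hg]
      exact Ideal.mem_map_of_mem _ hz
    obtain ⟨c, hc⟩ := Ideal.mem_span_singleton'.mp this
    obtain ⟨⟨a, u⟩, hu⟩ := IsLocalization.surj q.primeCompl c
    have : algebraMap R S (t * u * z) = algebraMap R S (a * y) := by
      simp only [map_mul] at *
      rw [← hc, ← hu, ← hgt]
      ring
    obtain ⟨v, hv⟩ := (IsLocalization.eq_iff_exists q.primeCompl S).mp this
    refine ⟨v * (t * u), (q.primeCompl.mul_mem v.2 (q.primeCompl.mul_mem t.2 u.2)), ?_⟩
    rw [mul_assoc, hv]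
    exact Ideal.mem_span_singleton'.mpr ⟨v * a, by ring⟩
  -- The product of the denominators of finitely many generators serves for all of `I`.
  obtain ⟨T, hT⟩ := (inferInstance : IsNoetherianRing R).noetherian I
  have hTI : ∀ z ∈ T, z ∈ I := fun z hz => hT ▸ Submodule.subset_span hz
  choose! s hs hsz using hz
  refine ⟨∏ z ∈ T, s z, q.primeCompl.prod_mem fun z hz => hs z (hTI z hz), y, hy, fun z hzI => ?_⟩
  have hle : I ≤ Submodule.comap (LinearMap.mulLeft R (∏ z ∈ T, s z)) (Ideal.span {y}) := by
    conv_lhs => rw [← hT]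
    refine Submodule.span_le.mpr fun w hw => ?_
    change (∏ z ∈ T, s z) * w ∈ Ideal.span {y}
    rw [← Finset.prod_erase_mul T s hw, mul_assoc]
    exact Ideal.mul_mem_left _ _ (hsz w (hTI w hw))
  exact hle hzI

/-- A nonzero ideal of a domain that is locally principal is an invertible module. -/
theorem Ideal.invertible_of_locally_principal {B : Type*} [CommRing B] [IsDomain B] {J : Ideal B} (hJ : J ≠ ⊥)
    (h : ∀ q : Ideal B, q.IsMaximal → ∃ s ∉ q, ∃ y ∈ J, ∀ z ∈ J, s * z ∈ Ideal.span {y}) :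
    Module.Invertible B J := by
  let K := FractionRing B
  obtain ⟨a, haJ, ha⟩ := Submodule.exists_mem_ne_zero_of_ne_bot hJ
  -- For an invertible `J` the inverse would be `a⁻¹C`; so the point is to prove `J * C = (a)`.
  let C : Ideal B := (Ideal.span {a}).colon (J : Set B)
  have hC : ∀ b, b ∈ C ↔ ∀ z ∈ J, b * z ∈ Ideal.span {a} := fun b => by
    simp [C, Submodule.mem_colon]
  have hJC : J * C = Ideal.span {a} := by
    apply le_antisymm
    · rw [Ideal.mul_le]
      intro z hz b hb
      rw [mul_comm]
      exact (hC b).mp hb z hz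
    · rw [Ideal.span_singleton_le_iff_mem]
      -- The elements that carry `a` into `J * C`. If `D` were in a maximal ideal `q`, the local
      -- generator `y` would give `s * a = b * y` with `b ∈ C`, whence `s ∈ D` although `s ∉ q`.
      let D : Ideal B := Submodule.comap (LinearMap.mulLeft B a) (J * C)
      have hD : D = ⊤ := by
        by_contra hD
        obtain ⟨q, hq, hDq⟩ := Ideal.exists_le_maximal D hD
        obtain ⟨s, hs, y, hy, hsy⟩ := h q hq
        obtain ⟨b, hb⟩ := Ideal.mem_span_singleton'.mp (hsy a haJ)
        have hs0 : s ≠ 0 := fun h0 => hs (h0 ▸ zero_mem _)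
        have hbC : b ∈ C := by
          rw [hC]
          intro z hz
          obtain ⟨c, hc⟩ := Ideal.mem_span_singleton'.mp (hsy z hz)
          refine Ideal.mem_span_singleton'.mpr ⟨c, mul_left_cancel₀ hs0 ?_⟩
          linear_combination (-c) * hb + b * hc
        apply hs
        apply hDq
        change a * s ∈ J * C
        rw [mul_comm a s, ← hb, mul_comm b y]
        exact Ideal.mul_mem_mul hy hbC
      have : (1 : B) ∈ D := hD ▸ Submodule.mem_top
      have h1 : a * 1 ∈ J * C := this
      rwa [mul_one] at h1
  let f : B →ₐ[B] K := Algebra.ofId B K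
  have haK : algebraMap B K a ≠ 0 := by
    rwa [Ne, IsFractionRing.to_map_eq_zero_iff]
  have hunit : (Submodule.map f.toLinearMap J) * (Submodule.map f.toLinearMap C * Submodule.span B {(algebraMap B K a)⁻¹}) = 1 := by
    rw [← mul_assoc, ← Submodule.map_mul]
    have : (J : Submodule B B) * C = Submodule.span B {a} := hJC
    rw [this, Submodule.map_span, Set.image_singleton, Submodule.span_mul_span, Set.singleton_mul_singleton]
    change Submodule.span B {algebraMap B K a * (algebraMap B K a)⁻¹} = 1
    rw [mul_inv_cancel₀ haK, Submodule.one_eq_span]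
  let u : (Submodule B K)ˣ := Units.mkOfMulEqOne _ _ hunit
  have hinj : Function.Injective f.toLinearMap := IsFractionRing.injective B K
  have : Module.Invertible B (Submodule.map f.toLinearMap J) := (inferInstance : Module.Invertible B u.1)
  exact Module.Invertible.congr (Submodule.equivMapOfInjective f.toLinearMap hinj J).symm

/-- Choose a prime element `x ∈ 𝔪 ∖ 𝔪²`. If `x ∈ p`, then `p = (x)` by height. Otherwise invert `x`:
the primes of `A[1/x]` come from non-maximal primes of `A`, so `p` becomes locally principal by
induction on dimension, thus invertible. It is also stably free, since `p` has a finite free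
resolution, and a stably free module of rank one is free. Finally the generator is freed of powers
of `x`. Assuming `IsRegularRing` provides regularity of the localizations that the induction passes
to. -/
theorem IsRegularRing.isPrincipal_of_height_le_one_aux (d : ℕ) : ∀ (A : Type u) [CommRing A] [IsLocalRing A] [IsRegularRing A],
    ringKrullDim A = d → ∀ p : Ideal A, p.IsPrime → p.height ≤ 1 → p.IsPrincipal := by
  induction d using Nat.strong_induction_on with
  | _ d ih =>
  intro A _ _ _ hd p hp hp1
  have := IsRegularLocalRing.of_isRegularRing_of_isLocalRing A
  have := IsRegularLocalRing.isDomain A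
  by_cases hp0 : p = ⊥
  · rw [hp0]; exact bot_isPrincipal
  have hdim : ringKrullDim A ≠ 0 := by
    intro h0
    rw [← maximalIdeal_height_eq_ringKrullDim] at h0
    have h1 : (maximalIdeal A).height = 0 := by exact_mod_cast h0
    rw [Ideal.height_eq_zero_iff_eq_bot] at h1
    exact hp0 (le_bot_iff.mp (h1 ▸ le_maximalIdeal hp.ne_top))
  obtain ⟨x, hx, hx2, -⟩ := IsRegularLocalRing.exists_mem_maximalIdeal_notMem hdim
  have hx0 : x ≠ 0 := fun h => hx2 (h ▸ zero_mem _)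
  obtain ⟨hreg, -⟩ := IsRegularLocalRing.quotient_span_singleton hx hx2
  have hxprime : (Ideal.span {x}).IsPrime :=
    (Ideal.Quotient.isDomain_iff_prime _).mp (IsRegularLocalRing.isDomain _)
  have hxp' : Prime x := (Ideal.span_singleton_prime hx0).mp hxprime
  by_cases hxp : x ∈ p
  · have hle : Ideal.span {x} ≤ p := (Ideal.span_singleton_le_iff_mem _).mpr hxp
    rcases hle.eq_or_lt with heq | hlt
    · exact ⟨x, heq.symm⟩
    · exfalso
      have h1 := Ideal.height_add_one_le_of_lt_of_isPrime hlt
      have h2 : (Ideal.span {x}).height ≠ 0 := by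
        rw [Ne, Ideal.height_eq_zero_iff_eq_bot, Ideal.span_singleton_eq_bot]
        exact hx0
      have h3 := h1.trans hp1
      have h4 : (1 : ℕ∞) ≤ (Ideal.span {x}).height := Order.one_le_iff_ne_zero.mpr h2
      have h5 : (1 + 1 : ℕ∞) ≤ 1 := (add_le_add_left h4 1).trans h3
      exact absurd h5 (by decide)
  let S := Submonoid.powers x
  let B := Localization S
  have hSle : S ≤ nonZeroDivisors A := powers_le_nonZeroDivisors_of_noZeroDivisors hx0
  have : IsDomain B := IsLocalization.isDomain_localization hSle
  let J := p.map (algebraMap A B)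
  have hinj : Function.Injective (algebraMap A B) := IsLocalization.injective B hSle
  have hJ0 : J ≠ ⊥ := by
    rwa [Ne, Ideal.map_eq_bot_iff_of_injective hinj]
  have hJinv : Module.Invertible B J := by
    refine Ideal.invertible_of_locally_principal hJ0 fun q hq => ?_
    let q' := q.under A
    have hq' : q'.IsPrime := inferInstance
    have hxq : x ∉ q' := fun h => by
      exact hq.ne_top (Ideal.eq_top_of_isUnit_mem _ h (IsLocalization.map_units B (⟨x, Submonoid.mem_powers x⟩ : S)))
    suffices H : ∃ s ∉ q', ∃ y ∈ p, ∀ z ∈ p, s * z ∈ Ideal.span {y} by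
      obtain ⟨s, hs, y, hy, hsy⟩ := H
      refine ⟨algebraMap A B s, hs, algebraMap A B y, Ideal.mem_map_of_mem _ hy, fun z hz => ?_⟩
      obtain ⟨⟨⟨w, hw⟩, t⟩, hzt⟩ := (IsLocalization.mem_map_algebraMap_iff S B).mp hz
      obtain ⟨c, hc⟩ := Ideal.mem_span_singleton'.mp (hsy w hw)
      have h1 : algebraMap A B s * z * algebraMap A B t ∈ Ideal.span {algebraMap A B y} := by
        refine Ideal.mem_span_singleton'.mpr ⟨algebraMap A B c, ?_⟩
        rw [mul_assoc, hzt, ← map_mul, ← map_mul, hc]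
      exact (Ideal.mul_unit_mem_iff_mem _ (IsLocalization.map_units B t)).mp h1
    -- If `p ≤ q'`, then `q'` has smaller height than `𝔪` because `x ∉ q'`, and induction applies to
    -- the localization at `q'`. Otherwise an element of `p` outside `q'` makes `p` the unit ideal
    -- there.
    by_cases hpq : p ≤ q'
    · have hlt : q'.height < (maximalIdeal A).height := by
        refine Ideal.height_strict_mono_of_isPrime_of_isPrime (lt_of_le_of_ne (le_maximalIdeal hq'.ne_top) ?_)
        intro h
        exact hxq (h ▸ hx)
      have hd1 : (maximalIdeal A).height = d := by
        have := maximalIdeal_height_eq_ringKrullDim (R := A)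
        rw [hd] at this
        exact_mod_cast this
      obtain ⟨n, hn⟩ := ENat.ne_top_iff_exists.mp hlt.ne_top
      have hnd : n < d := by
        rw [hd1, ← hn] at hlt
        exact_mod_cast hlt
      have := IsRegularRing.localizationAtPrime A q'
      have hdisj : Disjoint (q'.primeCompl : Set A) p :=
        Set.disjoint_left.mpr fun y hy hyp => hy (hpq hyp)
      have hpp : (p.map (algebraMap A (Localization.AtPrime q'))).IsPrime :=
        IsLocalization.isPrime_of_isPrime_disjoint q'.primeCompl _ _ hp hdisj
      refine Ideal.exists_smul_le_span_singleton_of_isPrincipal_map p q' (Localization.AtPrime q')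
        (ih n hnd _ ?_ _ hpp ?_)
      · rw [IsLocalization.AtPrime.ringKrullDim_eq_height q', ← hn]
        rfl
      · rwa [← IsLocalization.height_under q'.primeCompl,
          IsLocalization.under_map_of_isPrime_disjoint q'.primeCompl _ hp hdisj]
    · obtain ⟨s, hsp, hsq⟩ := Set.not_subset.mp hpq
      exact ⟨s, hsq, s, hsp, fun z _ => Ideal.mem_span_singleton'.mpr ⟨z, mul_comm _ _⟩⟩
  have e : LocalizedModule S p ≃ₗ[B] J :=
    (IsLocalizedModule.linearEquiv S (LocalizedModule.mkLinearMap S p) (Algebra.idealMap (S := B) p)).extendScalarsOfIsLocalization S B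
  have hproj : Module.Projective B (LocalizedModule S p) := Module.Projective.of_equiv e.symm
  obtain ⟨n, hn⟩ := IsRegularLocalRing.hasFreeResolution A
  have := HasFreeResolution.isStablyFree_localizedModule S n p (hn p) hproj
  have : Module.IsStablyFree B J := Module.IsStablyFree.equiv e
  have : Module.Free B J := Module.free_of_isStablyFree_of_invertible B J
  obtain ⟨e'⟩ := Module.Invertible.free_iff_linearEquiv.mp this
  have hgen : ∀ z ∈ J, ∃ c, z = c * (e'.symm 1 : J) := fun z hz => ⟨e' ⟨z, hz⟩, by
    rw [← smul_eq_mul, ← Submodule.coe_smul, ← map_smul, smul_eq_mul, mul_one, e'.symm_apply_apply]⟩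
  obtain ⟨⟨⟨y, hy⟩, t⟩, hyt⟩ := (IsLocalization.mem_map_algebraMap_iff S B).mp (e'.symm 1).2
  have hgen' : ∀ z ∈ p, ∃ (a : A) (m : ℕ), x ^ m * z = a * y := by
    intro z hz
    obtain ⟨c, hc⟩ := hgen _ (Ideal.mem_map_of_mem _ hz)
    obtain ⟨⟨a, ⟨_, m, rfl⟩⟩, hu⟩ := IsLocalization.surj S c
    obtain ⟨k, hk⟩ := t.2
    refine ⟨a, k + m, hinj ?_⟩
    have hk' : x ^ k = (t : A) := hk
    simp only [map_mul, pow_add, hk', ← hyt, hc] at hu ⊢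
    rw [← hu]
    ring
  have hy0 : y ≠ 0 := by
    rintro rfl
    refine hp0 (le_bot_iff.mp fun z hz => ?_)
    obtain ⟨a, m, h⟩ := hgen' z hz
    rw [mul_zero] at h
    exact (mul_eq_zero.mp h).resolve_left (pow_ne_zero _ hx0)
  -- Powers of `x` are units in `A[1/x]`, so they may be removed from the generator. Once `x ∤ y'`,
  -- an equation `x ^ m * z = a * x ^ k * y'` forces `x ^ m ∣ a * x ^ k`, which leaves `z` a
  -- multiple of `y'` in `A`.
  obtain ⟨k, y', hy', rfl⟩ := WfDvdMonoid.max_power_factor hy0 hxp'.irreducible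
  have hy'p : y' ∈ p := (hp.mem_or_mem hy).resolve_left fun h => hxp (hp.mem_of_pow_mem _ h)
  refine ⟨y', le_antisymm (fun z hz => ?_) ((Ideal.span_singleton_le_iff_mem _).mpr hy'p)⟩
  obtain ⟨a, m, h⟩ := hgen' z hz
  obtain ⟨c, hc⟩ : x ^ m ∣ a * x ^ k := hxp'.pow_dvd_of_dvd_mul_right m hy' ⟨z, by rw [h]; ring⟩
  refine Ideal.mem_span_singleton'.mpr ⟨c, mul_left_cancel₀ (pow_ne_zero m hx0) ?_⟩
  rw [h, ← mul_assoc, ← mul_assoc, hc]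

/-- In a local ring all of whose localizations are regular, prime ideals of height at most one are principal. -/
theorem IsRegularRing.isPrincipal_of_height_le_one (A : Type u) [CommRing A] [IsLocalRing A] [IsRegularRing A]
    (p : Ideal A) (hp : p.IsPrime) (h : p.height ≤ 1) : p.IsPrincipal :=
  have := IsRegularLocalRing.of_isRegularRing_of_isLocalRing A
  isPrincipal_of_height_le_one_aux _ A IsRegularLocalRing.exists_dim_eq.choose_spec p hp h

end

/-! ### Normality in codimension one; regularity of étale and smooth algebras -/

section

universe u

section Hartogs

/-- Local generation by `z` makes `P` a minimal prime over `(z)`, so Krull's principal ideal theorem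
bounds its height. -/
theorem Ideal.height_eq_one_of_isPrincipal_localization {S : Type*} [CommRing S] [IsDomain S] [IsNoetherianRing S]
    (P : Ideal S) [P.IsPrime] (hP : P ≠ ⊥) {z : S} (hz : z ∈ P) (h : ∀ y ∈ P, ∃ t ∉ P, t * y ∈ Ideal.span {z}) :
    P.height = 1 := by
  have hle : P.height ≤ 1 := by
    refine Ideal.height_le_one_of_isPrincipal_of_mem_minimalPrimes (Ideal.span {z}) P ?_
    refine ⟨⟨inferInstance, (Ideal.span_singleton_le_iff_mem _).mpr hz⟩, ?_⟩
    rintro Q ⟨hQ, hzQ⟩ hQP y hy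
    obtain ⟨t, ht, hty⟩ := h y hy
    exact (hQ.mem_or_mem (hzQ hty)).resolve_left fun h => ht (hQP h)
  refine le_antisymm hle (Order.one_le_iff_pos.mpr (pos_iff_ne_zero.mpr fun h0 => hP ?_))
  rwa [Ideal.height_eq_zero_iff_eq_bot] at h0

/-- A normal Noetherian domain is the intersection of its localizations at height one primes. If `b
∤ a`, some associated prime `P` of `S/(b)` contains every `s` with `b ∣ s * a`; write `P` as the
annihilator of `e` modulo `b`. Multiplication by `e/b` maps `P` into `S`. If the image leaves `P`,
then `P` is locally principal of height one, against the hypothesis; if not, `e/b` is integral, so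
`b ∣ e`, which is absurd. -/
theorem IsIntegrallyClosed.dvd_of_forall_height_eq_one {S : Type*} [CommRing S] [IsDomain S] [IsNoetherianRing S]
    [IsIntegrallyClosed S] {a b : S} (hb : b ≠ 0)
    (h : ∀ p : Ideal S, p.IsPrime → p.height = 1 → ∃ t ∉ p, b ∣ t * a) : b ∣ a := by
  by_contra hba
  let π := Ideal.Quotient.mk (Ideal.span {b})
  have ha : π a ≠ 0 := by
    rwa [Ne, Ideal.Quotient.eq_zero_iff_dvd]
  obtain ⟨P, hP, hle⟩ := exists_le_isAssociatedPrime_of_isNoetherianRing S (π a) ha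
  have hPp : P.IsPrime := hP.isPrime
  obtain ⟨e', he⟩ := (isAssociatedPrime_iff.mp hP).2
  obtain ⟨e, rfl⟩ := Ideal.Quotient.mk_surjective e'
  have hmem : ∀ s, s ∈ P ↔ b ∣ s * e := by
    intro s
    rw [he, Submodule.mem_colon_singleton, Submodule.mem_bot, ← Ideal.Quotient.eq_zero_iff_dvd, map_mul]
    rfl
  have hla : ∀ s, b ∣ s * a → s ∈ P := by
    intro s hs
    apply hle
    rw [Submodule.mem_colon_singleton, Submodule.mem_bot]
    exact (Ideal.Quotient.eq_zero_iff_dvd _ _).mpr hs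
  have hbP : b ∈ P := (hmem b).mpr (dvd_mul_right _ _)
  have heb : ¬ b ∣ e := fun hd => hPp.ne_top ((Ideal.eq_top_iff_one P).mpr ((hmem 1).mpr (by rwa [one_mul])))
  let K := FractionRing S
  have hbK : algebraMap S K b ≠ 0 := by rwa [Ne, IsFractionRing.to_map_eq_zero_iff]
  by_cases hex : ∃ z ∈ P, ∃ t ∉ P, z * e = t * b
  · obtain ⟨z, hz, t, ht, hzt⟩ := hex
    have h1 : P.height = 1 := by
      refine P.height_eq_one_of_isPrincipal_localization (fun h0 => hb (by rwa [h0] at hbP)) hz fun y hy => ⟨t, ht, ?_⟩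
      obtain ⟨c, hc⟩ := (hmem y).mp hy
      refine Ideal.mem_span_singleton'.mpr ⟨c, mul_left_cancel₀ hb ?_⟩
      linear_combination z * hc.symm + y * hzt
    obtain ⟨t, ht, hta⟩ := h P hPp h1
    exact ht (hla t hta)
  · push Not at hex
    let N : Submodule S K := Submodule.map (Algebra.linearMap S K) P
    have hint : IsIntegral S (algebraMap S K e / algebraMap S K b) := by
      refine isIntegral_of_smul_mem_submodule N ?_ ((IsNoetherian.noetherian P).map _) _ ?_
      · rw [Submodule.ne_bot_iff]
        exact ⟨_, ⟨b, hbP, rfl⟩, hbK⟩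
      · rintro _ ⟨z, hz, rfl⟩
        obtain ⟨t, ht⟩ := (hmem z).mp hz
        have htP : t ∈ P := by
          by_contra hn
          exact hex z hz t hn (by rw [ht, mul_comm])
        refine ⟨t, htP, ?_⟩
        rw [Algebra.linearMap_apply, Algebra.linearMap_apply, smul_eq_mul, div_mul_eq_mul_div, eq_div_iff hbK,
          ← map_mul, ← map_mul]
        congr 1
        linear_combination -ht
    obtain ⟨y, hy⟩ := IsIntegrallyClosed.algebraMap_eq_of_integral hint
    apply heb
    refine ⟨y, IsFractionRing.injective S K ?_⟩
    rw [map_mul, hy, mul_div_cancel₀ _ hbK]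

end Hartogs

section Etale

/-- Unramifiedness makes the maximal ideal of `S_q` the extension of that of `R_p`, so it needs no
more generators; flatness gives going down, so the dimension of `S_q` is at least that of `R_p`. -/
theorem IsRegularRing.of_etale (R S : Type*) [CommRing R] [CommRing S] [Algebra R S] [IsRegularRing R] [Algebra.Etale R S] :
    IsRegularRing S := by
  have : IsNoetherianRing S := Algebra.FiniteType.isNoetherianRing R S
  rw [isRegularRing_iff]
  intro q hq
  let p := q.under R
  have : q.LiesOver p := ⟨rfl⟩
  let _ := Localization.AtPrime.algebraOfLiesOver p q
  have hreg : IsRegularLocalRing (Localization.AtPrime p) := (isRegularRing_iff (R := R)).mp inferInstance p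
  have : Algebra.EssFiniteType (Localization.AtPrime p) (Localization.AtPrime q) := .of_comp R _ _
  have hmax := Algebra.FormallyUnramified.map_maximalIdeal (R := Localization.AtPrime p) (S := Localization.AtPrime q)
  have : Module.Flat R S := inferInstance
  have hht := Ideal.height_eq_height_add_of_liesOver_of_hasGoingDown p q
  apply IsRegularLocalRing.of_spanFinrank_maximalIdeal_le
  have h1 := (isRegularLocalRing_iff (Localization.AtPrime p)).mp hreg
  rw [IsLocalization.AtPrime.ringKrullDim_eq_height p] at h1
  rw [IsLocalization.AtPrime.ringKrullDim_eq_height q, hht]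
  have h2 : ((p.height + (q.map (Ideal.Quotient.mk (p.map (algebraMap R S)))).height : ℕ∞) : WithBot ℕ∞) ≥ p.height := by
    exact_mod_cast le_self_add
  refine le_trans ?_ h2
  rw [← h1, ← hmax]
  norm_cast
  exact Ideal.spanFinrank_map_le_of_fg _ (IsNoetherian.noetherian _)

end Etale

open AlgebraicGeometry

/-- A smooth scheme is locally étale over affine space, and polynomial rings over a field are
regular. -/
theorem exists_isRegularRing_of_smooth {K : Type u} [Field K] {X : Scheme.{u}} (f : X ⟶ Spec (.of K)) [Smooth f] (x : X) :
    ∃ V : X.Opens, IsAffineOpen V ∧ x ∈ V ∧ IsRegularRing Γ(X, V) := by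
  obtain ⟨U, hU, V, hV, hxV, e, h⟩ := Smooth.exists_isStandardSmooth f x
  refine ⟨V, hV, hxV, ?_⟩
  -- `Spec K` has only one point, so a nonempty open subset is everything.
  obtain rfl : U = ⊤ := by
    refine top_le_iff.mp fun y _ => ?_
    have : Subsingleton (Spec (.of K)) := inferInstanceAs (Subsingleton (PrimeSpectrum K))
    rw [Subsingleton.elim y (f x)]
    exact e hxV
  have : IsRegularRing Γ(Spec (.of K), ⊤) :=
    IsRegularRing.of_ringEquiv (Scheme.ΓSpecIso (.of K)).symm.commRingCatIsoToRingEquiv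
  obtain ⟨n, g, -, hg⟩ := h.exists_etale_mvPolynomial
  algebraize [g]
  exact IsRegularRing.of_etale (MvPolynomial (Fin n) Γ(Spec (.of K), ⊤)) _

end

/-! ### Orders of vanishing and regular functions on normal schemes -/

section

universe u

open CategoryTheory Opposite AlgebraicGeometry RigidDivisors IsLocalRing

section
variable {X : Scheme.{u}}

theorem IsAffineOpen.mem_primeIdealOf {W : X.Opens} (hW : IsAffineOpen W) (x : W) (a : Γ(X, W)) :
    a ∈ (hW.primeIdealOf x).asIdeal ↔ X.presheaf.germ W x x.2 a ∈ maximalIdeal (X.presheaf.stalk x.1) := by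
  rw [hW.primeIdealOf_eq_map_closedPoint]
  rfl

theorem IsAffineOpen.height_primeIdealOf {W : X.Opens} (hW : IsAffineOpen W) (x : W) :
    (hW.primeIdealOf x).asIdeal.height = Order.coheight x.1 := by
  have := hW.isLocalization_stalk x
  have h1 := IsLocalization.AtPrime.ringKrullDim_eq_height (hW.primeIdealOf x).asIdeal (X.presheaf.stalk x.1)
  rw [ringKrullDim_stalk_eq_coheight] at h1
  exact_mod_cast h1.symm

theorem IsAffineOpen.exists_primeIdealOf_eq {W : X.Opens} (hW : IsAffineOpen W) (p : PrimeSpectrum Γ(X, W)) :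
    ∃ x : W, hW.primeIdealOf x = p :=
  ⟨hW.isoSpec.inv (show Spec Γ(X, W) from p), Scheme.inv_hom_apply hW.isoSpec p⟩

theorem IsAffineOpen.isNoetherianRing [IsLocallyNoetherian X] {W : X.Opens} (hW : IsAffineOpen W) : IsNoetherianRing Γ(X, W) :=
  IsLocallyNoetherian.component_noetherian ⟨W, hW⟩

theorem IsAffineOpen.isIntegrallyClosed [AlgebraicGeometry.IsIntegral X] [IsNormalScheme X] {W : X.Opens} (hW : IsAffineOpen W) [Nonempty W] : IsIntegrallyClosed Γ(X, W) := by
  refine IsIntegrallyClosed.of_localization_maximal fun p _ hp => ?_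
  obtain ⟨x, hx⟩ := IsAffineOpen.exists_primeIdealOf_eq hW ⟨p, inferInstance⟩
  have := hW.isLocalization_stalk x
  have := IsNormalScheme.stalk_isIntegrallyClosed x.1
  obtain rfl : p = (hW.primeIdealOf x).asIdeal := by rw [hx]
  exact IsIntegrallyClosed.of_equiv (IsLocalization.algEquiv (hW.primeIdealOf x).asIdeal.primeCompl (X.presheaf.stalk x.1)
    (Localization.AtPrime (hW.primeIdealOf x).asIdeal)).toRingEquiv

end

section
variable {X : Scheme.{u}} [AlgebraicGeometry.IsIntegral X] [IsLocallyNoetherian X]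

theorem Scheme.ord_one (x : X) : Scheme.ord (1 : X.functionField) x = 0 := by
  have h := Scheme.ord_mul (x := x) (one_ne_zero (α := X.functionField)) one_ne_zero
  rw [mul_one] at h
  linarith

theorem Scheme.ord_inv (f : X.functionField) (x : X) : Scheme.ord f⁻¹ x = - Scheme.ord f x := by
  by_cases hf : f = 0
  · simp [hf]
  have h := Scheme.ord_mul (x := x) hf (inv_ne_zero hf)
  rw [mul_inv_cancel₀ hf, Scheme.ord_one] at h
  linarith

theorem Scheme.ord_zpow {f : X.functionField} (hf : f ≠ 0) (x : X) (n : ℤ) : Scheme.ord (f ^ n) x = n * Scheme.ord f x := by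
  induction n with
  | zero => simp [Scheme.ord_one]
  | succ n ih => rw [zpow_add_one₀ hf, Scheme.ord_mul (zpow_ne_zero _ hf) hf, ih]; ring
  | pred n ih => rw [zpow_sub_one₀ hf, Scheme.ord_mul (zpow_ne_zero _ hf) (inv_ne_zero hf), ih, Scheme.ord_inv]; ring

theorem Scheme.ord_prod {ι : Type*} (s : Finset ι) {f : ι → X.functionField} (hf : ∀ i ∈ s, f i ≠ 0) (x : X) :
    Scheme.ord (∏ i ∈ s, f i) x = ∑ i ∈ s, Scheme.ord (f i) x := by
  classical
  induction s using Finset.induction_on with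
  | empty => simp [Scheme.ord_one]
  | insert a s ha ih =>
    rw [Finset.prod_insert ha, Finset.sum_insert ha, Scheme.ord_mul (hf _ (Finset.mem_insert_self _ _))
      (Finset.prod_ne_zero_iff.mpr fun i hi => hf i (Finset.mem_insert_of_mem hi)),
      ih fun i hi => hf i (Finset.mem_insert_of_mem hi)]

theorem Scheme.ord_algebraMap_nonneg (x : X) {a : X.presheaf.stalk x} (ha : a ≠ 0) :
    0 ≤ Scheme.ord (algebraMap (X.presheaf.stalk x) X.functionField a) x := by
  by_cases hx : Order.coheight x = 1
  · have := krullDimLE_of_coheight_le hx.le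
    rw [Scheme.le_ord_iff hx (by rwa [Ne, IsFractionRing.to_map_eq_zero_iff])]
    exact Ring.ordFrac_ge_one_of_ne_zero ha
  -- `Scheme.ord` takes the value zero at points that are not of codimension one.
  · rw [Scheme.ord_eq_zero_of_coheight_neq_one hx]

theorem Scheme.ord_germ_nonneg {U : X.Opens} [Nonempty U] {a : Γ(X, U)} {x : X} (hx : x ∈ U) :
    0 ≤ Scheme.ord (X.germToFunctionField U a) x := by
  by_cases ha : a = 0
  · simp [ha]
  rw [← Scheme.algebraMap_germ_eq_germToFunctionField X hx]
  apply Scheme.ord_algebraMap_nonneg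
  rwa [Ne, map_eq_zero_iff _ (germ_injective_of_isIntegral X x hx)]

variable [IsNormalScheme X]

namespace RigidDivisors.PrimeDivisor
variable (P : PrimeDivisor X)

theorem ord_eq_zero_iff {f : X.functionField} (hf : f ≠ 0) : Scheme.ord f P.point = 0 ↔
    ∃ a : X.presheaf.stalk P.point, IsUnit a ∧ algebraMap _ X.functionField a = f := by
  have := isDVR_stalk P
  have := krullDimLE_of_coheight_le P.coheight_point.le
  rw [Scheme.ord_eq_iff P.coheight_point hf]
  change Ring.ordFrac _ f = 1 ↔ _
  constructor
  · intro h
    obtain ⟨u, hu⟩ := Ring.associated_of_ordFrac_eq (R := X.presheaf.stalk P.point) (1 : X.functionField) f (by rw [map_one, h])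
    exact ⟨u, u.isUnit, by rw [← hu, Units.smul_def, Algebra.smul_def, mul_one]⟩
  · rintro ⟨a, ha, rfl⟩
    exact Ring.ordFrac_of_isUnit ha

theorem exists_ord_eq_one : ∃ a : X.presheaf.stalk P.point,
    Scheme.ord (algebraMap _ X.functionField a) P.point = 1 ∧ maximalIdeal _ = Ideal.span {a} := by
  have := isDVR_stalk P
  have := krullDimLE_of_coheight_le P.coheight_point.le
  obtain ⟨a, ha⟩ := IsDiscreteValuationRing.exists_irreducible (X.presheaf.stalk P.point)
  refine ⟨a, ?_, ha.maximalIdeal_eq⟩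
  rw [Scheme.ord_eq_iff P.coheight_point (by rw [Ne, IsFractionRing.to_map_eq_zero_iff]; exact ha.ne_zero)]
  exact Ring.ordFrac_irreducible ha

theorem ord_nonneg_iff {f : X.functionField} (hf : f ≠ 0) : 0 ≤ Scheme.ord f P.point ↔
    ∃ a : X.presheaf.stalk P.point, algebraMap _ X.functionField a = f := by
  constructor
  · intro h
    obtain ⟨n, hn⟩ := Int.eq_ofNat_of_zero_le h
    obtain ⟨t, ht, -⟩ := P.exists_ord_eq_one
    -- The zero function has order `0` by convention, so a function of order one is nonzero.
    have ht0 : algebraMap _ X.functionField t ≠ 0 := fun h0 => by simp [h0] at ht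
    obtain ⟨u, -, hu⟩ := (P.ord_eq_zero_iff (f := f * (algebraMap _ X.functionField t) ^ (-n : ℤ))
      (mul_ne_zero hf (zpow_ne_zero _ ht0))).mp (by
        rw [Scheme.ord_mul hf (zpow_ne_zero _ ht0), Scheme.ord_zpow ht0, ht, hn]; ring)
    refine ⟨u * t ^ n, ?_⟩
    rw [map_mul, hu, map_pow, mul_assoc, zpow_neg, zpow_natCast, inv_mul_cancel₀ (pow_ne_zero _ ht0), mul_one]
  · rintro ⟨a, rfl⟩
    apply Scheme.ord_algebraMap_nonneg
    rintro rfl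
    simp at hf

theorem ord_pos_iff {a : X.presheaf.stalk P.point} (ha : a ≠ 0) :
    0 < Scheme.ord (algebraMap _ X.functionField a) P.point ↔ a ∈ maximalIdeal _ := by
  have ha' : algebraMap _ X.functionField a ≠ 0 := by rwa [Ne, IsFractionRing.to_map_eq_zero_iff]
  have h1 := Scheme.ord_algebraMap_nonneg P.point ha
  rw [IsLocalRing.mem_maximalIdeal, mem_nonunits_iff, lt_iff_le_and_ne, and_iff_right h1, not_iff_not, eq_comm,
    P.ord_eq_zero_iff ha']
  constructor
  · rintro ⟨b, hb, h⟩
    rwa [← IsFractionRing.injective _ X.functionField h]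
  · intro h
    exact ⟨a, h, rfl⟩

end RigidDivisors.PrimeDivisor

/-- A rational function without poles on an affine open subset is regular there. -/
theorem IsAffineOpen.exists_germToFunctionField_eq {W : X.Opens} (hW : IsAffineOpen W) [Nonempty W] {f : X.functionField}
    (hf : ∀ P : PrimeDivisor X, P.point ∈ W → 0 ≤ Scheme.ord f P.point) : ∃ a : Γ(X, W), X.germToFunctionField W a = f := by
  by_cases hf0 : f = 0
  · exact ⟨0, by rw [map_zero, hf0]⟩
  have := IsAffineOpen.isNoetherianRing hW
  have := IsAffineOpen.isIntegrallyClosed hW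
  have := functionField_isFractionRing_of_isAffineOpen X W hW
  obtain ⟨a, b, hb, rfl⟩ := IsFractionRing.div_surjective (A := Γ(X, W)) f
  have hb0 := nonZeroDivisors.ne_zero hb
  have hbK : algebraMap Γ(X, W) X.functionField b ≠ 0 := by rwa [Ne, IsFractionRing.to_map_eq_zero_iff]
  -- The height one primes of `Γ(X, W)` are the prime divisors meeting `W`; absence of a pole there
  -- says that `b` divides `a` up to a denominator outside the prime.
  obtain ⟨c, rfl⟩ : b ∣ a := by
    refine IsIntegrallyClosed.dvd_of_forall_height_eq_one hb0 fun p hp hp1 => ?_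
    obtain ⟨x, hx⟩ := IsAffineOpen.exists_primeIdealOf_eq hW ⟨p, hp⟩
    have hloc := hW.isLocalization_stalk x
    obtain rfl : p = (hW.primeIdealOf x).asIdeal := by rw [hx]
    rw [IsAffineOpen.height_primeIdealOf] at hp1
    let P : PrimeDivisor X := ⟨x.1, hp1⟩
    obtain ⟨s, hs⟩ := (P.ord_nonneg_iff hf0).mp (hf P x.2)
    obtain ⟨c, t, rfl⟩ := IsLocalization.exists_mk'_eq (hW.primeIdealOf x).asIdeal.primeCompl s
    refine ⟨t.1, t.2, ⟨c, ?_⟩⟩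
    have h1 := IsLocalization.mk'_spec' (X.presheaf.stalk x.1) c t
    have := functionField_isScalarTower X W x
    have h2 := congrArg (algebraMap (X.presheaf.stalk x.1) X.functionField) h1
    have hs' : algebraMap (X.presheaf.stalk x.1) X.functionField (IsLocalization.mk' (X.presheaf.stalk x.1) c t) = _ := hs
    rw [map_mul, hs', ← IsScalarTower.algebraMap_apply, ← IsScalarTower.algebraMap_apply, mul_div_assoc', div_eq_iff hbK,
      ← map_mul, ← map_mul] at h2
    rw [IsFractionRing.injective _ _ h2, mul_comm]
  refine ⟨c, ?_⟩
  change algebraMap Γ(X, W) X.functionField c = _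
  rw [map_mul, mul_div_cancel_left₀ _ hbK]

/-- A rational function without poles on an open subset is regular there. -/
theorem Scheme.exists_germToFunctionField_eq (U : X.Opens) [Nonempty U] {f : X.functionField}
    (hf : ∀ P : PrimeDivisor X, P.point ∈ U → 0 ≤ Scheme.ord f P.point) : ∃ a : Γ(X, U), X.germToFunctionField U a = f := by
  choose W hW hxW hWU using fun x : U => X.isBasis_affineOpens.exists_subset_of_mem_open x.2 U.isOpen
  choose V hV hVW using hW
  replace hxW : ∀ x, x.1 ∈ V x := fun x => (hVW x ▸ hxW x : x.1 ∈ (V x : Set X))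
  replace hWU : ∀ x, V x ≤ U := fun x => (hVW x ▸ hWU x : (V x : Set X) ⊆ U)
  have hne : ∀ x, Nonempty (V x) := fun x => ⟨⟨x.1, hxW x⟩⟩
  choose s hs using fun x => IsAffineOpen.exists_germToFunctionField_eq (hV x) fun P hP => hf P (hWU x hP)
  have hsup : U = iSup V := by
    apply le_antisymm
    · intro y hy
      exact TopologicalSpace.Opens.mem_iSup.mpr ⟨⟨y, hy⟩, hxW ⟨y, hy⟩⟩
    · exact iSup_le fun x => hWU x
  obtain ⟨a, ha, -⟩ := X.sheaf.existsUnique_gluing' V U (fun x => homOfLE (hWU x)) hsup.le s (by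
    intro x y
    obtain ⟨z, hz⟩ : ((V x : Set X) ∩ V y).Nonempty :=
      nonempty_preirreducible_inter (V x).isOpen (V y).isOpen ⟨_, hxW x⟩ ⟨_, hxW y⟩
    have : Nonempty (V x ⊓ V y : X.Opens) := ⟨⟨z, hz⟩⟩
    apply X.germToFunctionField_injective (V x ⊓ V y)
    exact (germToFunctionField_res _ _).trans ((hs x).trans ((hs y).symm.trans (germToFunctionField_res _ _).symm)))
  obtain ⟨x⟩ := ‹Nonempty U›
  have := hne x
  refine ⟨a, ?_⟩
  rw [← hs x, ← ha x]
  exact (germToFunctionField_res (homOfLE (hWU x)) a).symm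

end

end

/-! ### Points of projective space with coordinates in a domain -/

section

universe u

open CategoryTheory Opposite AlgebraicGeometry RigidDivisors IsLocalRing

section Cone
open MvPolynomial
attribute [local instance] MvPolynomial.gradedAlgebra
variable {ι k B : Type*} [Field k] [CommRing B] (φ : k →+* B) (b : ι → B)

/-- The homomorphism of graded rings `k[xᵢ] → B[T]` that sends `xᵢ` to `bᵢ T`. -/
noncomputable def coneHom : MvPolynomial ι k →+* Polynomial B :=
  eval₂Hom (Polynomial.C.comp φ) fun i => Polynomial.C (b i) * Polynomial.X

/-- The variable `T` separates degrees. Plain evaluation in `B` could vanish by cancellation between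
different degrees; with `T` the kernel is a homogeneous ideal. -/
theorem coeff_coneHom (F : MvPolynomial ι k) (d : ℕ) :
    (coneHom φ b F).coeff d = eval₂ φ b (homogeneousComponent d F) := by
  induction F using MvPolynomial.induction_on' with
  | monomial s c =>
    rw [homogeneousComponent_of_mem (isHomogeneous_monomial c rfl), coneHom, coe_eval₂Hom, eval₂_monomial]
    simp only [Finsupp.prod, mul_pow, Finset.prod_mul_distrib, Finset.prod_pow_eq_pow_sum, RingHom.comp_apply,
      ← map_pow, ← map_prod, ← mul_assoc, ← map_mul, Polynomial.coeff_C_mul_X_pow]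
    split_ifs with h h' h'
    · rw [eval₂_monomial, Finsupp.prod]
    · exact absurd h h'
    · exact absurd h' h
    · rw [eval₂_zero]
  | add p q hp hq => rw [map_add, Polynomial.coeff_add, hp, hq, map_add, eval₂_add]

theorem mem_ker_coneHom (F : MvPolynomial ι k) :
    F ∈ RingHom.ker (coneHom φ b) ↔ ∀ d, eval₂ φ b (homogeneousComponent d F) = 0 := by
  simp only [RingHom.mem_ker, Polynomial.ext_iff, coeff_coneHom, Polynomial.coeff_zero]

theorem mem_ker_coneHom_of_isHomogeneous {F : MvPolynomial ι k} {d : ℕ} (hF : F.IsHomogeneous d) :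
    F ∈ RingHom.ker (coneHom φ b) ↔ eval₂ φ b F = 0 := by
  rw [mem_ker_coneHom]
  refine ⟨fun h => by simpa [homogeneousComponent_of_mem hF] using h d, fun h e => ?_⟩
  rw [homogeneousComponent_of_mem hF]
  split_ifs
  · exact h
  · exact eval₂_zero _ _

theorem decompose_homogeneousSubmodule (F : MvPolynomial ι k) (d : ℕ) :
    (DirectSum.decompose (homogeneousSubmodule ι k) F d : MvPolynomial ι k) = homogeneousComponent d F :=
  decomposition.decompose'_apply F d

theorem degree_eq_of_isHomogeneous {F : MvPolynomial ι k} {d : ℕ} (hF : F.IsHomogeneous d) {s : ι →₀ ℕ}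
    (hs : coeff s F ≠ 0) : s.degree = d := by
  rw [Finsupp.degree_eq_weight_one]
  exact hF hs

theorem X_mem_irrelevant (i : ι) :
    (X i : MvPolynomial ι k) ∈ HomogeneousIdeal.irrelevant (homogeneousSubmodule ι k) := by
  rw [HomogeneousIdeal.mem_irrelevant_iff, GradedRing.proj_apply, decompose_homogeneousSubmodule,
    homogeneousComponent_of_mem (isHomogeneous_X k i), if_neg zero_ne_one]

/-- The point with homogeneous coordinates `bᵢ`. -/
noncomputable def conePoint [IsDomain B] (hb : ∃ i, b i ≠ 0) : ProjectiveSpectrum (homogeneousSubmodule ι k) where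
  asHomogeneousIdeal := ⟨RingHom.ker (coneHom φ b), fun d F hF => by
    rw [decompose_homogeneousSubmodule, mem_ker_coneHom_of_isHomogeneous _ _ (homogeneousComponent_isHomogeneous d F)]
    exact (mem_ker_coneHom φ b F).mp hF d⟩
  isPrime := RingHom.ker_isPrime (coneHom φ b)
  not_irrelevant_le h := by
    obtain ⟨i, hi⟩ := hb
    have : X i ∈ RingHom.ker (coneHom φ b) := h (X_mem_irrelevant i)
    rw [mem_ker_coneHom_of_isHomogeneous _ _ (isHomogeneous_X k i), eval₂_X] at this
    exact hi this

theorem mem_conePoint [IsDomain B] (hb : ∃ i, b i ≠ 0) {F : MvPolynomial ι k} {d : ℕ} (hF : F.IsHomogeneous d) :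
    F ∈ (conePoint φ b hb).asHomogeneousIdeal ↔ eval₂ φ b F = 0 :=
  mem_ker_coneHom_of_isHomogeneous φ b hF

/-- Forms vanishing on the coordinates still vanish on their images, so the image point is a
specialization. The hypothesis `hb'` keeps it from being the irrelevant ideal. -/
theorem conePoint_le [IsDomain B] (hb : ∃ i, b i ≠ 0) {B' : Type*} [CommRing B'] [IsDomain B'] (π : B →+* B')
    (hb' : ∃ i, π (b i) ≠ 0) : conePoint φ b hb ≤ conePoint (π.comp φ) (fun i => π (b i)) hb' := by
  rw [← ProjectiveSpectrum.as_ideal_le_as_ideal]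
  intro F hF
  have h : ∀ d, eval₂ φ b (homogeneousComponent d F) = 0 := (mem_ker_coneHom φ b F).mp hF
  refine (mem_ker_coneHom _ _ F).mpr fun d => ?_
  have h1 := hom_eval₂ (homogeneousComponent d F) φ π b
  rw [h, map_zero] at h1
  exact h1.symm

theorem eval₂_smul_of_isHomogeneous {F : MvPolynomial ι k} {d : ℕ} (hF : F.IsHomogeneous d) (c : B) :
    eval₂ φ (fun i => c * b i) F = c ^ d * eval₂ φ b F := by
  rw [eval₂_eq, eval₂_eq, Finset.mul_sum]
  refine Finset.sum_congr rfl fun s hs => ?_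
  rw [Finset.prod_congr rfl fun i _ => mul_pow c (b i) (s i), Finset.prod_mul_distrib, Finset.prod_pow_eq_pow_sum]
  have := degree_eq_of_isHomogeneous hF (mem_support_iff.mp hs)
  rw [← this, Finsupp.degree]
  change _ = c ^ (∑ i ∈ s.support, s i) * _
  ring

/-- Zero-dimensional projective space is a point: a relevant prime omits the single variable, forms
are scalars times powers of it, so the prime is zero. -/
theorem ProjectiveSpectrum.subsingleton_of_unique [Unique ι] :
    Subsingleton (ProjectiveSpectrum (homogeneousSubmodule ι k)) := by
  have key : ∀ q : ProjectiveSpectrum (homogeneousSubmodule ι k), q.asHomogeneousIdeal = ⊥ := by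
    intro q
    have hX : (X default : MvPolynomial ι k) ∉ q.asHomogeneousIdeal := by
      intro hX
      apply q.not_irrelevant_le
      intro F hF
      have hF' : F ∈ HomogeneousIdeal.irrelevant (homogeneousSubmodule ι k) := hF
      rw [HomogeneousIdeal.mem_irrelevant_iff, GradedRing.proj_apply, decompose_homogeneousSubmodule,
        homogeneousComponent_zero, map_eq_zero_iff _ (C_injective _ _)] at hF'
      change F ∈ q.asHomogeneousIdeal.toIdeal
      rw [F.as_sum]
      refine Ideal.sum_mem _ fun s hs => ?_
      have hs0 : s default ≠ 0 := by
        intro h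
        have : s = 0 := Finsupp.ext fun i => by rw [Subsingleton.elim i default, h]; rfl
        rw [mem_support_iff, this] at hs
        exact hs hF'
      rw [monomial_eq, Finsupp.prod]
      refine Ideal.mul_mem_left _ _ (Ideal.mem_of_dvd _ (Finset.dvd_prod_of_mem _ (Finsupp.mem_support_iff.mpr hs0)) ?_)
      exact Ideal.pow_mem_of_mem _ hX _ (Nat.pos_of_ne_zero hs0)
    apply HomogeneousIdeal.toIdeal_injective
    refine le_antisymm (fun F hF => ?_) bot_le
    have hc : ∀ d, homogeneousComponent d F = 0 := by
      intro d
      have hd : homogeneousComponent d F ∈ q.asHomogeneousIdeal.toIdeal := by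
        rw [← decompose_homogeneousSubmodule]
        exact q.asHomogeneousIdeal.isHomogeneous d hF
      by_contra hne
      obtain ⟨s, hs⟩ := ne_zero_iff.mp hne
      have hmono : homogeneousComponent d F = monomial s (coeff s (homogeneousComponent d F)) := by
        ext t
        rw [coeff_monomial]
        split_ifs with h
        · rw [h]
        · by_contra ht
          have h1 := degree_eq_of_isHomogeneous (homogeneousComponent_isHomogeneous d F) ht
          have h2 := degree_eq_of_isHomogeneous (homogeneousComponent_isHomogeneous d F) hs
          apply h
          refine Finsupp.ext fun i => ?_
          rw [Subsingleton.elim i default]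
          have h3 : ∀ r : ι →₀ ℕ, r.degree = r default := fun r => by
            rw [Finsupp.degree_eq_sum, Fintype.sum_unique]
          rw [← h3, ← h3, h1, h2]
      rw [hmono, monomial_eq, Finsupp.prod] at hd
      rcases q.isPrime.mem_or_mem hd with h | h
      · exact q.isPrime.ne_top (Ideal.eq_top_of_isUnit_mem _ h ((isUnit_iff_ne_zero.mpr hs).map C))
      · obtain ⟨i, -, hi⟩ := q.isPrime.prod_mem_iff.mp h
        rw [Subsingleton.elim i default] at hi
        exact hX (q.isPrime.mem_of_pow_mem _ hi)
    change F = 0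
    rw [← sum_homogeneousComponent F, Finset.sum_eq_zero fun i _ => hc i]
  constructor
  intro p q
  exact ProjectiveSpectrum.ext ((key p).trans (key q).symm)

theorem one_le_topologicalKrullDim {T : Type*} [TopologicalSpace T] {p q : T} (h : p ⤳ q) (h' : ¬ q ⤳ p) :
    1 ≤ topologicalKrullDim T := by
  rw [topologicalKrullDim, Order.one_le_krullDim_iff]
  refine ⟨⟨closure {q}, isIrreducible_singleton.closure, isClosed_closure⟩,
    ⟨closure {p}, isIrreducible_singleton.closure, isClosed_closure⟩, ?_⟩
  refine lt_of_le_not_ge ?_ ?_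
  · change closure {q} ⊆ closure {p}
    exact h.closure_subset
  · intro hle
    have : closure {p} ⊆ closure {q} := hle
    exact h' (specializes_iff_closure_subset.mpr this)

end Cone

end

/-! ### Constants on projective varieties and images of linear systems -/

section

open CategoryTheory Opposite AlgebraicGeometry RigidDivisors IsLocalRing

namespace RigidDivisors
open MvPolynomial
attribute [local instance] MvPolynomial.gradedAlgebra
variable {X : Scheme.{0}} [X.Over (Spec (.of ℂ))] [AlgebraicGeometry.IsIntegral X]

omit [AlgebraicGeometry.IsIntegral X] in
-- `Proj` is proper over the spectrum of the degree zero part, and that part consists of the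
-- constants only.
theorem IsProjective.isProper (hX : IsProjective X) : IsProper (X ↘ Spec (.of ℂ)) := by
  obtain ⟨n, i, hi, h⟩ := hX
  have hsurj : Function.Surjective (algebraMap ℂ (homogeneousSubmodule (Fin (n + 1)) ℂ 0)) := by
    rintro ⟨F, hF⟩
    have hF0 := homogeneousComponent_eq_self (show F.IsHomogeneous 0 from hF)
    rw [homogeneousComponent_zero] at hF0
    exact ⟨coeff 0 F, Subtype.ext hF0⟩
  have h1 : IsClosedImmersion (Spec.map (CommRingCat.ofHom (algebraMap ℂ (homogeneousSubmodule (Fin (n + 1)) ℂ 0)))) :=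
    IsClosedImmersion.spec_of_surjective _ hsurj
  have h2 : Algebra.FiniteType (homogeneousSubmodule (Fin (n + 1)) ℂ 0) (MvPolynomial (Fin (n + 1)) ℂ) :=
    have : IsScalarTower ℂ (homogeneousSubmodule (Fin (n + 1)) ℂ 0) (MvPolynomial (Fin (n + 1)) ℂ) :=
      ⟨fun a b c => smul_mul_assoc a (b : MvPolynomial (Fin (n + 1)) ℂ) c⟩
    Algebra.FiniteType.of_restrictScalars_finiteType ℂ _ _
  rw [← h]
  infer_instance

/-- Properness makes the global functions integral over `ℂ`; they form a domain and `ℂ` is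
algebraically closed. -/
theorem IsProjective.surjective_constants (hX : IsProjective X) : Function.Surjective (constants X) := by
  have := hX.isProper
  have h := isIntegral_appTop_of_universallyClosed (X ↘ Spec (.of ℂ))
  let _ : Algebra ℂ Γ(X, ⊤) := (constants X).toAlgebra
  have : Algebra.IsIntegral ℂ Γ(X, ⊤) := by
    constructor
    change (constants X).IsIntegral
    refine RingHom.IsIntegral.trans (Scheme.ΓSpecIso (.of ℂ)).inv.hom _ ?_ h
    exact RingHom.isIntegral_of_surjective _ (Scheme.ΓSpecIso (.of ℂ)).symm.commRingCatIsoToRingEquiv.surjective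
  exact (IsAlgClosed.algebraMap_bijective_of_isIntegral (k := ℂ)).2

omit [AlgebraicGeometry.IsIntegral X] in
theorem IsProjective.compactSpace (hX : IsProjective X) : CompactSpace X := by
  have := hX.isProper
  exact (quasiCompact_iff_compactSpace (X ↘ Spec (.of ℂ))).mp inferInstance

variable [IsLocallyNoetherian X]

theorem ord_algebraMap (c : ℂ) (x : X) : Scheme.ord (algebraMap ℂ X.functionField c) x = 0 := by
  by_cases hc : c = 0
  · rw [hc, map_zero]; simp
  · exact Scheme.ord_of_isUnit ((isUnit_iff_ne_zero.mpr hc).map (constants X)) trivial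

variable [IsNormalScheme X]

theorem IsProjective.exists_algebraMap_eq (hX : IsProjective X) {f : X.functionField}
    (hf : ∀ P : PrimeDivisor X, 0 ≤ Scheme.ord f P.point) : ∃ c : ℂ, algebraMap ℂ X.functionField c = f := by
  obtain ⟨a, rfl⟩ := Scheme.exists_germToFunctionField_eq (⊤ : X.Opens) fun P _ => hf P
  obtain ⟨c, rfl⟩ := hX.surjective_constants a
  exact ⟨c, rfl⟩

theorem one_mem_H0 {E : WeilDivisor X} (hE : 0 ≤ E) : 1 ∈ H0 E :=
  Or.inr fun P _ => by rw [Scheme.ord_one, zero_add]; exact hE P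

theorem H0_mono {E E' : WeilDivisor X} (h : E ≤ E') : H0 E ≤ H0 E' := by
  rintro f (rfl | hf)
  · exact zero_mem _
  · exact Or.inr fun P hP => (hf P hP).trans (add_le_add_right (h P) _)

/-- Members of `H0 E` are values of linear forms in the homogeneous coordinates; this is how the
functions `1` and `f` are seen on the image. -/
theorem aeval_basis_eq (E : WeilDivisor X) (g : H0 E) : ∃ F : MvPolynomial (Module.Basis.ofVectorSpaceIndex ℂ (H0 E)) ℂ, F.IsHomogeneous 1 ∧
    aeval (fun i => (Module.Basis.ofVectorSpace ℂ (H0 E) i : X.functionField)) F = g := by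
  let β := Module.Basis.ofVectorSpace ℂ (H0 E)
  refine ⟨∑ i ∈ (β.repr g).support, C (β.repr g i) * MvPolynomial.X i, ?_, ?_⟩
  · refine IsHomogeneous.sum _ _ _ fun i _ => ?_
    simpa using (isHomogeneous_C _ (β.repr g i)).mul (isHomogeneous_X ℂ i)
  · have h := congrArg (H0 E).subtype (β.linearCombination_repr g)
    rw [Finsupp.linearCombination_apply, Finsupp.sum, map_sum] at h
    rw [map_sum, ← Submodule.subtype_apply, ← h]
    refine Finset.sum_congr rfl fun i _ => ?_
    rw [map_mul, aeval_C, aeval_X, map_smul, Algebra.smul_def]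
    rfl

/-- If the linear system of `E` contains a nonconstant function in addition to the constants, then its
image has positive dimension. -/
theorem IsProjective.one_le_topologicalKrullDim (hX : IsProjective X) {E : WeilDivisor X} (h1 : 1 ∈ H0 E) {f : X.functionField}
    (hf : f ∈ H0 E) (hfc : ∀ c : ℂ, algebraMap ℂ X.functionField c ≠ f) : 1 ≤ topologicalKrullDim (linearSystemImage E) := by
  classical
  let β := Module.Basis.ofVectorSpace ℂ (H0 E)
  let s : Module.Basis.ofVectorSpaceIndex ℂ (H0 E) → X.functionField := fun i => (β i : X.functionField)
  have hs0 : ∀ i, s i ≠ 0 := fun i h => β.ne_zero i (Subtype.ext h)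
  have hf0 : f ≠ 0 := fun h => hfc 0 (by rw [map_zero, h])
  obtain ⟨P, hP⟩ : ∃ P : PrimeDivisor X, Scheme.ord f P.point < 0 := by
    by_contra! h
    obtain ⟨c, hc⟩ := hX.exists_algebraMap_eq h
    exact hfc c hc
  obtain ⟨t, ht, -⟩ := P.exists_ord_eq_one
  set T : X.functionField := algebraMap _ X.functionField t with hT
  have hT0 : T ≠ 0 := fun h0 => by simp [h0] at ht
  have hne : Nonempty (Module.Basis.ofVectorSpaceIndex ℂ (H0 E)) := by
    by_contra hempty
    rw [not_nonempty_iff] at hempty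
    have : Subsingleton (H0 E) := β.repr.toEquiv.subsingleton
    exact hf0 (congrArg Subtype.val (Subsingleton.elim (⟨f, hf⟩ : H0 E) 0))
  -- `a` is the least order of a coordinate along `P`; it exists even for an infinite basis, because
  -- membership in `H0 E` bounds orders below by `-E P`. After multiplication by `T ^ (-a)` all
  -- coordinates lie in the local ring and the one of index `i₀` is a unit.
  obtain ⟨a, ⟨i₀, hi₀⟩, hmin⟩ := Int.exists_least_of_bdd (P := fun a => ∃ i, Scheme.ord (s i) P.point = a)
    ⟨- E P, by rintro _ ⟨i, rfl⟩; linarith [((β i).2.resolve_left (hs0 i)) P trivial]⟩ ⟨_, hne.some, rfl⟩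
  have hord : ∀ i, Scheme.ord (T ^ (-a) * s i) P.point = Scheme.ord (s i) P.point - a := fun i => by
    rw [Scheme.ord_mul (zpow_ne_zero _ hT0) (hs0 i), Scheme.ord_zpow hT0, ht]; ring
  have hr : ∀ i, ∃ r : X.presheaf.stalk P.point, algebraMap _ X.functionField r = T ^ (-a) * s i := fun i =>
    (P.ord_nonneg_iff (mul_ne_zero (zpow_ne_zero _ hT0) (hs0 i))).mp (by
      rw [hord]; linarith [hmin _ ⟨i, rfl⟩])
  choose r hr using hr
  have hr0 : ∀ i, r i ≠ 0 := fun i h => mul_ne_zero (zpow_ne_zero (-a) hT0) (hs0 i) (by rw [← hr, h, map_zero])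
  let φ := (X.presheaf.germ ⊤ P.point trivial).hom.comp (constants X)
  have hφ : (algebraMap _ X.functionField).comp φ = algebraMap ℂ X.functionField :=
    RingHom.ext fun c => Scheme.algebraMap_germ_eq_germToFunctionField X (U := ⊤) trivial (constants X c)
  have heval : ∀ (d : ℕ) (F : MvPolynomial _ ℂ), F.IsHomogeneous d →
      algebraMap _ X.functionField (eval₂ φ r F) = (T ^ (-a)) ^ d * aeval s F := by
    intro d F hF
    rw [hom_eval₂, hφ, aeval_def, ← eval₂_smul_of_isHomogeneous _ _ hF]
    congr 1
    funext i
    exact hr i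
  have hinj := IsFractionRing.injective (X.presheaf.stalk P.point) X.functionField
  have hres : residue _ (r i₀) ≠ 0 := by
    rw [Ne, residue_eq_zero_iff, ← P.ord_pos_iff (hr0 i₀), hr, hord, hi₀]
    simp
  -- `p` is the generic point of the image, and `q` is where the generic point of `P` goes.
  let p := conePoint φ r ⟨i₀, hr0 i₀⟩
  let q := conePoint ((residue _).comp φ) (fun i => residue _ (r i)) ⟨i₀, hres⟩
  have hpq : p ≤ q := conePoint_le φ r ⟨i₀, hr0 i₀⟩ (residue _) ⟨i₀, hres⟩
  have hp : p ∈ linearSystemImage E := by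
    intro d F hF hF0
    refine (mem_conePoint φ r ⟨i₀, hr0 i₀⟩ hF).mpr (hinj ?_)
    rw [heval d F hF, map_zero]
    exact mul_eq_zero_of_right _ hF0
  have hq : q ∈ linearSystemImage E := fun d F hF hF0 => (ProjectiveSpectrum.as_ideal_le_as_ideal _ _ _).mpr hpq (hp d F hF hF0)
  have hqp : ¬ q ≤ p := by
    intro hqp
    -- As a linear form in the rescaled coordinates, `T ^ (-a) * f` is integral at `P`, so `a ≤ ord
    -- f < 0`.
    obtain ⟨G, hG, hGf⟩ := aeval_basis_eq E ⟨f, hf⟩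
    have h2 := heval 1 G hG
    have hfr : 0 ≤ Scheme.ord ((T ^ (-a)) * f) P.point := by
      rw [P.ord_nonneg_iff (mul_ne_zero (zpow_ne_zero _ hT0) hf0)]
      exact ⟨_, by rw [h2, pow_one]; exact congrArg _ hGf⟩
    rw [Scheme.ord_mul (zpow_ne_zero _ hT0) hf0, Scheme.ord_zpow hT0, ht] at hfr
    -- The form for `1` takes the value `T ^ (-a)`, of positive order: it vanishes at `q` but not at
    -- `p`.
    obtain ⟨L, hL, hL1⟩ := aeval_basis_eq E ⟨1, h1⟩
    have h3 := heval 1 L hL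
    have hL1' : aeval s L = 1 := hL1
    rw [hL1', pow_one, mul_one] at h3
    have hne : eval₂ φ r L ≠ 0 := fun h => zpow_ne_zero (-a) hT0 (by rw [← h3, h, map_zero])
    have hLq : L ∈ q.asHomogeneousIdeal := by
      refine (mem_conePoint _ _ ⟨i₀, hres⟩ hL).mpr ?_
      rw [← hom_eval₂ L φ (residue _) r, residue_eq_zero_iff, ← P.ord_pos_iff hne, h3, Scheme.ord_zpow hT0, ht]
      linarith
    have hLp : L ∈ p.asHomogeneousIdeal := (ProjectiveSpectrum.as_ideal_le_as_ideal _ _ _).mpr hqp hLq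
    exact hne ((mem_conePoint φ r ⟨i₀, hr0 i₀⟩ hL).mp hLp)
  have hspec : ∀ x y : linearSystemImage E, x.1 ≤ y.1 ↔ x ⤳ y := fun x y => by
    rw [ProjectiveSpectrum.le_iff_mem_closure, subtype_specializes_iff, specializes_iff_mem_closure]
  exact _root_.one_le_topologicalKrullDim ((hspec ⟨p, hp⟩ ⟨q, hq⟩).mp hpq) fun h => hqp ((hspec ⟨q, hq⟩ ⟨p, hp⟩).mpr h)

end RigidDivisors

end

/-! ### Rigid divisors: parts (a) and (b) -/

section

open CategoryTheory Opposite AlgebraicGeometry RigidDivisors IsLocalRing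

section
variable {ι α M : Type*} [Fintype ι] [AddCommMonoid M] {P : ι → α}

theorem Finsupp.sum_single_apply_of_injective (hP : Function.Injective P) (a : ι → M) (j : ι) :
    (∑ i, Finsupp.single (P i) (a i)) (P j) = a j := by
  classical
  rw [Finsupp.finsetSum_apply, Finset.sum_eq_single j (fun i _ hij => Finsupp.single_eq_of_ne' (hP.ne hij))
    (fun h => absurd (Finset.mem_univ _) h), Finsupp.single_eq_same]

theorem Finsupp.sum_single_apply_of_notMem_range (a : ι → M) {Q : α} (hQ : Q ∉ Set.range P) :
    (∑ i, Finsupp.single (P i) (a i)) Q = 0 := by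
  rw [Finsupp.finsetSum_apply]
  exact Finset.sum_eq_zero fun i _ => Finsupp.single_eq_of_ne' fun h => hQ ⟨i, h⟩

end

namespace RigidDivisors
open MvPolynomial
attribute [local instance] MvPolynomial.gradedAlgebra

section
universe u
variable {X : Scheme.{u}}

theorem WeilDivisor.toQ_apply (E : WeilDivisor X) (P : PrimeDivisor X) : E.toQ P = (E P : ℚ) := rfl

theorem exists_toQ_eq_smul {D : QDivisor X} (hD : 0 ≤ D) {E : WeilDivisor X} (hE : E.support ⊆ D.support) :
    ∃ (m : ℕ) (E' : WeilDivisor X), 0 < m ∧ E'.toQ = (m : ℚ) • D ∧ E ≤ E' := by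
  classical
  -- `d` clears the denominators, so `d • D` has coefficients at least one on its support;
  -- multiplying by `N`, which exceeds all `|E P|`, then dominates `E`.
  let d : ℕ := ∏ P ∈ D.support, (D P).den
  let N : ℕ := 1 + ∑ P ∈ E.support, (E P).natAbs
  have hd : 0 < d := Finset.prod_pos fun P _ => (D P).den_pos
  have hN : 0 < N := by omega
  have hint : ∀ P, ∃ z : ℤ, (d : ℚ) * D P = z := by
    intro P
    by_cases hP : P ∈ D.support
    · obtain ⟨e, he⟩ := Finset.dvd_prod_of_mem (fun P => (D P).den) hP
      refine ⟨e * (D P).num, ?_⟩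
      have h1 : (d : ℚ) = (D P).den * e := by exact_mod_cast he
      have h2 := Rat.den_mul_eq_num (D P)
      rw [h1]
      push_cast
      linear_combination (e : ℚ) * h2
    · exact ⟨0, by rw [Finsupp.notMem_support_iff.mp hP]; simp⟩
  choose z hz using hint
  have hsupp : ∀ P, z P ≠ 0 → P ∈ D.support := by
    intro P hP
    by_contra h
    have := hz P
    rw [Finsupp.notMem_support_iff.mp h, mul_zero] at this
    exact hP (by exact_mod_cast this.symm)
  refine ⟨N * d, Finsupp.onFinset D.support (fun P => N * z P) fun P hP => hsupp P (right_ne_zero_of_mul hP),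
    by positivity, ?_, ?_⟩
  · ext P
    rw [WeilDivisor.toQ_apply, Finsupp.onFinset_apply, Finsupp.smul_apply, smul_eq_mul]
    push_cast
    rw [mul_assoc, hz]
  · intro P
    rw [Finsupp.onFinset_apply]
    have hzP : 0 ≤ z P := by
      have h1 : (0 : ℚ) ≤ z P := by rw [← hz]; exact mul_nonneg (by positivity) (hD P)
      exact_mod_cast h1
    by_cases hP : P ∈ E.support
    · have hzP' : z P ≠ 0 := by
        intro h0
        have := hz P
        rw [h0, Int.cast_zero, mul_eq_zero] at this
        rcases this with h | h
        · have : d = 0 := by exact_mod_cast h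
          omega
        · exact (Finsupp.mem_support_iff.mp (hE hP)) h
      have h1 : 1 ≤ z P := by omega
      have h2 : (E P).natAbs ≤ ∑ P ∈ E.support, (E P).natAbs :=
        Finset.single_le_sum (f := fun P => (E P).natAbs) (fun _ _ => Nat.zero_le _) hP
      have h3 : E P ≤ N := by omega
      exact h3.trans (le_mul_of_one_le_right (by positivity) h1)
    · rw [Finsupp.notMem_support_iff.mp hP]
      positivity

theorem componentDivisor_injective (D : QDivisor X) : Function.Injective (componentDivisor D) :=
  Finsupp.mapDomain_injective Subtype.val_injective

theorem support_componentDivisor_subset (D : QDivisor X) (n : D.support →₀ ℤ) :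
    (componentDivisor D n).support ⊆ D.support := by
  classical
  refine Finsupp.mapDomain_support.trans fun P hP => ?_
  obtain ⟨Q, -, rfl⟩ := Finset.mem_image.mp hP
  exact Q.2

theorem isPrincipal_zero [AlgebraicGeometry.IsIntegral X] [IsLocallyNoetherian X] : IsPrincipal (0 : WeilDivisor X) :=
  ⟨1, one_ne_zero, fun _ => (Scheme.ord_one _).symm⟩

end

variable {X : Scheme.{0}} [X.Over (Spec (.of ℂ))] [AlgebraicGeometry.IsIntegral X] [IsLocallyNoetherian X] [IsNormalScheme X]

/-- An effective multiple `E' = mD` dominates `E`, so `1` and `f` both lie in `H0 E'`. A nonconstant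
`f` would make the image for `E'` at least one-dimensional, while rigidity allows dimension zero
only. -/
theorem IsProjective.exists_algebraMap_eq_of_isRigid (hX : IsProjective X) {D : QDivisor X} (hD : IsRigid D) {E : WeilDivisor X}
    (hE : E.support ⊆ D.support) {f : X.functionField} (hf : f ∈ H0 E) : ∃ c : ℂ, algebraMap ℂ X.functionField c = f := by
  obtain ⟨m, E', hm, hE', hle⟩ := exists_toQ_eq_smul hD.1 hE
  have hE'0 : 0 ≤ E' := fun P => by
    have h := congrArg (fun F : QDivisor X => F P) hE'
    have h1 : (0 : ℚ) ≤ E' P := by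
      rw [← WeilDivisor.toQ_apply, hE']
      exact mul_nonneg (by positivity) (hD.1 P)
    exact_mod_cast h1
  by_contra! h
  have h1 := hX.one_le_topologicalKrullDim (one_mem_H0 hE'0) (H0_mono hle hf) h
  have h2 : topologicalKrullDim (linearSystemImage E') ≤ iitakaDim D :=
    le_iSup_of_le m (le_iSup_of_le E' (le_iSup_of_le ⟨hm, hE'⟩ le_rfl))
  rw [hD.2] at h2
  exact absurd (h1.trans h2) (by decide)

/-- One coordinate means a projective space with at most one point; the generic point of the image
shows that the image is nonempty, so the dimension is `0` and not `⊥`. -/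
theorem topologicalKrullDim_linearSystemImage_eq_zero {E : WeilDivisor X} (hE : Module.finrank ℂ (H0 E) = 1) :
    topologicalKrullDim (linearSystemImage E) = 0 := by
  let β := Module.Basis.ofVectorSpace ℂ (H0 E)
  have := Module.finite_of_finrank_pos (R := ℂ) (M := H0 E) (by omega)
  have hfin := Module.Finite.finite_basis β
  have hcard := Module.finrank_eq_nat_card_basis β
  rw [hE, eq_comm, Nat.card_eq_one_iff_unique] at hcard
  obtain ⟨hsub, ⟨i⟩⟩ := hcard
  let _ : Unique (Module.Basis.ofVectorSpaceIndex ℂ (H0 E)) := ⟨⟨i⟩, fun j => Subsingleton.elim _ _⟩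
  have := ProjectiveSpectrum.subsingleton_of_unique (ι := Module.Basis.ofVectorSpaceIndex ℂ (H0 E)) (k := ℂ)
  have hs0 : (β i : X.functionField) ≠ 0 := fun h => β.ne_zero i (Subtype.ext h)
  let p := conePoint (algebraMap ℂ X.functionField) (fun i => (β i : X.functionField)) ⟨i, hs0⟩
  have hp : p ∈ linearSystemImage E := fun d F hF hF0 => (mem_conePoint _ _ ⟨i, hs0⟩ hF).mpr hF0
  have : Nonempty (TopologicalSpace.IrreducibleCloseds (linearSystemImage E)) :=
    ⟨⟨closure {⟨p, hp⟩}, isIrreducible_singleton.closure, isClosed_closure⟩⟩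
  have : Subsingleton (TopologicalSpace.IrreducibleCloseds (linearSystemImage E)) := by
    constructor
    intro A B
    apply TopologicalSpace.IrreducibleCloseds.ext
    exact (Set.Nonempty.eq_univ A.isIrreducible.nonempty).trans (Set.Nonempty.eq_univ B.isIrreducible.nonempty).symm
  exact Order.krullDim_eq_zero

theorem IsProjective.isRigid_iff (hX : IsProjective X) {D : QDivisor X} (hD : 0 ≤ D) :
    IsRigid D ↔
        ∃ (l : ℕ) (P : Fin l → PrimeDivisor X) (r : Fin l → ℚ),
          Function.Injective P ∧ (∀ i, 0 < r i) ∧ D = ∑ i, Finsupp.single (P i) (r i) ∧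
            ∀ n : Fin l → ℕ,
              Module.finrank ℂ (H0 (∑ i, Finsupp.single (P i) (n i : ℤ) : WeilDivisor X)) = 1 := by
  constructor
  · intro hr
    let e := D.support.equivFin
    have hinj : Function.Injective fun i => (e.symm i).1 := Subtype.val_injective.comp e.symm.injective
    refine ⟨_, fun i => (e.symm i).1, fun i => D (e.symm i).1, hinj,
      fun i => (hD _).lt_of_ne' (Finsupp.mem_support_iff.mp (e.symm i).2), ?_, fun n => ?_⟩
    · rw [Equiv.sum_comp e.symm (fun P : D.support => Finsupp.single P.1 (D P.1)),
        Finset.sum_coe_sort D.support (fun P => Finsupp.single P (D P))]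
      exact (Finsupp.sum_single D).symm
    · set E : WeilDivisor X := ∑ i, Finsupp.single (e.symm i).1 (n i : ℤ) with hE
      have hE0 : 0 ≤ E := Finset.sum_nonneg fun i _ => Finsupp.single_nonneg.mpr (by positivity)
      have hsupp : E.support ⊆ D.support := by
        intro Q hQ
        by_contra h
        apply Finsupp.mem_support_iff.mp hQ
        refine Finsupp.sum_single_apply_of_notMem_range (P := fun i => (e.symm i).1) _ ?_
        rintro ⟨i, rfl⟩
        exact h (e.symm i).2
      rw [finrank_eq_one_iff']
      refine ⟨⟨1, one_mem_H0 hE0⟩, fun h => one_ne_zero (congrArg Subtype.val h), fun w => ?_⟩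
      obtain ⟨c, hc⟩ := hX.exists_algebraMap_eq_of_isRigid hr hsupp w.2
      refine ⟨c, Subtype.ext ?_⟩
      rw [← hc, Algebra.algebraMap_eq_smul_one]
      rfl
  · rintro ⟨l, P, r, hP, hr, rfl, hn⟩
    have key : ∀ (m : ℕ) (E : WeilDivisor X), E.toQ = (m : ℚ) • (∑ i, Finsupp.single (P i) (r i) : QDivisor X) →
        topologicalKrullDim (linearSystemImage E) = 0 := by
      intro m E hE
      have hE' : ∀ Q, (E Q : ℚ) = m * (∑ i, Finsupp.single (P i) (r i) : QDivisor X) Q := fun Q => by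
        rw [← WeilDivisor.toQ_apply, hE]; rfl
      -- The coefficients of `E = mD` are nonnegative, so `toNat` loses nothing and the hypothesis
      -- on natural combinations applies.
      have hEeq : E = ∑ i, Finsupp.single (P i) ((E (P i)).toNat : ℤ) := by
        ext Q
        by_cases hQ : Q ∈ Set.range P
        · obtain ⟨j, rfl⟩ := hQ
          have h := hE' (P j)
          rw [Finsupp.sum_single_apply_of_injective hP] at h ⊢
          have : (0 : ℚ) ≤ E (P j) := by rw [h]; exact mul_nonneg (by positivity) (hr j).le
          rw [Int.toNat_of_nonneg (by exact_mod_cast this)]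
        · have h := hE' Q
          rw [Finsupp.sum_single_apply_of_notMem_range _ hQ, mul_zero] at h
          rw [Finsupp.sum_single_apply_of_notMem_range _ hQ]
          exact_mod_cast h
      rw [hEeq]
      exact topologicalKrullDim_linearSystemImage_eq_zero (hn _)
    refine ⟨hD, le_antisymm ?_ ?_⟩
    · exact iSup_le fun m => iSup_le fun E => iSup_le fun h => (key m E h.2).le
    -- Applied to `0`, this only provides one integral positive multiple of `D`, which keeps the
    -- supremum from being `⊥`.
    · obtain ⟨m, E, hm, hE, -⟩ := exists_toQ_eq_smul hD (E := 0) (by simp)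
      rw [← key m E hE]
      exact le_iSup_of_le m (le_iSup_of_le E (le_iSup_of_le ⟨hm, hE⟩ le_rfl))

/-- If `E = div f`, then `div f - E = 0` puts `f` in `H0 (-E)`, so `f` is constant and has order
zero everywhere. -/
theorem IsProjective.eq_zero_of_isPrincipal (hX : IsProjective X) {D : QDivisor X} (hD : IsRigid D) {E : WeilDivisor X}
    (hE : E.support ⊆ D.support) (h : IsPrincipal E) : E = 0 := by
  obtain ⟨f, hf0, hf⟩ := h
  obtain ⟨c, rfl⟩ := hX.exists_algebraMap_eq_of_isRigid hD (E := -E) (by rwa [Finsupp.support_neg])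
    (Or.inr fun P _ => by rw [← hf, Finsupp.neg_apply, add_neg_cancel])
  ext P
  rw [hf, ord_algebraMap, Finsupp.zero_apply]

theorem IsProjective.isPrincipal_componentDivisor_iff (hX : IsProjective X) {D : QDivisor X} (hD : IsRigid D)
    (n : D.support →₀ ℤ) : IsPrincipal (componentDivisor D n) ↔ n = 0 := by
  constructor
  · intro h
    apply componentDivisor_injective D
    rw [hX.eq_zero_of_isPrincipal hD (support_componentDivisor_subset D n) h, map_zero]
  · rintro rfl
    rw [map_zero]
    exact isPrincipal_zero

end RigidDivisors

end

/-! ### Weil divisors on regular schemes are locally principal -/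

section

open CategoryTheory Opposite AlgebraicGeometry RigidDivisors IsLocalRing

universe u

section
variable {X : Scheme.{u}} [AlgebraicGeometry.IsIntegral X] [IsLocallyNoetherian X] [IsNormalScheme X]

/-- Near a point `x` of `P`, the ideal `p` of `P` is principal in the regular local ring at `x`,
hence generated by one function `y` on a basic open neighbourhood. It remains to compute the order
of `y` at each prime divisor meeting that neighbourhood. -/
theorem RigidDivisors.PrimeDivisor.exists_ord_eq_single (hreg : ∀ x : X, ∃ V : X.Opens, IsAffineOpen V ∧ x ∈ V ∧ IsRegularRing Γ(X, V))
    (P : PrimeDivisor X) (x : X) : ∃ U : X.Opens, x ∈ U ∧ ∃ f : X.functionField, f ≠ 0 ∧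
      ∀ Q : PrimeDivisor X, Q.point ∈ U → Scheme.ord f Q.point = Finsupp.single P (1 : ℤ) Q := by
  classical
  by_cases hx : x ∈ closure {P.point}
  swap
  -- Off the closure of `P` the function `1` is a local equation.
  · refine ⟨⟨(closure {P.point})ᶜ, isClosed_closure.isOpen_compl⟩, hx, 1, one_ne_zero, fun Q hQ => ?_⟩
    rw [Scheme.ord_one, Finsupp.single_eq_of_ne]
    rintro rfl
    exact hQ (subset_closure rfl)
  have hspec : P.point ⤳ x := specializes_iff_mem_closure.mpr hx
  obtain ⟨V, hV, hxV, hVreg⟩ := hreg x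
  have hPV : P.point ∈ V := hspec.mem_open V.isOpen hxV
  have : Nonempty V := ⟨⟨x, hxV⟩⟩
  set p := (hV.primeIdealOf ⟨P.point, hPV⟩).asIdeal with hp
  set q := (hV.primeIdealOf ⟨x, hxV⟩).asIdeal with hq
  have hp1 : p.height = 1 := by rw [hp, IsAffineOpen.height_primeIdealOf, P.coheight_point]
  have hmem : ∀ (y : V) (a : Γ(X, V)), a ∈ (hV.primeIdealOf y).asIdeal ↔ y.1 ∉ X.basicOpen a := fun y a => by
    rw [IsAffineOpen.mem_primeIdealOf, Scheme.mem_basicOpen X a y.1 y.2, IsLocalRing.mem_maximalIdeal, mem_nonunits_iff]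
  have hpq : p ≤ q := fun a ha => (hmem _ a).mpr fun h => (hmem _ a).mp ha (hspec.mem_open (X.basicOpen a).isOpen h)
  have hprinc : (p.map (algebraMap Γ(X, V) (Localization.AtPrime q))).IsPrincipal := by
    have := IsRegularRing.localizationAtPrime Γ(X, V) q
    have hdisj : Disjoint (q.primeCompl : Set Γ(X, V)) p :=
      Set.disjoint_left.mpr fun y hy hyp => hy (hpq hyp)
    refine IsRegularRing.isPrincipal_of_height_le_one (Localization.AtPrime q) _
      (IsLocalization.isPrime_of_isPrime_disjoint q.primeCompl _ _ inferInstance hdisj) ?_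
    rw [IsLocalization.height_map_of_disjoint q.primeCompl p hdisj, hp1]
  obtain ⟨s, hs, y, hyp, hy⟩ := Ideal.exists_smul_le_span_singleton_of_isPrincipal_map p q (Localization.AtPrime q) hprinc
  have hs0 : s ≠ 0 := fun h => hs (h ▸ zero_mem _)
  have hy0 : y ≠ 0 := by
    rintro rfl
    have : p = ⊥ := by
      rw [eq_bot_iff]
      intro z hz
      have := hy z hz
      rw [Ideal.span_singleton_eq_bot.mpr rfl, Ideal.mem_bot] at this
      exact (mul_eq_zero.mp this).resolve_left hs0
    rw [this, Ideal.height_bot] at hp1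
    exact zero_ne_one hp1
  have hinj := X.germToFunctionField_injective V
  have hne : ∀ a : Γ(X, V), a ≠ 0 → X.germToFunctionField V a ≠ 0 := fun a ha => by
    rwa [Ne, map_eq_zero_iff _ hinj]
  have hunit : ∀ (Q : PrimeDivisor X) (hQ : Q.point ∈ V) (a : Γ(X, V)), a ∉ (hV.primeIdealOf ⟨Q.point, hQ⟩).asIdeal →
      Scheme.ord (X.germToFunctionField V a) Q.point = 0 := by
    intro Q hQ a ha
    rw [Q.ord_eq_zero_iff (hne a (by rintro rfl; exact ha (zero_mem _)))]
    refine ⟨X.presheaf.germ V Q.point hQ a, ?_, Scheme.algebraMap_germ_eq_germToFunctionField X hQ a⟩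
    rw [IsAffineOpen.mem_primeIdealOf, IsLocalRing.mem_maximalIdeal, mem_nonunits_iff, not_not] at ha
    exact ha
  refine ⟨X.basicOpen s, by simpa using (hmem ⟨x, hxV⟩ s).not.mp hs, X.germToFunctionField V y, hne y hy0, fun Q hQ => ?_⟩
  have hQV : Q.point ∈ V := X.basicOpen_le s hQ
  have hsQ : s ∉ (hV.primeIdealOf ⟨Q.point, hQV⟩).asIdeal := fun h => (hmem _ s).mp h hQ
  by_cases hQP : Q = P
  · subst hQP
    rw [Finsupp.single_eq_same]
    -- Clearing denominators of a uniformizer gives `z ∈ p` of order one. From `c * y = s * z` with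
    -- `s` a unit at `Q`, `ord c + ord y = 1`; as `ord c ≥ 0` and `ord y > 0`, the order of `y` is
    -- one.
    obtain ⟨t, ht, htm⟩ := Q.exists_ord_eq_one
    let _ := X.presheaf.algebra_section_stalk (⟨Q.point, hQV⟩ : V)
    have hloc := hV.isLocalization_stalk ⟨Q.point, hQV⟩
    have := functionField_isScalarTower X V ⟨Q.point, hQV⟩
    obtain ⟨z, u, hzu⟩ := IsLocalization.exists_mk'_eq (hV.primeIdealOf ⟨Q.point, hQV⟩).asIdeal.primeCompl t
    have h1 : X.presheaf.germ V Q.point hQV u.1 * t = X.presheaf.germ V Q.point hQV z := by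
      rw [← hzu]
      exact IsLocalization.mk'_spec' (X.presheaf.stalk Q.point) z u
    have ht0 : algebraMap (X.presheaf.stalk Q.point) X.functionField t ≠ 0 := fun h0 => by simp [h0] at ht
    have hu0 : u.1 ≠ 0 := fun h => u.2 (h ▸ zero_mem _)
    have h2 := congrArg (algebraMap _ X.functionField) h1
    rw [map_mul, Scheme.algebraMap_germ_eq_germToFunctionField, Scheme.algebraMap_germ_eq_germToFunctionField] at h2
    have h3 : Scheme.ord (X.germToFunctionField V z) Q.point = 1 := by
      rw [← h2, Scheme.ord_mul (hne _ hu0) ht0, hunit Q hQV _ u.2, ht, zero_add]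
    have hz0 : z ≠ 0 := by
      rintro rfl
      rw [map_zero] at h3
      simp at h3
    have hzp : z ∈ p := by
      rw [hp, IsAffineOpen.mem_primeIdealOf, ← h1]
      exact Ideal.mul_mem_left _ _ (htm ▸ Ideal.mem_span_singleton_self t)
    obtain ⟨c, hc⟩ := Ideal.mem_span_singleton'.mp (hy z hzp)
    have hc0 : c ≠ 0 := by
      rintro rfl
      rw [zero_mul] at hc
      exact mul_ne_zero hs0 hz0 hc.symm
    have h4 := congrArg (fun a => Scheme.ord (X.germToFunctionField V a) Q.point) hc
    simp only [map_mul] at h4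
    rw [Scheme.ord_mul (hne _ hc0) (hne _ hy0), Scheme.ord_mul (hne _ hs0) (hne _ hz0), h3, hunit Q hQV s hsQ] at h4
    have h5 : 0 ≤ Scheme.ord (X.germToFunctionField V c) Q.point := Scheme.ord_germ_nonneg hQV
    have h6 : 0 < Scheme.ord (X.germToFunctionField V y) Q.point := by
      rw [← Scheme.algebraMap_germ_eq_germToFunctionField X hQV, Q.ord_pos_iff (by
        rwa [Ne, map_eq_zero_iff _ (germ_injective_of_isIntegral X Q.point hQV)]),
        ← IsAffineOpen.mem_primeIdealOf hV ⟨Q.point, hQV⟩]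
      exact hyp
    omega
  · rw [Finsupp.single_eq_of_ne hQP]
    -- If `y` vanishes at `Q`, then `p` is contained in the prime of `Q`; both have height one, so
    -- they coincide.
    refine hunit Q hQV y fun hyQ => hQP ?_
    set r := (hV.primeIdealOf ⟨Q.point, hQV⟩).asIdeal with hr
    have hr1 : r.height = 1 := by rw [hr, IsAffineOpen.height_primeIdealOf, Q.coheight_point]
    have hpr : p ≤ r := by
      intro z hz
      refine ((inferInstance : r.IsPrime).mem_or_mem ?_).resolve_left hsQ
      exact (Ideal.span_singleton_le_iff_mem _).mpr hyQ (hy z hz)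
    have hpr' : p = r := by
      by_contra hne
      have hlt : p < r := lt_of_le_of_ne hpr hne
      have := IsAffineOpen.isNoetherianRing hV
      have h := Ideal.height_strict_mono_of_isPrime hlt
      rw [hp1, hr1] at h
      exact lt_irrefl _ h
    ext
    refine (hV.fromSpec_primeIdealOf ⟨Q.point, hQV⟩).symm.trans (Eq.trans ?_ (hV.fromSpec_primeIdealOf ⟨P.point, hPV⟩))
    exact congrArg hV.fromSpec (PrimeSpectrum.ext hpr'.symm)

/-- On a regular scheme every Weil divisor is locally principal. -/
theorem RigidDivisors.WeilDivisor.exists_ord_eq (hreg : ∀ x : X, ∃ V : X.Opens, IsAffineOpen V ∧ x ∈ V ∧ IsRegularRing Γ(X, V))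
    (D : WeilDivisor X) (x : X) : ∃ U : X.Opens, x ∈ U ∧ ∃ f : X.functionField, f ≠ 0 ∧
      ∀ Q : PrimeDivisor X, Q.point ∈ U → Scheme.ord f Q.point = D Q := by
  classical
  choose U hxU f hf0 hf using fun P => PrimeDivisor.exists_ord_eq_single hreg P x
  refine ⟨D.support.inf U, ?_, ∏ P ∈ D.support, f P ^ D P, Finset.prod_ne_zero_iff.mpr fun P _ => zpow_ne_zero _ (hf0 P),
    fun Q hQ => ?_⟩
  · exact Finset.inf_induction (p := fun V : X.Opens => x ∈ V) trivial (fun _ h _ h' => ⟨h, h'⟩) fun P _ => hxU P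
  · rw [Scheme.ord_prod _ fun P _ => zpow_ne_zero _ (hf0 P)]
    conv_rhs => rw [← Finsupp.sum_single D, Finsupp.sum, Finsupp.finsetSum_apply]
    refine Finset.sum_congr rfl fun P hP => ?_
    rw [Scheme.ord_zpow (hf0 P), hf P Q (Finset.inf_le (f := U) hP hQ), Finsupp.single_apply, Finsupp.single_apply]
    split_ifs <;> simp

end

end

/-! ### Prime divisors and open subsets -/

section

open CategoryTheory Opposite AlgebraicGeometry RigidDivisors TopologicalSpace

universe u

section
variable {X : Scheme.{u}}

/-- In this order `x ≤ y` means that `y` specializes to `x`, so coheight is codimension, and it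
drops strictly under proper generization when it is finite. -/
theorem AlgebraicGeometry.Scheme.eq_of_le_of_coheight_le {x y : X} (h : x ≤ y) (hx : Order.coheight x ≠ ⊤)
    (h' : Order.coheight x ≤ Order.coheight y) : x = y := by
  by_contra hne
  have hlt : x < y := lt_of_le_not_ge h fun h1 =>
    hne ((Scheme.le_iff_specializes.mp h1).antisymm (Scheme.le_iff_specializes.mp h)).eq
  exact absurd (Order.coheight_strictAnti hlt ((Order.coheight_anti h).trans_lt hx.lt_top)) h'.not_gt

theorem RigidDivisors.PrimeDivisor.eq_of_mem_carrier {P Q : PrimeDivisor X} (h : P.point ∈ Q.carrier) : P = Q := by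
  have h1 : P.point ≤ Q.point := specializes_iff_mem_closure.mpr h
  exact PrimeDivisor.ext (Scheme.eq_of_le_of_coheight_le h1 (by rw [P.coheight_point]; simp)
    (by rw [P.coheight_point, Q.coheight_point]))

theorem RigidDivisors.PrimeDivisor.mem_supportComplement_iff {D : QDivisor X} {P : PrimeDivisor X} :
    P.point ∈ supportComplement D ↔ P ∉ D.support := by
  change P.point ∉ (⋃ Q ∈ D.support, Q.carrier) ↔ _
  rw [not_iff_not, Set.mem_iUnion₂]
  constructor
  · rintro ⟨Q, hQ, h⟩
    rwa [PrimeDivisor.eq_of_mem_carrier h]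
  · exact fun h => ⟨P, h, subset_closure rfl⟩

variable [AlgebraicGeometry.IsIntegral X]

theorem AlgebraicGeometry.Scheme.coheight_genericPoint : Order.coheight (genericPoint X) = 0 :=
  Order.coheight_top X

theorem AlgebraicGeometry.Scheme.eq_genericPoint_of_coheight_eq_zero {x : X} (h : Order.coheight x = 0) : x = genericPoint X :=
  Scheme.eq_of_le_of_coheight_le (le_top (a := x)) (by rw [h]; simp) (by rw [h]; simp)

theorem RigidDivisors.genericPoint_mem_supportComplement (D : QDivisor X) : genericPoint X ∈ supportComplement D := by
  change _ ∉ (⋃ Q ∈ D.support, Q.carrier)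
  rw [Set.mem_iUnion₂]
  rintro ⟨Q, hQ, h⟩
  have h1 : genericPoint X ≤ Q.point := specializes_iff_mem_closure.mpr h
  have h2 := Order.coheight_anti h1
  rw [Q.coheight_point, Scheme.coheight_genericPoint] at h2
  simp at h2

/-- All but finitely many prime divisors meet a given nonempty open subset. -/
theorem RigidDivisors.PrimeDivisor.finite_notMem [IsLocallyNoetherian X] [CompactSpace X] (W : X.Opens) [hW : Nonempty W] :
    {P : PrimeDivisor X | P.point ∉ W}.Finite := by
  have : IsNoetherian X := {}
  -- A prime divisor missing `W` lies in one of the finitely many components of the complement. The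
  -- generic point of that component is not that of `X`, so it has codimension at least one and must
  -- be the point of the prime divisor.
  obtain ⟨S, hS, hirr, hSup⟩ := NoetherianSpace.exists_finite_set_closeds_irreducible
    (⟨(W : Set X)ᶜ, W.isOpen.isClosed_compl⟩ : Closeds X)
  choose! g hg using fun t (ht : t ∈ S) => QuasiSober.sober (hirr t ht) t.isClosed
  have hmem : ∀ x : X, x ∉ W ↔ ∃ t ∈ S, x ∈ t := by
    intro x
    have h1 : x ∉ W ↔ x ∈ (⟨(W : Set X)ᶜ, W.isOpen.isClosed_compl⟩ : Closeds X) := Iff.rfl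
    lift S to Finset (Closeds X) using hS
    rw [h1, hSup, ← SetLike.mem_coe, ← Finset.sup_id_eq_sSup, Closeds.coe_finset_sup, Finset.sup_eq_iSup]
    simp
  refine Set.Finite.of_finite_image (f := PrimeDivisor.point) ((hS.image g).subset ?_) (fun P _ Q _ => PrimeDivisor.ext)
  rintro _ ⟨P, hP, rfl⟩
  obtain ⟨t, ht, hPt⟩ := (hmem P.point).mp hP
  refine ⟨t, ht, ?_⟩
  have h1 : P.point ≤ g t := (hg t ht).specializes hPt
  refine (Scheme.eq_of_le_of_coheight_le h1 (by rw [P.coheight_point]; simp) ?_).symm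
  rw [P.coheight_point, Order.one_le_iff_pos, pos_iff_ne_zero]
  intro h0
  apply (hmem (g t)).mpr ⟨t, ht, (hg t ht).mem⟩
  rw [Scheme.eq_genericPoint_of_coheight_eq_zero h0]
  exact ((genericPoint_spec X).mem_open_set_iff W.isOpen).mpr (by simpa using hW)

end

end

/-! ### Sheaves whose sections are rational functions -/

section

open CategoryTheory Opposite AlgebraicGeometry RigidDivisors TopologicalSpace

universe u

namespace RigidDivisors

section
variable {X Y : Scheme.{u}} (j : Y ⟶ X) [IsOpenImmersion j]

instance nonempty_image (V : Y.Opens) [h : Nonempty V] : Nonempty (j ''ᵁ V) :=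
  h.map fun y => ⟨j y.1, y.1, y.2, rfl⟩

variable [AlgebraicGeometry.IsIntegral X]

/-- A regular function on a nonempty open subset of `Y`, as a rational function on `X`. -/
noncomputable def toRational (V : Y.Opens) [Nonempty V] : Γ(Y, V) →+* X.functionField :=
  (X.germToFunctionField (j ''ᵁ V)).hom.comp (j.appIso V).inv.hom

theorem toRational_injective (V : Y.Opens) [Nonempty V] : Function.Injective (toRational j V) :=
  (X.germToFunctionField_injective (j ''ᵁ V)).comp (j.appIso V).commRingCatIsoToRingEquiv.symm.injective

theorem toRational_res {V W : Y.Opens} [Nonempty V] [Nonempty W] (i : W ⟶ V) (r : Γ(Y, V)) :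
    toRational j W (Y.presheaf.map i.op r) = toRational j V r := by
  have h : (j.appIso W).inv (Y.presheaf.map i.op r) = X.presheaf.map (j.opensFunctor.map i).op ((j.appIso V).inv r) :=
    ConcreteCategory.congr_hom (Scheme.Hom.appIso_inv_naturality j i.op) r
  change X.germToFunctionField _ ((j.appIso W).inv (Y.presheaf.map i.op r)) = _
  rw [h]
  exact X.presheaf.germ_res_apply _ _ _ _

variable [IsLocallyNoetherian X]

theorem ord_toRational_nonneg {V : Y.Opens} [Nonempty V] (r : Γ(Y, V)) {x : X} (hx : x ∈ j ''ᵁ V) :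
    0 ≤ Scheme.ord (toRational j V r) x :=
  Scheme.ord_germ_nonneg hx

variable [IsNormalScheme X]

theorem exists_toRational_eq (V : Y.Opens) [Nonempty V] {f : X.functionField}
    (hf : ∀ P : PrimeDivisor X, P.point ∈ j ''ᵁ V → 0 ≤ Scheme.ord f P.point) : ∃ r, toRational j V r = f := by
  obtain ⟨a, rfl⟩ := Scheme.exists_germToFunctionField_eq (j ''ᵁ V) hf
  refine ⟨(j.appIso V).hom a, congrArg (X.germToFunctionField (j ''ᵁ V)) ?_⟩
  exact (j.appIso V).commRingCatIsoToRingEquiv.symm_apply_apply a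

theorem subsingleton_sections {M : Y.Modules} {V : Y.Opens} (hV : ¬ Nonempty V) : Subsingleton Γ(M, V) := by
  constructor
  intro a b
  refine TopCat.Sheaf.eq_of_locally_eq' ⟨M.presheaf, M.isSheaf⟩ (fun i : PEmpty.{1} => i.elim) V (fun i => i.elim) ?_ a b fun i => i.elim
  intro y hy
  exact absurd ⟨⟨y, hy⟩⟩ hV

/-- A sheaf of modules whose sections are rational functions, namely those of `𝒪(E)`, is isomorphic to `𝒪(E)`. -/
theorem nonempty_iso_divisorialSheaf {M : Y.Modules} {E : WeilDivisor X} (ψ : ∀ (V : Y.Opens) [Nonempty V], Γ(M, V) →+ X.functionField)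
    (hsmul : ∀ (V : Y.Opens) [Nonempty V] (r : Γ(Y, V)) (m : Γ(M, V)), ψ V (r • m) = toRational j V r * ψ V m)
    (hres : ∀ (V W : Y.Opens) [Nonempty V] [Nonempty W] (i : W ⟶ V) (m : Γ(M, V)), ψ W (M.presheaf.map i.op m) = ψ V m)
    (hinj : ∀ (V : Y.Opens) [Nonempty V], Function.Injective (ψ V))
    (hrange : ∀ (V : Y.Opens) [Nonempty V] (f : X.functionField), (∃ m, ψ V m = f) ↔ IsSectionOn E (j ''ᵁ V) f) :
    Nonempty (M ≅ (divisorialSheaf E).restrict j) := by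
  have hne : ∀ (V : Y.Opens), (j ''ᵁ V : X.Opens) → Nonempty V := by
    rintro V ⟨_, y, hy, rfl⟩
    exact ⟨⟨y, hy⟩⟩
  -- Sections of `𝒪(E)` are constant functions on the open set, so `ψ` is needed only when a point
  -- is given, which covers the empty set as well.
  let φ : M ⟶ (divisorialSheaf E).restrict j := SheafOfModules.Hom.mk
    { app V := ModuleCat.ofHom (R := Y.ringCatSheaf.obj.obj V) (X := M.val.obj V)
        (Y := ((divisorialSheaf E).restrict j).val.obj V)
        { toFun m := (⟨fun x => @ψ V.unop (hne _ x) m, fun _ _ => rfl,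
            fun x => have := hne _ x; (hrange V.unop _).mp ⟨m, rfl⟩⟩ : divisorialSections E (j ''ᵁ V.unop))
          map_add' a b := Subtype.ext (funext fun x => have := hne _ x; map_add (ψ V.unop) a b)
          map_smul' r a := Subtype.ext (funext fun x => have := hne _ x; hsmul V.unop r a) }
      naturality {V W} i := by
        ext m
        apply Subtype.ext
        funext x
        have := hne _ x
        have : Nonempty V.unop := ⟨⟨this.some.1, i.unop.le this.some.2⟩⟩
        exact hres V.unop W.unop i.unop m }
  have hφ : IsIso φ := by
    rw [Scheme.Modules.Hom.isIso_iff_isIso_app]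
    intro V
    rw [ConcreteCategory.isIso_iff_bijective]
    by_cases hV : Nonempty V
    · constructor
      · intro a b hab
        exact hinj V (congrFun (congrArg Subtype.val hab) (nonempty_image j V).some)
      · intro s
        obtain ⟨m, hm⟩ := (hrange V _).mpr ((show divisorialSections E (j ''ᵁ V) from s).2.2 (nonempty_image j V).some)
        refine ⟨m, Subtype.ext (funext fun x => ?_)⟩
        exact hm.trans ((show divisorialSections E (j ''ᵁ V) from s).2.1 _ _)
    · have h1 := subsingleton_sections (M := M) hV
      have h2 := subsingleton_sections (M := (divisorialSheaf E).restrict j) hV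
      exact ⟨fun _ _ _ => Subsingleton.elim _ _, fun _ => ⟨0, Subsingleton.elim _ _⟩⟩
  exact ⟨asIso φ⟩

end

end RigidDivisors

end

/-! ### Invertible sheaves come from Weil divisors -/

section

open CategoryTheory Opposite AlgebraicGeometry RigidDivisors TopologicalSpace

universe u

namespace RigidDivisors

section
variable {Y : Scheme.{u}} {M : Y.Modules}

theorem res_res {U V W : Y.Opens} (i : V ⟶ U) (k : W ⟶ V) (l : W ⟶ U) (m : Γ(M, U)) :
    M.presheaf.map k.op (M.presheaf.map i.op m) = M.presheaf.map l.op m := by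
  rw [← ConcreteCategory.comp_apply, ← M.presheaf.map_comp, ← op_comp, Subsingleton.elim (k ≫ i) l]

/-- `t` freely generates the restriction of `M` to `V`. -/
def IsGenerator (M : Y.Modules) (V : Y.Opens) (t : Γ(M, V)) : Prop :=
  ∀ (W : Y.Opens) (i : W ⟶ V), Function.Bijective fun r : Γ(Y, W) => r • M.presheaf.map i.op t

/-- The generator is the image of `1` under the trivialization. -/
theorem exists_isGenerator_of_iso {Z : Scheme.{u}} (k : Z ⟶ Y) [IsOpenImmersion k] (e : structureModule Z ≅ M.restrict k) :
    ∃ t, IsGenerator M (k ''ᵁ ⊤) t := by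
  have he : ∀ V, Function.Bijective (e.hom.app V) := fun V =>
    (ConcreteCategory.isIso_iff_bijective _).mp (Scheme.Modules.Hom.isIso_iff_isIso_app.mp inferInstance V)
  let one : ∀ V : Z.Opens, Γ(structureModule Z, V) := fun V => (1 : Γ(Z, V))
  refine ⟨e.hom.app ⊤ (one ⊤), fun W i => ?_⟩
  obtain ⟨W, rfl⟩ : ∃ W', W = k ''ᵁ W' := ⟨k ⁻¹ᵁ W, by
    rw [Scheme.Hom.image_preimage_eq_opensRange_inf, eq_comm, inf_eq_right, ← Scheme.Hom.image_top_eq_opensRange]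
    exact i.le⟩
  have h1 : e.hom.app W (one W) = M.presheaf.map i.op (e.hom.app ⊤ (one ⊤)) := by
    have h2 : (structureModule Z).presheaf.map (homOfLE (le_top (a := W))).op (one ⊤) = one W :=
      map_one (Z.presheaf.map (homOfLE (le_top (a := W))).op).hom
    rw [← h2]
    exact ConcreteCategory.congr_hom (e.hom.mapPresheaf.naturality (homOfLE (le_top (a := W))).op) (one ⊤)
  have h3 : (fun r : Γ(Y, k ''ᵁ W) => r • M.presheaf.map i.op (e.hom.app ⊤ (one ⊤))) =
      (e.hom.app W) ∘ fun r => (show Γ(structureModule Z, W) from (k.appIso W).hom r) := by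
    funext r
    have h4 : (show Γ(structureModule Z, W) from (k.appIso W).hom r) = (k.appIso W).hom r • one W :=
      (mul_one ((k.appIso W).hom r)).symm
    rw [Function.comp_apply, h4, Scheme.Modules.Hom.app_smul, h1]
    have h5 : (k.appIso W).inv ((k.appIso W).hom r) = r := (k.appIso W).commRingCatIsoToRingEquiv.symm_apply_apply r
    conv_lhs => rw [← h5]
    rfl
  rw [h3]
  exact (he W).comp (k.appIso W).commRingCatIsoToRingEquiv.bijective

theorem eq_zero_of_locally {V : Y.Opens} {m : Γ(M, V)} (h : ∀ y ∈ V, ∃ (W : Y.Opens) (i : W ⟶ V), y ∈ W ∧ M.presheaf.map i.op m = 0) :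
    m = 0 := by
  choose! W i hyW hW using h
  refine TopCat.Sheaf.eq_of_locally_eq' ⟨M.presheaf, M.isSheaf⟩ (fun y : V => W y.1) V (fun y => i y.1 y.2) ?_ m 0 fun y => ?_
  · intro y hy
    exact Opens.mem_iSup.mpr ⟨⟨y, hy⟩, hyW y hy⟩
  · exact (hW y.1 y.2).trans (map_zero (M.presheaf.map (i y.1 y.2).op).hom).symm

end

section
variable {X Y : Scheme.{u}} (j : Y ⟶ X) [IsOpenImmersion j] [AlgebraicGeometry.IsIntegral X]

section Coordinate
variable [AlgebraicGeometry.IsIntegral Y] {M : Y.Modules} {V₀ : Y.Opens} [hV₀ : Nonempty V₀] {t₀ : Γ(M, V₀)}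

theorem nonempty_inf (V W : Y.Opens) [hV : Nonempty V] [hW : Nonempty W] : Nonempty (V ⊓ W : Y.Opens) := by
  obtain ⟨z, hz⟩ := nonempty_preirreducible_inter V.isOpen W.isOpen (hV.elim fun a => ⟨a.1, a.2⟩) (hW.elim fun a => ⟨a.1, a.2⟩)
  exact ⟨⟨z, hz⟩⟩

/-- Sections of `M` as rational functions, with respect to a generator on a dense open subset. -/
theorem exists_coordinate (ht₀ : IsGenerator M V₀ t₀) : ∃ ψ : ∀ (V : Y.Opens) [Nonempty V], Γ(M, V) →+ X.functionField,
    (∀ (V : Y.Opens) [Nonempty V] (r : Γ(Y, V)) (m : Γ(M, V)), ψ V (r • m) = toRational j V r * ψ V m) ∧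
    (∀ (V W : Y.Opens) [Nonempty V] [Nonempty W] (i : W ⟶ V) (m : Γ(M, V)), ψ W (M.presheaf.map i.op m) = ψ V m) ∧
    ψ V₀ t₀ = 1 ∧
    ∀ (V : Y.Opens) [Nonempty V] (m : Γ(M, V)), ψ V m = 0 → M.presheaf.map (Opens.infLELeft V V₀).op m = 0 := by
  -- The rational function attached to `m` is the ratio `m / t₀`; it can be read off on any nonempty
  -- open subset of `V ⊓ V₀`, with the same result.
  have key : ∀ (V : Y.Opens) [Nonempty V] (m : Γ(M, V)), ∃ x : X.functionField,
      (∀ (W : Y.Opens) [Nonempty W] (i : W ⟶ V) (k : W ⟶ V₀) (r : Γ(Y, W)),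
        M.presheaf.map i.op m = r • M.presheaf.map k.op t₀ → toRational j W r = x) ∧
      ∃ r : Γ(Y, V ⊓ V₀), M.presheaf.map (Opens.infLELeft V V₀).op m = r • M.presheaf.map (Opens.infLERight V V₀).op t₀ := by
    intro V _ m
    have := nonempty_inf V V₀
    obtain ⟨r, hr⟩ := (ht₀ (V ⊓ V₀) (Opens.infLERight V V₀)).2 (M.presheaf.map (Opens.infLELeft V V₀).op m)
    refine ⟨toRational j (V ⊓ V₀) r, fun W _ i k r' hr' => ?_, r, hr.symm⟩
    let l : W ⟶ V ⊓ V₀ := homOfLE (le_inf i.le k.le)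
    rw [← toRational_res j l r]
    congr 1
    apply (ht₀ W k).1
    change r' • _ = Y.presheaf.map l.op r • _
    rw [← hr', ← res_res (Opens.infLERight V V₀) l k t₀, ← Scheme.Modules.map_smul]
    have hr2 := congrArg (M.presheaf.map l.op) hr
    rw [res_res _ _ i] at hr2
    exact hr2.symm
  choose ψ hψ r hr using key
  have hadd : ∀ (V : Y.Opens) [Nonempty V] (a b : Γ(M, V)), ψ V (a + b) = ψ V a + ψ V b := by
    intro V _ a b
    have := nonempty_inf V V₀
    rw [← hψ V a _ _ _ _ (hr V a), ← hψ V b _ _ _ _ (hr V b), ← map_add]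
    refine (hψ V _ (V ⊓ V₀) (Opens.infLELeft V V₀) (Opens.infLERight V V₀) _ ?_).symm
    rw [map_add, hr, hr, add_smul]
  refine ⟨fun V _ => AddMonoidHom.mk' (ψ V) (hadd V), ?_, ?_, ?_, ?_⟩
  · intro V _ a m
    have := nonempty_inf V V₀
    change ψ V _ = _ * ψ V m
    rw [← hψ V m _ _ _ _ (hr V m), ← toRational_res j (Opens.infLELeft V V₀), ← map_mul]
    refine (hψ V _ (V ⊓ V₀) (Opens.infLELeft V V₀) (Opens.infLERight V V₀) _ ?_).symm
    rw [Scheme.Modules.map_smul, hr, mul_smul]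
  · intro V W _ _ i m
    have := nonempty_inf W V₀
    change ψ W _ = ψ V m
    rw [← hψ W _ _ _ _ _ (hr W _)]
    refine hψ V m (W ⊓ V₀) (Opens.infLELeft W V₀ ≫ i) (Opens.infLERight W V₀) _ ?_
    rw [← hr, res_res]
  · change ψ V₀ t₀ = 1
    rw [← map_one (toRational j V₀)]
    exact (hψ V₀ t₀ V₀ (𝟙 _) (𝟙 _) 1 (one_smul _ _).symm).symm
  · intro V _ m hm
    have := nonempty_inf V V₀
    change ψ V m = 0 at hm
    rw [← hψ V m _ _ _ _ (hr V m), map_eq_zero_iff _ (toRational_injective j _)] at hm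
    rw [hr, hm, zero_smul]

end Coordinate

variable [IsLocallyNoetherian X] [IsNormalScheme X] {M : Y.Modules}

/-- Every invertible sheaf on an open subset of `X` is the restriction of a sheaf `𝒪(E)`. -/
theorem exists_iso_divisorialSheaf [CompactSpace X] [hY : Nonempty Y] (hM : ∀ y : Y, ∃ (V : Y.Opens) (t : Γ(M, V)), y ∈ V ∧ IsGenerator M V t) :
    ∃ E : WeilDivisor X, Nonempty (M ≅ (divisorialSheaf E).restrict j) := by
  classical
  have := isIntegral_of_isOpenImmersion j
  choose V t hyV ht using hM
  have hVne : ∀ y, Nonempty (V y) := fun y => ⟨⟨y, hyV y⟩⟩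
  let y₀ := hY.some
  obtain ⟨ψ, hsmul, hres, hone, hzero⟩ := exists_coordinate j (ht y₀)
  -- If the coordinate of `m` is zero, `m` vanishes on `W ⊓ V₀`. Near any other point `m` is a
  -- multiple `r` of a local generator, and `r`, being zero on a dense open subset, is zero.
  have hinj : ∀ (W : Y.Opens) [Nonempty W], Function.Injective (ψ W) := by
    intro W _
    rw [injective_iff_map_eq_zero]
    intro m hm
    refine eq_zero_of_locally fun y hy => ⟨W ⊓ V y, Opens.infLELeft W (V y), ⟨hy, hyV y⟩, ?_⟩
    obtain ⟨r, hr⟩ := (ht y (W ⊓ V y) (Opens.infLERight W (V y))).2 (M.presheaf.map (Opens.infLELeft W (V y)).op m)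
    have h1 := nonempty_inf W (V y)
    have h2 := nonempty_inf (W ⊓ V y) (V y₀)
    let l := Opens.infLELeft (W ⊓ V y) (V y₀)
    have h3 : Y.presheaf.map l.op r = 0 := by
      apply (ht y _ (l ≫ Opens.infLERight W (V y))).1
      change Y.presheaf.map l.op r • _ = 0 • _
      rw [zero_smul, ← res_res (Opens.infLERight W (V y)) l, ← Scheme.Modules.map_smul]
      have hr2 := congrArg (M.presheaf.map l.op) hr
      refine hr2.trans (hzero _ _ ?_)
      rw [hres, hm]
    have h4 : r = 0 := by
      apply toRational_injective j
      rw [← toRational_res j l, h3, map_zero, map_zero]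
    rw [← hr, h4]
    exact zero_smul _ _
  have hne0 : ∀ y, ψ (V y) (t y) ≠ 0 := by
    intro y h
    have h1 : t y = 0 := hinj _ (by rw [h, map_zero])
    have h2 := (ht y (V y) (𝟙 _)).1
    have h3 : (1 : Γ(Y, V y)) = 0 := h2 (by simp only [h1, map_zero, smul_zero])
    exact one_ne_zero h3
  -- Each local generator is a regular multiple of the other on the overlap; exchanging `y` and `z`
  -- shows that their orders agree.
  have hle : ∀ (y z x : Y) (hy : x ∈ V y) (hz : x ∈ V z), Scheme.ord (ψ (V z) (t z)) (j x) ≤ Scheme.ord (ψ (V y) (t y)) (j x) := by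
    intro y z x hy hz
    obtain ⟨r, hr⟩ := (ht z (V y ⊓ V z) (Opens.infLERight _ _)).2 (M.presheaf.map (Opens.infLELeft _ _).op (t y))
    have h1 := nonempty_inf (V y) (V z)
    have h2 := congrArg (ψ _) hr
    simp only [hsmul, hres] at h2
    have h3 : toRational j _ r ≠ 0 := fun h => hne0 y (by rw [← h2, h, zero_mul])
    rw [← h2, Scheme.ord_mul h3 (hne0 z)]
    have h4 := ord_toRational_nonneg j r (x := j x) ⟨x, ⟨hy, hz⟩, rfl⟩
    linarith
  -- The coefficient is minus the order of any local generator at the point, so that the sections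
  -- become those of `𝒪(E)`. Prime divisors not meeting `Y` get coefficient zero.
  let d : PrimeDivisor X → ℤ := fun P => if h : ∃ y, j y = P.point then - Scheme.ord (ψ (V h.choose) (t h.choose)) P.point else 0
  have hd : ∀ (P : PrimeDivisor X) (x y : Y), j x = P.point → x ∈ V y → d P = - Scheme.ord (ψ (V y) (t y)) P.point := by
    intro P x y hx hy
    have h : ∃ y, j y = P.point := ⟨x, hx⟩
    have hxc : h.choose = x := j.isOpenEmbedding.injective (h.choose_spec.trans hx.symm)
    rw [show d P = _ from dif_pos h, neg_inj]
    have hc : x ∈ V h.choose := by rw [hxc]; exact hyV x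
    have h1 := le_antisymm (hle _ _ x hy hc) (hle _ _ x hc hy)
    rwa [hx] at h1
  -- On `V y₀` the generator has coordinate `1`, so the coefficients vanish there, and only finitely
  -- many prime divisors miss this open set.
  have hfin := PrimeDivisor.finite_notMem (j ''ᵁ V y₀)
  let E : WeilDivisor X := Finsupp.onFinset hfin.toFinset d fun P hP => by
    rw [Set.Finite.mem_toFinset]
    rintro ⟨x, hx, hxP⟩
    exact hP (by rw [hd P x y₀ hxP hx, hone, Scheme.ord_one, neg_zero])
  refine ⟨E, nonempty_iso_divisorialSheaf j ψ hsmul hres hinj fun W _ f => ⟨?_, fun hf => ?_⟩⟩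
  · rintro ⟨m, rfl⟩
    by_cases h0 : ψ W m = 0
    · exact Or.inl h0
    refine Or.inr ?_
    rintro P ⟨x, hxW, hxP⟩
    change 0 ≤ _ + d P
    rw [hd P x x hxP (hyV x)]
    obtain ⟨r, hr⟩ := (ht x (W ⊓ V x) (Opens.infLERight _ _)).2 (M.presheaf.map (Opens.infLELeft _ _).op m)
    have h1 := nonempty_inf W (V x)
    have h2 := congrArg (ψ _) hr
    simp only [hsmul, hres] at h2
    have h3 : toRational j _ r ≠ 0 := fun h => h0 (by rw [← h2, h, zero_mul])
    rw [← h2, Scheme.ord_mul h3 (hne0 x)]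
    have h4 := ord_toRational_nonneg j r (x := P.point) ⟨x, ⟨hxW, hyV x⟩, hxP⟩
    linarith
  · rcases hf with rfl | hf
    · exact ⟨0, map_zero _⟩
    by_cases hf0 : f = 0
    · exact ⟨0, by rw [map_zero, hf0]⟩
    -- Locally `f` divided by the generator has no poles, hence is regular; the resulting sections
    -- agree on overlaps since `ψ` is injective.
    have hloc : ∀ y : W, ∃ m : Γ(M, W ⊓ V y.1), ∀ (h : Nonempty (W ⊓ V y.1 : Y.Opens)), ψ (W ⊓ V y.1) m = f := by
      intro y
      have h1 := nonempty_inf W (V y.1)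
      obtain ⟨r, hr⟩ := exists_toRational_eq j (W ⊓ V y.1) (f := f * (ψ _ (t y.1))⁻¹) (by
        rintro P ⟨x, ⟨hxW, hxV⟩, hxP⟩
        rw [Scheme.ord_mul hf0 (inv_ne_zero (hne0 _)), Scheme.ord_inv]
        have := hf P ⟨x, hxW, hxP⟩
        change 0 ≤ _ + d P at this
        rwa [hd P x y.1 hxP hxV] at this)
      refine ⟨r • M.presheaf.map (Opens.infLERight W (V y.1)).op (t y.1), fun _ => ?_⟩
      rw [hsmul, hres, hr, inv_mul_cancel_right₀ (hne0 _)]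
    choose m hm using hloc
    have hmne : ∀ y : W, Nonempty (W ⊓ V y.1 : Y.Opens) := fun y => nonempty_inf _ _
    obtain ⟨s, hs, -⟩ := TopCat.Sheaf.existsUnique_gluing' ⟨M.presheaf, M.isSheaf⟩ (fun y : W => W ⊓ V y.1) W
      (fun y => Opens.infLELeft W (V y.1)) (fun y hy => Opens.mem_iSup.mpr ⟨⟨y, hy⟩, hy, hyV y⟩) m (by
        intro y z
        have h1 := hmne y
        have h2 := hmne z
        have h3 := nonempty_inf (W ⊓ V y.1) (W ⊓ V z.1)
        apply hinj
        exact (hres _ _ _ _).trans ((hm y (hmne y)).trans ((hm z (hmne z)).symm.trans (hres _ _ _ _).symm)))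
    obtain ⟨y⟩ := ‹Nonempty W›
    have h1 := hmne y
    refine ⟨s, ?_⟩
    rw [← hm y (hmne y), ← hs y]
    exact (hres _ _ (Opens.infLELeft W (V y.1)) _).symm

end

end RigidDivisors

end

/-! ### Trivializations and products of the sheaves `𝒪(E)` -/

section

open CategoryTheory MonoidalCategory TensorProduct
open Opposite AlgebraicGeometry RigidDivisors TopologicalSpace

universe u

namespace RigidDivisors

variable {X Y : Scheme.{u}} [AlgebraicGeometry.IsIntegral X] [IsLocallyNoetherian X] [IsNormalScheme X]

section Trivial
variable (j : Y ⟶ X) [IsOpenImmersion j]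

/-- Multiplication by `s` is the isomorphism: `f` is a section of `𝒪(E)` exactly when `f/s` has no
poles, that is, is regular. -/
theorem structureModule_iso_divisorialSheaf {E : WeilDivisor X} {s : X.functionField} (hs : s ≠ 0)
    (hsE : ∀ P : PrimeDivisor X, P.point ∈ Set.range j → Scheme.ord s P.point = - E P) :
    Nonempty (structureModule Y ≅ (divisorialSheaf E).restrict j) := by
  refine nonempty_iso_divisorialSheaf j (M := structureModule Y)
    (fun V _ => AddMonoidHom.mk' (fun r : Γ(Y, V) => toRational j V r * s) fun (a b : Γ(Y, V)) =>
      (congrArg (· * s) (map_add (toRational j V) a b)).trans (add_mul _ _ _))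
    ?_ ?_ ?_ ?_
  · intro V _ (r : Γ(Y, V)) (m : Γ(Y, V))
    change toRational j V (r * m) * s = _ * (toRational j V m * s)
    rw [map_mul, mul_assoc]
  · intro V W _ _ i (m : Γ(Y, V))
    exact congrArg (· * s) (toRational_res j i m)
  · intro V _ a b h
    exact toRational_injective j V (mul_right_cancel₀ hs h)
  · intro V _ f
    constructor
    · rintro ⟨(r : Γ(Y, V)), rfl⟩
      by_cases hr : toRational j V r = 0
      · exact Or.inl (by change toRational j V r * s = 0; rw [hr, zero_mul])
      · refine Or.inr fun P hP => ?_
        obtain ⟨y, hy, hyP⟩ := hP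
        change 0 ≤ Scheme.ord (toRational j V r * s) _ + _
        rw [Scheme.ord_mul hr hs, hsE P ⟨y, hyP⟩, neg_add_cancel_right]
        exact ord_toRational_nonneg j r ⟨y, hy, hyP⟩
    · intro hf
      by_cases hf0 : f = 0
      · exact ⟨(0 : Γ(Y, V)), by change toRational j V 0 * s = f; rw [map_zero, zero_mul, hf0]⟩
      obtain ⟨r, hr⟩ := exists_toRational_eq j V (f := f * s⁻¹) fun P hP => by
        obtain ⟨y, hy, hyP⟩ := hP
        rw [Scheme.ord_mul hf0 (inv_ne_zero hs), Scheme.ord_inv, hsE P ⟨y, hyP⟩, neg_neg]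
        exact hf.resolve_left hf0 P ⟨y, hy, hyP⟩
      refine ⟨r, ?_⟩
      change toRational j V r * s = f
      rw [hr, inv_mul_cancel_right₀ hs]

end Trivial

/-- The section of `𝒪(E)` given by a rational function. -/
def sectionOfFunction {E : WeilDivisor X} {V : X.Opens} {f : X.functionField} (hf : IsSectionOn E V f) : divisorialSections E V :=
  ⟨fun _ => f, fun _ _ => rfl, fun _ => hf⟩

theorem exists_smul_eq_of_ord_eq {E : WeilDivisor X} {V : X.Opens} [hV : Nonempty V] {g : X.functionField} (hg0 : g ≠ 0)
    (hg : ∀ P : PrimeDivisor X, P.point ∈ V → Scheme.ord g P.point = - E P) {f : X.functionField} (hf : IsSectionOn E V f) :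
    ∃ r : Γ(X, V), X.germToFunctionField V r * g = f := by
  by_cases hf0 : f = 0
  · exact ⟨0, by rw [map_zero, zero_mul, hf0]⟩
  obtain ⟨r, hr⟩ := Scheme.exists_germToFunctionField_eq V (f := f * g⁻¹) fun P hP => by
    rw [Scheme.ord_mul hf0 (inv_ne_zero hg0), Scheme.ord_inv, hg P hP, neg_neg]
    exact hf.resolve_left hf0 P hP
  exact ⟨r, by rw [hr, inv_mul_cancel_right₀ hg0]⟩

/-- A divisor is locally principal. -/
def WeilDivisor.IsLocallyPrincipal (E : WeilDivisor X) : Prop :=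
  ∀ x : X, ∃ U : X.Opens, x ∈ U ∧ ∃ g : X.functionField, g ≠ 0 ∧ ∀ Q : PrimeDivisor X, Q.point ∈ U → Scheme.ord g Q.point = - E Q

/-- Take for `s` the image of `1`. Being a section of `𝒪(E)`, it has order at least `-E`. Being a
generator, it divides every local equation `g` of order exactly `-E`, which gives the opposite
inequality; this needs `E` to be locally principal. -/
theorem exists_ord_eq_of_iso (j : Y ⟶ X) [IsOpenImmersion j] [hY : Nonempty Y] {E : WeilDivisor X} (hE : E.IsLocallyPrincipal)
    (e : structureModule Y ≅ (divisorialSheaf E).restrict j) :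
    ∃ s : X.functionField, s ≠ 0 ∧ ∀ P : PrimeDivisor X, P.point ∈ Set.range j → Scheme.ord s P.point = - E P := by
  obtain ⟨t, ht⟩ := exists_isGenerator_of_iso j e
  let t' : divisorialSections E (j ''ᵁ ⊤) := t
  have : Nonempty (⊤ : Y.Opens) := hY.map fun y => ⟨y, trivial⟩
  have hne := nonempty_image j ⊤
  let s := t'.1 hne.some
  have hts : ∀ x, t'.1 x = s := fun x => t'.2.1 _ _
  have hsec : IsSectionOn E (j ''ᵁ ⊤) s := t'.2.2 _
  have key : ∀ x, x ∈ Set.range j → ∃ (W : X.Opens) (_ : Nonempty W), x ∈ W ∧ ∃ (g : X.functionField) (r : Γ(X, W)), g ≠ 0 ∧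
      (∀ Q : PrimeDivisor X, Q.point ∈ W → Scheme.ord g Q.point = - E Q) ∧ X.germToFunctionField W r * s = g := by
    rintro _ ⟨y, rfl⟩
    obtain ⟨U, hxU, g, hg0, hg⟩ := hE (j y)
    let W : X.Opens := j ''ᵁ ⊤ ⊓ U
    have hyW : j y ∈ W := ⟨⟨y, trivial, rfl⟩, hxU⟩
    have hW : Nonempty W := ⟨⟨_, hyW⟩⟩
    have hg' : ∀ Q : PrimeDivisor X, Q.point ∈ W → Scheme.ord g Q.point = - E Q := fun Q hQ => hg Q hQ.2
    obtain ⟨r, hr⟩ := (ht W (Opens.infLELeft _ _)).2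
      (sectionOfFunction (E := E) (V := W) (f := g) (Or.inr fun Q hQ => by rw [hg' Q hQ, neg_add_cancel]))
    refine ⟨W, hW, hyW, g, r, hg0, hg', ?_⟩
    have h1 := congrFun (congrArg Subtype.val hr) ⟨_, hyW⟩
    refine Eq.trans ?_ h1
    exact congrArg (X.germToFunctionField W r * ·) (hts ⟨_, ⟨y, trivial, rfl⟩⟩).symm
  have hs0 : s ≠ 0 := by
    obtain ⟨W, _, -, g, r, hg0, -, hr⟩ := key _ ⟨hY.some, rfl⟩
    intro h
    exact hg0 (by rw [← hr, h, mul_zero])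
  refine ⟨s, hs0, fun P hP => le_antisymm ?_ ?_⟩
  · obtain ⟨W, _, hPW, g, r, hg0, hg, hr⟩ := key _ hP
    rw [← hg P hPW, ← hr, Scheme.ord_mul (fun h => hg0 (by rw [← hr, h, zero_mul])) hs0]
    have := Scheme.ord_germ_nonneg (a := r) hPW
    linarith
  · obtain ⟨y, hy⟩ := hP
    have := hsec.resolve_left hs0 P ⟨y, trivial, hy⟩
    linarith

omit [IsNormalScheme X] in
theorem IsSectionOn.mul {E E' : WeilDivisor X} {V : X.Opens} {f g : X.functionField} (hf : IsSectionOn E V f)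
    (hg : IsSectionOn E' V g) : IsSectionOn (E + E') V (f * g) := by
  by_cases hf0 : f = 0
  · exact Or.inl (by rw [hf0, zero_mul])
  by_cases hg0 : g = 0
  · exact Or.inl (by rw [hg0, mul_zero])
  refine Or.inr fun P hP => ?_
  have h1 := hf.resolve_left hf0 P hP
  have h2 := hg.resolve_left hg0 P hP
  rw [Scheme.ord_mul hf0 hg0, Finsupp.add_apply]
  linarith

/-- Multiplication of sections of `𝒪(E)` and `𝒪(E')`. -/
noncomputable def mulSection {E E' : WeilDivisor X} {V : X.Opens} (m : divisorialSections E V) (n : divisorialSections E' V) :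
    divisorialSections (E + E') V :=
  ⟨fun x => m.1 x * n.1 x, fun x y => congrArg₂ (· * ·) (m.2.1 x y) (n.2.1 x y), fun x => (m.2.2 x).mul (n.2.2 x)⟩

/-- The multiplication `𝒪(E) ⊗ 𝒪(E') → 𝒪(E + E')`, on presheaves. -/
noncomputable def mulHom (E E' : WeilDivisor X) :
    toPre (divisorialSheaf E) ⊗ toPre (divisorialSheaf E') ⟶ toPre (divisorialSheaf (E + E')) where
  app V := by
    refine ModuleCat.MonoidalCategory.tensorLift (R := X.presheaf.obj V)
      (M₁ := (toPre (divisorialSheaf E)).obj V) (M₂ := (toPre (divisorialSheaf E')).obj V)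
      (M₃ := (toPre (divisorialSheaf (E + E'))).obj V)
      (fun m n => mulSection (V := V.unop) m n) ?_ ?_ ?_ ?_
    · intro m₁ m₂ n
      exact Subtype.ext (funext fun x => add_mul _ _ _)
    · intro a m n
      exact Subtype.ext (funext fun x => mul_assoc _ _ _)
    · intro m n₁ n₂
      exact Subtype.ext (funext fun x => mul_add _ _ _)
    · intro a m n
      exact Subtype.ext (funext fun x => mul_left_comm _ _ _)
  naturality {V W} i := by
    refine ModuleCat.MonoidalCategory.tensor_ext (R := X.presheaf.obj V)
      (M₁ := (toPre (divisorialSheaf E)).obj V) (M₂ := (toPre (divisorialSheaf E')).obj V) ?_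
    intro m n
    rfl

theorem mulHom_tmul (E E' : WeilDivisor X) (V : X.Opens) (m : divisorialSections E V) (n : divisorialSections E' V) :
    (mulHom E E').app (op V) (m ⊗ₜ[Γ(X, V)] n : TensorProduct Γ(X, V) (divisorialSections E V) (divisorialSections E' V)) =
      mulSection m n := rfl

/-- Where `g` generates `𝒪(E)`, every tensor is pure with first factor `g`. Multiplication then
becomes `n ↦ g * n`, visibly injective. -/
theorem exists_tmul_eq {E E' : WeilDivisor X} {V : X.Opens} [hV : Nonempty V] {g : X.functionField} (hg0 : g ≠ 0)
    (hg : ∀ P : PrimeDivisor X, P.point ∈ V → Scheme.ord g P.point = - E P) (hgs : IsSectionOn E V g)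
    (z : TensorProduct Γ(X, V) (divisorialSections E V) (divisorialSections E' V)) :
    ∃ n, z = sectionOfFunction hgs ⊗ₜ[Γ(X, V)] n := by
  induction z with
  | zero => exact ⟨0, (TensorProduct.tmul_zero _ _).symm⟩
  | tmul m n =>
    obtain ⟨r, hr⟩ := exists_smul_eq_of_ord_eq hg0 hg (m.2.2 hV.some)
    have hm : m = r • sectionOfFunction hgs := Subtype.ext (funext fun x => (m.2.1 x hV.some).trans hr.symm)
    exact ⟨r • n, by rw [hm, TensorProduct.smul_tmul]⟩
  | add x y hx hy =>
    obtain ⟨a, rfl⟩ := hx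
    obtain ⟨b, rfl⟩ := hy
    exact ⟨a + b, (TensorProduct.tmul_add _ _ _).symm⟩

/-- Only one factor has to be locally principal: with a local generator `g` of `𝒪(E)`, a section `f`
of `𝒪(E + E')` is the product of `g` and `g⁻¹ * f`, and cancelling `g` gives injectivity. -/
theorem WeilDivisor.IsLocallyPrincipal.locBij_mulHom {E : WeilDivisor X} (hE : E.IsLocallyPrincipal) (E' : WeilDivisor X) :
    LocBij (mulHom E E') where
  inj := ⟨fun {V} a b h x hx => by
    obtain ⟨U, hxU, g, hg0, hg⟩ := hE x
    let W : X.Opens := V.unop ⊓ U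
    let i : W ⟶ V.unop := Opens.infLELeft _ _
    have hW : Nonempty W := ⟨⟨x, hx, hxU⟩⟩
    have hg' : ∀ Q : PrimeDivisor X, Q.point ∈ W → Scheme.ord g Q.point = - E Q := fun Q hQ => hg Q hQ.2
    have hgs : IsSectionOn E W g := Or.inr fun Q hQ => by rw [hg' Q hQ, neg_add_cancel]
    refine ⟨W, i, ?_, hx, hxU⟩
    let T := toPre (divisorialSheaf E) ⊗ toPre (divisorialSheaf E')
    have h1 : (mulHom E E').app (op W) (T.map i.op a) = (mulHom E E').app (op W) (T.map i.op b) :=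
      (PresheafOfModules.naturality_apply (mulHom E E') i.op a).trans
        ((congrArg ((toPre (divisorialSheaf (E + E'))).map i.op) h).trans
          (PresheafOfModules.naturality_apply (mulHom E E') i.op b).symm)
    change T.map i.op a = T.map i.op b
    obtain ⟨m, hm⟩ := exists_tmul_eq (E' := E') hg0 hg' hgs (T.map i.op a)
    obtain ⟨n, hn⟩ := exists_tmul_eq (E' := E') hg0 hg' hgs (T.map i.op b)
    have h2 : mulSection (sectionOfFunction hgs) m = mulSection (sectionOfFunction hgs) n :=
      (congrArg ((mulHom E E').app (op W)) hm).symm.trans (h1.trans (congrArg ((mulHom E E').app (op W)) hn))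
    have h3 : m = n := Subtype.ext (funext fun y => mul_left_cancel₀ hg0 (congrFun (congrArg Subtype.val h2) y))
    exact hm.trans (h3 ▸ hn.symm)⟩
  surj := ⟨fun {V} s x hx => by
    obtain ⟨U, hxU, g, hg0, hg⟩ := hE x
    let W : X.Opens := V ⊓ U
    let i : W ⟶ V := Opens.infLELeft _ _
    have hg' : ∀ Q : PrimeDivisor X, Q.point ∈ W → Scheme.ord g Q.point = - E Q := fun Q hQ => hg Q hQ.2
    have hgs : IsSectionOn E W g := Or.inr fun Q hQ => by rw [hg' Q hQ, neg_add_cancel]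
    let s' : divisorialSections (E + E') V := s
    let f := s'.1 ⟨x, hx⟩
    have hf : IsSectionOn E' W (g⁻¹ * f) := by
      by_cases hf0 : f = 0
      · exact Or.inl (by rw [hf0, mul_zero])
      refine Or.inr fun Q hQ => ?_
      have h1 := (s'.2.2 ⟨x, hx⟩).resolve_left hf0 Q hQ.1
      rw [Finsupp.add_apply] at h1
      rw [Scheme.ord_mul (inv_ne_zero hg0) hf0, Scheme.ord_inv, hg' Q hQ]
      change 0 ≤ Scheme.ord f Q.point + _ at h1
      linarith
    refine ⟨W, i, ⟨(sectionOfFunction hgs ⊗ₜ[Γ(X, W)] sectionOfFunction hf :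
      TensorProduct Γ(X, W) (divisorialSections E W) (divisorialSections E' W)), ?_⟩, hx, hxU⟩
    refine (mulHom_tmul E E' W (sectionOfFunction hgs) (sectionOfFunction hf)).trans ?_
    refine Subtype.ext (funext fun y => ?_)
    change g * (g⁻¹ * f) = s'.1 ⟨y.1, y.2.1⟩
    rw [mul_inv_cancel_left₀ hg0]
    exact s'.2.1 _ _⟩

omit [AlgebraicGeometry.IsIntegral X] [IsLocallyNoetherian X] [IsNormalScheme X] in
theorem LocBij.nonempty_iso {P : PresheafOfModules.{u} (X.presheaf ⋙ forget₂ CommRingCat RingCat)} {M : X.Modules}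
    {f : P ⟶ toPre M} (hf : LocBij f) : Nonempty (sheafify.obj P ≅ M) := by
  have := hf.isIso_sheafify
  exact ⟨asIso (sheafify.map f) ≪≫ sheafifyToPre _⟩

theorem WeilDivisor.IsLocallyPrincipal.tensor_iso {E : WeilDivisor X} (hE : E.IsLocallyPrincipal) (E' : WeilDivisor X) :
    Nonempty (tensor (divisorialSheaf E) (divisorialSheaf E') ≅ divisorialSheaf (E + E')) :=
  (hE.locBij_mulHom E').nonempty_iso

end RigidDivisors

end

/-! ### The Picard group and the exact sequence -/

section

open CategoryTheory Opposite AlgebraicGeometry RigidDivisors TopologicalSpace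

universe u

namespace RigidDivisors

theorem IsoClass.restrict_id {X : Scheme.{u}} (c : IsoClass X) : IsoClass.restrict (𝟙 X) c = c := by
  obtain ⟨M⟩ := c
  exact Quotient.sound ⟨(Scheme.Modules.restrictFunctorId (X := X)).app M⟩

variable {X Y : Scheme.{u}} [AlgebraicGeometry.IsIntegral X] [IsLocallyNoetherian X] [IsNormalScheme X]

theorem restrict_mk_divisorialSheaf_eq_one (j : Y ⟶ X) [IsOpenImmersion j] {E : WeilDivisor X} {s : X.functionField} (hs : s ≠ 0)
    (hsE : ∀ P : PrimeDivisor X, P.point ∈ Set.range j → Scheme.ord s P.point = - E P) :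
    IsoClass.restrict j (IsoClass.mk (divisorialSheaf E)) = 1 :=
  Quotient.sound (Nonempty.map Iso.symm (structureModule_iso_divisorialSheaf j hs hsE))

theorem mk_divisorialSheaf_eq_one {E : WeilDivisor X} {s : X.functionField} (hs : s ≠ 0)
    (hsE : ∀ P : PrimeDivisor X, Scheme.ord s P.point = - E P) : IsoClass.mk (divisorialSheaf E) = 1 := by
  rw [← IsoClass.restrict_id (IsoClass.mk _)]
  exact restrict_mk_divisorialSheaf_eq_one (𝟙 X) hs fun P _ => hsE P

theorem mk_divisorialSheaf_zero : IsoClass.mk (divisorialSheaf (0 : WeilDivisor X)) = 1 :=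
  mk_divisorialSheaf_eq_one (s := 1) one_ne_zero fun P => by rw [Scheme.ord_one]; simp

theorem exists_ord_eq_of_restrict_eq_one (j : Y ⟶ X) [IsOpenImmersion j] [Nonempty Y] {E : WeilDivisor X} (hE : E.IsLocallyPrincipal)
    (h : IsoClass.restrict j (IsoClass.mk (divisorialSheaf E)) = 1) :
    ∃ s : X.functionField, s ≠ 0 ∧ ∀ P : PrimeDivisor X, P.point ∈ Set.range j → Scheme.ord s P.point = - E P :=
  exists_ord_eq_of_iso j hE (Quotient.exact h).some.symm

theorem WeilDivisor.IsLocallyPrincipal.mk_add {E : WeilDivisor X} (hE : E.IsLocallyPrincipal) (E' : WeilDivisor X) :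
    IsoClass.mk (divisorialSheaf (E + E')) = IsoClass.mk (divisorialSheaf E) * IsoClass.mk (divisorialSheaf E') :=
  Quotient.sound ((hE.tensor_iso E').map Iso.symm)

theorem WeilDivisor.IsLocallyPrincipal.locallyTrivial {E : WeilDivisor X} (hE : E.IsLocallyPrincipal) :
    (IsoClass.mk (divisorialSheaf E)).LocallyTrivial := fun x =>
  let ⟨U, hxU, g, hg0, hg⟩ := hE x
  ⟨U, hxU, restrict_mk_divisorialSheaf_eq_one U.ι hg0 fun P hP => hg P (by simpa using hP)⟩

theorem IsoClass.LocallyTrivial.exists_divisorialSheaf [CompactSpace X] [Nonempty Y] (j : Y ⟶ X) [IsOpenImmersion j]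
    {c : IsoClass Y} (hc : c.LocallyTrivial) :
    ∃ E : WeilDivisor X, c = IsoClass.restrict j (IsoClass.mk (divisorialSheaf E)) := by
  obtain ⟨M⟩ := c
  obtain ⟨E, hE⟩ := exists_iso_divisorialSheaf j (M := M) fun y => by
    obtain ⟨V, hyV, hV⟩ := hc y
    obtain ⟨t, ht⟩ := exists_isGenerator_of_iso V.ι (M := M) (Quotient.exact hV).some.symm
    exact ⟨_, t, ⟨⟨y, hyV⟩, trivial, rfl⟩, ht⟩
  exact ⟨E, Quotient.sound hE⟩

/-- The class of `𝒪(E)` in the Picard group, when all divisors are locally principal. -/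
noncomputable def picardClass (h : ∀ E : WeilDivisor X, E.IsLocallyPrincipal) : WeilDivisor X →+ Additive (Pic X) where
  toFun E := Additive.ofMul ⟨⟨IsoClass.mk (divisorialSheaf E), IsoClass.mk (divisorialSheaf (-E)),
    by rw [← (h E).mk_add, add_neg_cancel, mk_divisorialSheaf_zero],
    by rw [← (h (-E)).mk_add, neg_add_cancel, mk_divisorialSheaf_zero]⟩, (h E).locallyTrivial⟩
  map_zero' := Additive.toMul.injective (Subtype.ext (Units.ext mk_divisorialSheaf_zero))
  map_add' E E' := Additive.toMul.injective (Subtype.ext (Units.ext ((h E).mk_add E')))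

theorem coe_picardClass (h : ∀ E : WeilDivisor X, E.IsLocallyPrincipal) (E : WeilDivisor X) :
    (((picardClass h E).toMul : (IsoClass X)ˣ) : IsoClass X) = IsoClass.mk (divisorialSheaf E) := rfl

omit [AlgebraicGeometry.IsIntegral X] [IsLocallyNoetherian X] [IsNormalScheme X] in
theorem Pic.additive_ext {a b : Additive (Pic X)}
    (h : ((a.toMul : (IsoClass X)ˣ) : IsoClass X) = ((b.toMul : (IsoClass X)ˣ) : IsoClass X)) : a = b :=
  Additive.toMul.injective (Subtype.ext (Units.ext h))

/-- A trivializing function has divisor `-E`, so its inverse is the function with divisor `E`. -/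
theorem picardClass_eq_zero_iff (h : ∀ E : WeilDivisor X, E.IsLocallyPrincipal) (E : WeilDivisor X) :
    picardClass h E = 0 ↔ IsPrincipal E := by
  constructor
  · intro hE
    have h1 : IsoClass.mk (divisorialSheaf E) = 1 :=
      congrArg (fun a : Additive (Pic X) => ((a.toMul : (IsoClass X)ˣ) : IsoClass X)) hE
    obtain ⟨s, hs, hsE⟩ := exists_ord_eq_of_restrict_eq_one (𝟙 X) (h E) (by rw [h1, map_one])
    exact ⟨s⁻¹, inv_ne_zero hs, fun P => by rw [Scheme.ord_inv, hsE P ⟨P.point, rfl⟩, neg_neg]⟩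
  · rintro ⟨f, hf, hE⟩
    exact Pic.additive_ext (mk_divisorialSheaf_eq_one (inv_ne_zero hf) fun P => by rw [Scheme.ord_inv, hE])

theorem picardClass_surjective [CompactSpace X] (h : ∀ E : WeilDivisor X, E.IsLocallyPrincipal) :
    Function.Surjective (picardClass h) := by
  intro a
  obtain ⟨E, hE⟩ := IsoClass.LocallyTrivial.exists_divisorialSheaf (𝟙 X) a.toMul.2
  exact ⟨E, Pic.additive_ext (by rw [hE, IsoClass.restrict_id, coe_picardClass])⟩

theorem restrict_picardClass_eq_zero_iff (h : ∀ E : WeilDivisor X, E.IsLocallyPrincipal) (E : WeilDivisor X)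
    (U : X.Opens) [Nonempty U] :
    MonoidHom.toAdditive (Pic.restrict U.ι) (picardClass h E) = 0 ↔
      ∃ s : X.functionField, s ≠ 0 ∧ ∀ P : PrimeDivisor X, P.point ∈ U → Scheme.ord s P.point = - E P := by
  constructor
  · intro h0
    have h1 : IsoClass.restrict U.ι (IsoClass.mk (divisorialSheaf E)) = 1 :=
      congrArg (fun a : Additive (Pic U) => ((a.toMul : (IsoClass U)ˣ) : IsoClass U)) h0
    obtain ⟨s, hs, hsE⟩ := exists_ord_eq_of_restrict_eq_one U.ι (h E) h1
    exact ⟨s, hs, fun P hP => hsE P (by simpa using hP)⟩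
  · rintro ⟨s, hs, hsE⟩
    exact Additive.toMul.injective (Subtype.ext (Units.ext
      (restrict_mk_divisorialSheaf_eq_one U.ι hs fun P hP => hsE P (by simpa using hP))))

/-- An invertible sheaf on `U` is the restriction of some `𝒪(E)` with `E` a divisor on `X`, and that
sheaf is invertible on all of `X` because `E` is locally principal. -/
theorem restrict_surjective [CompactSpace X] (h : ∀ E : WeilDivisor X, E.IsLocallyPrincipal) (U : X.Opens) [Nonempty U] :
    Function.Surjective (MonoidHom.toAdditive (Pic.restrict U.ι)) := by
  intro a
  obtain ⟨E, hE⟩ := IsoClass.LocallyTrivial.exists_divisorialSheaf U.ι a.toMul.2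
  exact ⟨picardClass h E, Additive.toMul.injective (Subtype.ext (Units.ext hE.symm))⟩

omit [AlgebraicGeometry.IsIntegral X] [IsLocallyNoetherian X] [IsNormalScheme X] in
theorem mem_range_componentDivisor {D : QDivisor X} {E : WeilDivisor X} (hE : E.support ⊆ D.support) :
    ∃ n, componentDivisor D n = E := by
  refine ⟨E.comapDomain Subtype.val Subtype.val_injective.injOn, ?_⟩
  exact Finsupp.mapDomain_comapDomain _ Subtype.val_injective _ (fun P hP => ⟨⟨P, hE hP⟩, rfl⟩)

theorem exact_picardClass_componentDivisor [CompactSpace X] (h : ∀ E : WeilDivisor X, E.IsLocallyPrincipal) (D : QDivisor X) :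
    Function.Exact ((picardClass h).comp (componentDivisor D))
      (MonoidHom.toAdditive (Pic.restrict (supportComplement D).ι)) := by
  classical
  have hne : Nonempty (supportComplement D) := ⟨⟨_, genericPoint_mem_supportComplement D⟩⟩
  intro a
  obtain ⟨E, rfl⟩ := picardClass_surjective h a
  rw [restrict_picardClass_eq_zero_iff]
  constructor
  · rintro ⟨s, hs, hsE⟩
    -- `F` is `E + div s`. As `s` has divisor `-E` on the complement, `F` is supported on the
    -- support of `D`; building this into the definition makes the finiteness and the support
    -- condition immediate.
    let F : WeilDivisor X := Finsupp.onFinset D.support (fun P => if P ∈ D.support then E P + Scheme.ord s P.point else 0)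
      fun P hP => by by_contra h'; exact hP (if_neg h')
    obtain ⟨n, hn⟩ := mem_range_componentDivisor (D := D) (E := F) Finsupp.support_onFinset_subset
    refine ⟨n, ?_⟩
    rw [AddMonoidHom.comp_apply, hn, ← sub_eq_zero, ← map_sub, picardClass_eq_zero_iff]
    refine ⟨s, hs, fun P => ?_⟩
    change (if P ∈ D.support then E P + Scheme.ord s P.point else 0) - E P = _
    split_ifs with hP
    · rw [add_sub_cancel_left]
    · rw [hsE P (P.mem_supportComplement_iff.mpr hP), zero_sub]
  · rintro ⟨n, hn⟩
    rw [AddMonoidHom.comp_apply, ← sub_eq_zero, ← map_sub, picardClass_eq_zero_iff] at hn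
    obtain ⟨s, hs, hsE⟩ := hn
    refine ⟨s, hs, fun P hP => ?_⟩
    have h0 : componentDivisor D n P = 0 := Finsupp.notMem_support_iff.mp fun h' =>
      P.mem_supportComplement_iff.mp hP (support_componentDivisor_subset D n h')
    rw [← hsE, Finsupp.sub_apply, h0, zero_sub]

section Complex
variable {X : Scheme.{0}} [X.Over (Spec (.of ℂ))] [AlgebraicGeometry.IsIntegral X] [IsLocallyNoetherian X] [IsNormalScheme X]

theorem WeilDivisor.isLocallyPrincipal_of_smooth (hs : Smooth (X ↘ Spec (.of ℂ))) (E : WeilDivisor X) : E.IsLocallyPrincipal :=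
  -- The sign is that of a local generator of `𝒪(E)`, which has divisor `-E`.
  fun x => WeilDivisor.exists_ord_eq (exists_isRegularRing_of_smooth (X ↘ Spec (.of ℂ))) (-E) x

end Complex

end RigidDivisors

end

theorem mainTheorem11 (X : Scheme.{0}) [X.Over (Spec (.of ℂ))] [AlgebraicGeometry.IsIntegral X]
    [IsLocallyNoetherian X] [IsNormalScheme X] (hX : IsProjective X) :
    (∀ D : QDivisor X, 0 ≤ D →
      (IsRigid D ↔
        ∃ (l : ℕ) (P : Fin l → PrimeDivisor X) (r : Fin l → ℚ),
          Function.Injective P ∧ (∀ i, 0 < r i) ∧ D = ∑ i, Finsupp.single (P i) (r i) ∧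
            ∀ n : Fin l → ℕ,
              Module.finrank ℂ (H0 (∑ i, Finsupp.single (P i) (n i : ℤ) : WeilDivisor X)) = 1)) ∧
    (∀ D : QDivisor X, IsRigid D →
      ∀ n : D.support →₀ ℤ, IsPrincipal (componentDivisor D n) ↔ n = 0) ∧
    (Smooth (X ↘ Spec (.of ℂ)) → ∀ D : QDivisor X, IsRigid D →
      ∃ φ : (D.support →₀ ℤ) →+ Additive (Pic X),
        (∀ n, (((φ n).toMul : (IsoClass X)ˣ) : IsoClass X) =
          IsoClass.mk (divisorialSheaf (componentDivisor D n))) ∧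
        Function.Injective φ ∧
        Function.Exact φ (MonoidHom.toAdditive (Pic.restrict (supportComplement D).ι)) ∧
        Function.Surjective (MonoidHom.toAdditive (Pic.restrict (supportComplement D).ι))) := by
  refine ⟨fun D hD => hX.isRigid_iff hD, fun D hD n => hX.isPrincipal_componentDivisor_iff hD n, fun hs D hD => ?_⟩
  have := hX.compactSpace
  have hne : Nonempty (supportComplement D) := ⟨⟨_, genericPoint_mem_supportComplement D⟩⟩
  have h := WeilDivisor.isLocallyPrincipal_of_smooth hs
  refine ⟨(picardClass h).comp (componentDivisor D), fun n => rfl, ?_, exact_picardClass_componentDivisor h D,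
    restrict_surjective h _⟩
  -- A combination of components with trivial class is principal, hence zero by (b).
  rw [injective_iff_map_eq_zero]
  intro n hn
  exact (hX.isPrincipal_componentDivisor_iff hD n).mp ((picardClass_eq_zero_iff h _).mp hn)
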